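/- Let $\mathfrak g$ be a split real form of a complex simple Lie algebra, $\theta$ a Cartan involution of $\mathfrak g$, $\mathfrak k=\{X:\theta X=X\}$, and $\mathfrak a$ a split Cartan subalgebra of $\mathfrak g$ on which $\theta=-1$. Choose a simple system $\Sigma$ of the roots of $(\mathfrak g,\mathfrak a)$ and put $\mathfrak n^-=\sum_{\alpha<0}\mathfrak g_\alpha$. Let $K$ be the subgroup of $\mathrm{Aut}(\mathfrak g)$ generated by $\exp(\mathrm{ad}\,X)$, $X\in\mathfrak k$ (the maximal compact subgroup of the group of inner automorphisms), let $M$ be the centralizer of $\mathfrak a$ in $K$, and let $\mathbb F=K/M$ be the maximal real flag. Its tangent space at the origin $b=eM$ is identified, as an $M$-module, with $\mathfrak n^-$ (adjoint action), and its tangent bundle with $K\times_M\mathfrak n^-$. A $K$-invariant almost complex structure on $\mathbb F$ is a $K$-invariant field $J$ of endomorphisms of the tangent spaces with $J^2=-1$. It is called integrable (in the sense used here) if its value $J:\mathfrak n^-\to\mathfrak n^-$ at the origin satisfies $$N_J(X,Y):=[JX,JY]-[X,Y]-J[JX,Y]-J[X,JY]=0\qquad\text{for all }X,Y\in\mathfrak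 n^-,$$ the brackets being those of the Lie algebra $\mathfrak n^-$. Then $\mathbb F$ admits a $K$-invariant almost complex structure if and only if $\mathfrak g$ is of type $A_3$, $B_2$, $G_2$, $C_l$ with $l\ge 2$ even, or $D_l$ with $l\ge 4$. None of these structures is integrable in the above sense. -/

import Mathlib

open scoped TensorProduct
open LieModule LieAlgebra.IsKilling

namespace RealFlag

/-! ### Real forms

A real Lie algebra `𝔤` is a real form of the complex Lie algebra `ℂ ⊗[ℝ] 𝔤`. The lemmas of this
section show that `𝔤` is simple as soon as its complexification is, so that Mathlib's theory of
root systems of Lie algebras applies to `𝔤`. -/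

section RealForm

variable (𝔤 : Type*) [LieRing 𝔤] [LieAlgebra ℝ 𝔤]

/-- The real part `ℂ ⊗ 𝔤 → 𝔤`, `z ⊗ x ↦ Re z • x` (used only in the next lemmas). -/
noncomputable def realPart : ℂ ⊗[ℝ] 𝔤 →ₗ[ℝ] 𝔤 :=
  (TensorProduct.lid ℝ 𝔤).toLinearMap ∘ₗ Complex.reLm.rTensor 𝔤

variable {𝔤}

lemma realPart_tmul (z : ℂ) (x : 𝔤) : realPart 𝔤 (z ⊗ₜ x) = z.re • x := by
  simp [realPart]

lemma realPart_mem (I : LieIdeal ℝ 𝔤) {m : ℂ ⊗[ℝ] 𝔤} (hm : m ∈ I.baseChange ℂ) :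
    realPart 𝔤 m ∈ I := by
  rw [LieSubmodule.mem_baseChange_iff] at hm
  have h : ∀ z : ℂ, realPart 𝔤 (z • m) ∈ I := by
    induction hm using Submodule.span_induction with
    | mem y hy =>
      obtain ⟨x, hx, rfl⟩ := hy
      intro z
      have : z • (TensorProduct.mk ℝ ℂ 𝔤 1) x = z ⊗ₜ[ℝ] x := by simp [TensorProduct.smul_tmul']
      rw [this, realPart_tmul]
      exact I.smul_mem _ hx
    | zero => intro z; simp
    | add y y' _ _ h h' => intro z; rw [smul_add, map_add]; exact I.add_mem (h z) (h' z)
    | smul c y _ h => intro z; rw [smul_smul]; exact h _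
  simpa using h 1

instance isSimple_of_complexification [LieAlgebra.IsSimple ℂ (ℂ ⊗[ℝ] 𝔤)] :
    LieAlgebra.IsSimple ℝ 𝔤 where
  eq_bot_or_eq_top I := by
    rcases LieAlgebra.IsSimple.eq_bot_or_eq_top (R := ℂ) (I.baseChange ℂ) with h | h
    · left
      rw [eq_bot_iff]
      intro x hx
      have hx' := LieSubmodule.tmul_mem_baseChange_of_mem (A := ℂ) (1 : ℂ) hx
      rw [h, LieSubmodule.mem_bot] at hx'
      have := realPart_tmul 1 x
      rw [hx'] at this
      simpa using this.symm
    · right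
      rw [eq_top_iff]
      intro x _
      have hx : (1 : ℂ) ⊗ₜ[ℝ] x ∈ I.baseChange ℂ := by rw [h]; exact LieSubmodule.mem_top _
      simpa [realPart_tmul] using realPart_mem I hx
  non_abelian h := by
    apply LieAlgebra.IsSimple.non_abelian (R := ℂ) (L := ℂ ⊗[ℝ] 𝔤)
    refine ⟨fun x y ↦ ?_⟩
    induction x using TensorProduct.induction_on with
    | zero => simp
    | add x x' hx hx' => rw [add_lie, hx, hx', add_zero]
    | tmul s x =>
      induction y using TensorProduct.induction_on with
      | zero => simp
      | add y y' hy hy' => rw [lie_add, hy, hy', add_zero]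
      | tmul t y => rw [LieAlgebra.ExtendScalars.bracket_tmul, trivial_lie_zero, TensorProduct.tmul_zero]

end RealForm

/-! ### The group `K`, its subgroup `M` and the maximal flag `K / M` -/

section Group

variable {𝔤 : Type*} [LieRing 𝔤] [LieAlgebra ℝ 𝔤]

/-- The automorphisms of a Lie algebra form a group under composition. -/
instance autGroup : Group (𝔤 ≃ₗ⁅ℝ⁆ 𝔤) where
  mul φ ψ := ψ.trans φ
  one := 1
  inv φ := φ.symm
  mul_assoc _ _ _ := rfl
  one_mul _ := rfl
  mul_one _ := rfl
  inv_mul_cancel φ := LieEquiv.self_trans_symm φ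

/-- A Cartan involution `θ` of `𝔤`: an involutive automorphism for which `-κ(X, θ Y)` is positive
definite, `κ` being the Killing form. Its fixed points form `𝔨`. -/
structure IsCartanInvolution (θ : 𝔤 ≃ₗ⁅ℝ⁆ 𝔤) : Prop where
  involutive : ∀ X, θ (θ X) = X
  killing_neg : ∀ X, X ≠ 0 → killingForm ℝ 𝔤 X (θ X) < 0

/-- The exponential of an endomorphism of a finite-dimensional real vector space, computed as a
matrix exponential in a basis (the result does not depend on the basis). -/
noncomputable def expEnd {V : Type*} [AddCommGroup V] [Module ℝ V] [FiniteDimensional ℝ V]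
    (T : Module.End ℝ V) : Module.End ℝ V :=
  (LinearMap.toMatrixAlgEquiv (Module.finBasis ℝ V)).symm
    (NormedSpace.exp (LinearMap.toMatrixAlgEquiv (Module.finBasis ℝ V) T))

variable [FiniteDimensional ℝ 𝔤]

/-- The maximal compact subgroup `K` of the group of inner automorphisms of `𝔤`: the group
generated by the automorphisms `exp (ad X)` with `X` in `𝔨 = {X | θ X = X}`. -/
def maximalCompact (θ : 𝔤 ≃ₗ⁅ℝ⁆ 𝔤) : Subgroup (𝔤 ≃ₗ⁅ℝ⁆ 𝔤) :=
  Subgroup.closure {φ | ∃ X : 𝔤, θ X = X ∧ ∀ Y, φ Y = expEnd (LieAlgebra.ad ℝ 𝔤 X) Y}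

/-- The centralizer `M` of `𝔞` in `K`. -/
def centralizerM (θ : 𝔤 ≃ₗ⁅ℝ⁆ 𝔤) (𝔞 : LieSubalgebra ℝ 𝔤) : Subgroup (maximalCompact θ) where
  carrier := {m | ∀ H ∈ 𝔞, m.1 H = H}
  mul_mem' {m n} hm hn H hH := by
    change m.1 (n.1 H) = H
    rw [hn H hH, hm H hH]
  one_mem' H _ := rfl
  inv_mem' {m} hm H hH := by
    change m.1.symm H = H
    rw [LieEquiv.symm_apply_eq, hm H hH]

/-- The maximal flag `𝔽 = K / M`, with its left action of `K`. -/
abbrev MaximalFlag (θ : 𝔤 ≃ₗ⁅ℝ⁆ 𝔤) (𝔞 : LieSubalgebra ℝ 𝔤) : Type _ :=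
  maximalCompact θ ⧸ centralizerM θ 𝔞

/-- The origin `b = eM` of the maximal flag. -/
def origin (θ : 𝔤 ≃ₗ⁅ℝ⁆ 𝔤) (𝔞 : LieSubalgebra ℝ 𝔤) : MaximalFlag θ 𝔞 :=
  ((1 : maximalCompact θ) : MaximalFlag θ 𝔞)

end Group

/-! ### The nilpotent algebra `𝔫⁻` and the tangent bundle of the maximal flag -/

section Flag

variable {𝔤 : Type*} [LieRing 𝔤] [LieAlgebra ℝ 𝔤] [FiniteDimensional ℝ 𝔤]
  [LieAlgebra.IsKilling ℝ 𝔤] {𝔞 : LieSubalgebra ℝ 𝔤} [𝔞.IsCartanSubalgebra]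
  [LieModule.IsTriangularizable ℝ 𝔞 𝔤]

/-- The sum of the root spaces `𝔤_{-α}`, `α` running through the roots that are positive for the
simple system `b`. -/
noncomputable def negSum (b : (rootSystem 𝔞).Base) : Submodule ℝ 𝔤 :=
  ⨆ (α : 𝔞.root) (_ : b.IsPos α), (weightSpace 𝔤 (-(α.1 : 𝔞 → ℝ))).toSubmodule

lemma lie_mem_negSum (b : (rootSystem 𝔞).Base) {X Y : 𝔤}
    (hX : X ∈ negSum b) (hY : Y ∈ negSum b) : ⁅X, Y⁆ ∈ negSum b := by
  have key : ∀ (α β : 𝔞.root), b.IsPos α → b.IsPos β → ∀ X Y : 𝔤,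
      X ∈ weightSpace 𝔤 (-(α.1 : 𝔞 → ℝ)) → Y ∈ weightSpace 𝔤 (-(β.1 : 𝔞 → ℝ)) →
      ⁅X, Y⁆ ∈ negSum b := by
    intro α β hα hβ X Y hX hY
    by_cases h0 : ⁅X, Y⁆ = 0
    · rw [h0]; exact zero_mem _
    rw [mem_weightSpace] at hX hY
    have hXY : ⁅X, Y⁆ ∈ weightSpace 𝔤 (-((α.1 : 𝔞 → ℝ) + (β.1 : 𝔞 → ℝ))) := by
      rw [mem_weightSpace]
      intro H
      have hX' : ⁅(H : 𝔤), X⁆ = (-(α.1 : 𝔞 → ℝ)) H • X := hX H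
      have hY' : ⁅(H : 𝔤), Y⁆ = (-(β.1 : 𝔞 → ℝ)) H • Y := hY H
      change ⁅(H : 𝔤), ⁅X, Y⁆⁆ = _
      rw [leibniz_lie, hX', hY', smul_lie, lie_smul, ← add_smul]
      congr 1
      simp; ring
    let δ : Weight ℝ 𝔞 𝔤 := ⟨_, fun h ↦ h0 (by
      have := weightSpace_le_genWeightSpace 𝔤 _ hXY
      rwa [h, LieSubmodule.mem_bot] at this)⟩
    have hδ : ∀ H, (-δ) H = α.1 H + β.1 H := fun H ↦ by
      rw [Weight.coe_neg]; simp [δ, Weight.coe_weight_mk, add_comm]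
    have hne : (-δ).IsNonZero := by
      intro hz
      have hz' : ∀ H, α.1 H + β.1 H = 0 := fun H ↦ by
        rw [← hδ H]; exact congrFun hz H
      have hβα : β = (rootSystem 𝔞).reflectionPerm α α := by
        apply (rootSystem 𝔞).root.injective
        rw [RootPairing.root_reflectionPerm, RootPairing.reflection_apply_self]
        ext H
        simp only [rootSystem_root_apply, LinearMap.neg_apply, Weight.toLinear_apply]
        linarith [hz' H]
      rw [hβα] at hβ
      exact (RootPairing.Base.IsPos.neg_iff_not b α).mp hβ hα
    let γ : 𝔞.root := ⟨-δ, by simpa [LieSubalgebra.root] using hne⟩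
    have hγ : b.IsPos γ := RootPairing.Base.IsPos.add hα hβ (by
      ext H; exact hδ H)
    have hle : (weightSpace 𝔤 (-(γ.1 : 𝔞 → ℝ))).toSubmodule ≤ negSum b :=
      le_iSup₂_of_le γ hγ le_rfl
    apply hle
    have : (-(γ.1 : 𝔞 → ℝ)) = -((α.1 : 𝔞 → ℝ) + (β.1 : 𝔞 → ℝ)) := by
      ext H; exact congrArg Neg.neg (hδ H)
    rw [this]; exact hXY
  have h1 : ∀ (α : 𝔞.root), b.IsPos α → ∀ X ∈ weightSpace 𝔤 (-(α.1 : 𝔞 → ℝ)),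
      ∀ Y ∈ negSum b, ⁅X, Y⁆ ∈ negSum b := by
    intro α hα X hX Y hY
    have hle : negSum b ≤ (negSum b).comap (LieAlgebra.ad ℝ 𝔤 X : 𝔤 →ₗ[ℝ] 𝔤) :=
      iSup₂_le fun β hβ Y hY ↦ key α β hα hβ X Y hX hY
    exact hle hY
  have hle : negSum b ≤ (negSum b).comap (LieAlgebra.ad ℝ 𝔤 Y : 𝔤 →ₗ[ℝ] 𝔤) :=
    iSup₂_le fun α hα X hX ↦ by
      change ⁅Y, X⁆ ∈ negSum b
      rw [← lie_skew]
      exact neg_mem (h1 α hα X hX Y hY)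
  have := hle hX
  rw [← lie_skew]
  exact neg_mem this

/-- The nilpotent subalgebra `𝔫⁻` of `𝔤`, the sum of the root spaces of the negative roots. -/
noncomputable def nMinus (b : (rootSystem 𝔞).Base) : LieSubalgebra ℝ 𝔤 :=
  { negSum b with lie_mem' := fun hX hY ↦ lie_mem_negSum b hX hY }

/-- Elements of `M` map `𝔫⁻` into itself. -/
lemma map_mem_negSum {θ : 𝔤 ≃ₗ⁅ℝ⁆ 𝔤} (b : (rootSystem 𝔞).Base) {m : maximalCompact θ}
    (hm : m ∈ centralizerM θ 𝔞) {X : 𝔤} (hX : X ∈ negSum b) : m.1 X ∈ negSum b := by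
  have hle : negSum b ≤ (negSum b).comap (m.1 : 𝔤 →ₗ[ℝ] 𝔤) := by
    refine iSup₂_le fun α hα X hX ↦ ?_
    refine (le_iSup₂_of_le (f := fun (α : 𝔞.root) (_ : b.IsPos α) ↦
      (weightSpace 𝔤 (-(α.1 : 𝔞 → ℝ))).toSubmodule) α hα le_rfl) ?_
    change m.1 X ∈ weightSpace 𝔤 (-(α.1 : 𝔞 → ℝ))
    rw [mem_weightSpace]
    intro H
    have hX' : ⁅(H : 𝔤), X⁆ = (-(α.1 : 𝔞 → ℝ)) H • X := (mem_weightSpace _ _).mp hX H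
    change ⁅(H : 𝔤), m.1 X⁆ = _
    conv_lhs => rw [← hm H.1 H.2]
    rw [← LieEquiv.map_lie, hX', map_smul]
  exact hle hX

/-- The tangent bundle of the maximal flag. The isotropy representation of `M` on the tangent
space at the origin is the adjoint action on `𝔫⁻`, and the tangent bundle of `K / M` is the
associated bundle `K ×_M 𝔫⁻`: the tangent space at `kM` is the subspace `k 𝔫⁻` of `𝔤`. -/
noncomputable def tangent (θ : 𝔤 ≃ₗ⁅ℝ⁆ 𝔤) (b : (rootSystem 𝔞).Base) (x : MaximalFlag θ 𝔞) : Submodule ℝ 𝔤 :=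
  Quotient.liftOn' x (fun k ↦ (nMinus b).toSubmodule.map (k.1 : 𝔤 →ₗ[ℝ] 𝔤)) (by
    have key : ∀ k k' : maximalCompact θ, k⁻¹ * k' ∈ centralizerM θ 𝔞 →
        (nMinus b).toSubmodule.map (k'.1 : 𝔤 →ₗ[ℝ] 𝔤) ≤
          (nMinus b).toSubmodule.map (k.1 : 𝔤 →ₗ[ℝ] 𝔤) := by
      rintro k k' h _ ⟨X, hX, rfl⟩
      refine ⟨(k⁻¹ * k').1 X, map_mem_negSum b h hX, ?_⟩
      change k.1 (k.1.symm (k'.1 X)) = k'.1 X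
      exact LieEquiv.apply_symm_apply _ _
    intro k k' h
    have h' : k⁻¹ * k' ∈ centralizerM θ 𝔞 := QuotientGroup.leftRel_apply.mp h
    refine le_antisymm (key k' k ?_) (key k k' h')
    have := (centralizerM θ 𝔞).inv_mem h'
    rwa [mul_inv_rev, inv_inv] at this)

lemma tangent_mk (θ : 𝔤 ≃ₗ⁅ℝ⁆ 𝔤) (b : (rootSystem 𝔞).Base) (k : maximalCompact θ) :
    tangent θ b (k : MaximalFlag θ 𝔞) = (nMinus b).toSubmodule.map (k.1 : 𝔤 →ₗ[ℝ] 𝔤) := rfl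

lemma tangent_origin (θ : 𝔤 ≃ₗ⁅ℝ⁆ 𝔤) (b : (rootSystem 𝔞).Base) :
    tangent θ b (origin θ 𝔞) = (nMinus b).toSubmodule := by
  rw [origin, tangent_mk]
  exact Submodule.map_id _

lemma apply_mem_tangent (θ : 𝔤 ≃ₗ⁅ℝ⁆ 𝔤) (b : (rootSystem 𝔞).Base) (k : maximalCompact θ)
    (x : MaximalFlag θ 𝔞) {v : 𝔤} (hv : v ∈ tangent θ b x) : k.1 v ∈ tangent θ b (k • x) := by
  induction x using QuotientGroup.induction_on with
  | H g =>
    obtain ⟨X, hX, rfl⟩ := hv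
    exact ⟨X, hX, rfl⟩

/-- The differential at `x` of the action of `k ∈ K` on the maximal flag. -/
noncomputable def tangentMap (θ : 𝔤 ≃ₗ⁅ℝ⁆ 𝔤) (b : (rootSystem 𝔞).Base) (k : maximalCompact θ)
    (x : MaximalFlag θ 𝔞) : tangent θ b x →ₗ[ℝ] tangent θ b (k • x) :=
  (k.1 : 𝔤 →ₗ[ℝ] 𝔤).restrict fun _ hv ↦ apply_mem_tangent θ b k x hv

/-- A `K`-invariant almost complex structure on the maximal flag `K / M`: a field of endomorphisms
of the tangent spaces with `J² = -1` that commutes with the differentials of the action of `K`.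
Being an invariant section of a homogeneous vector bundle, such a field is automatically smooth. -/
structure InvariantAlmostComplexStructure (θ : 𝔤 ≃ₗ⁅ℝ⁆ 𝔤) (b : (rootSystem 𝔞).Base) where
  J : ∀ x : MaximalFlag θ 𝔞, tangent θ b x →ₗ[ℝ] tangent θ b x
  sq : ∀ x v, J x (J x v) = -v
  invariant : ∀ (k : maximalCompact θ) x v,
    J (k • x) (tangentMap θ b k x v) = tangentMap θ b k x (J x v)

namespace InvariantAlmostComplexStructure

variable {θ : 𝔤 ≃ₗ⁅ℝ⁆ 𝔤} {b : (rootSystem 𝔞).Base}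

/-- The endomorphism of `𝔫⁻`, the tangent space at the origin, given by an invariant almost
complex structure. -/
noncomputable def atOrigin (𝒥 : InvariantAlmostComplexStructure θ b) : nMinus b →ₗ[ℝ] nMinus b :=
  (LinearEquiv.ofEq _ _ (tangent_origin θ b)).toLinearMap ∘ₗ 𝒥.J (origin θ 𝔞) ∘ₗ
    (LinearEquiv.ofEq _ _ (tangent_origin θ b).symm).toLinearMap

/-- The expression `N_J(X, Y) = [JX, JY] - [X, Y] - J[JX, Y] - J[X, JY]` for an endomorphism `J` of
a Lie algebra. -/
def nijenhuis {𝔫 : Type*} [LieRing 𝔫] [LieAlgebra ℝ 𝔫] (J : 𝔫 →ₗ[ℝ] 𝔫) (X Y : 𝔫) : 𝔫 :=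
  ⁅J X, J Y⁆ - ⁅X, Y⁆ - J ⁅J X, Y⁆ - J ⁅X, J Y⁆

/-- Integrability of an invariant almost complex structure, defined by the vanishing of
`N_J(X, Y)` for all `X, Y ∈ 𝔫⁻`, where `J : 𝔫⁻ → 𝔫⁻` is its value at the origin and the brackets
are those of `𝔫⁻`. -/
def IsIntegrable (𝒥 : InvariantAlmostComplexStructure θ b) : Prop :=
  ∀ X Y : nMinus b, nijenhuis 𝒥.atOrigin X Y = 0

end InvariantAlmostComplexStructure

/-- The simple system `b` has the Cartan matrix `A`, up to a numbering of the simple roots. -/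
def HasCartanMatrix (b : (rootSystem 𝔞).Base) {n : ℕ} (A : Matrix (Fin n) (Fin n) ℤ) : Prop :=
  ∃ e : b.support ≃ Fin n, ∀ i j, b.cartanMatrix i j = A (e i) (e j)

end Flag

end RealFlag

/-!
The invariant almost complex structures on `K / M` are the complex structures on `𝔫⁻` that commute
with `M` (`InvariantAlmostComplexStructure.exists_isComplexStructure`,
`nonempty_invariantAlmostComplexStructure`), and `M` acts on each root space by a character with
values `± 1` (`RootVectors.chi`), so the question is which root spaces carry the same character.

*Restriction on the root system.* For a root vector `e_i` the element `U_i = e_i + θ e_i` lies in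
`𝔨`, and `m_i = exp (π ad U_i)` belongs to `M` and acts on the root space of `β` by the sign
`(-1) ^ ⟨β, i^∨⟩`, if no pairing with `i^∨` exceeds `2` (`RootVectors.m_apply_of_isWt`). Call two
roots congruent if their pairings with every coroot have the same parity. Outside type `G₂`, a
complex structure that commutes with `M` preserves the spans of the congruence classes of positive
roots, which therefore have even size (`IsComplexStructure.evenClasses`). A parity argument
produces two congruent short roots (`NormForm.exists_shortPair`), and the Weyl orbit of half their
difference is, up to signs, an orthonormal frame for which the positive roots are `e_p ± e_q` with
`p < q` and possibly all `2 e_p` (`ShortPair.exists_orthFrame`): the type is `D` or `C`. In type `C`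
the long roots `2 e_p` form one class, so the rank is even (`OrthFrame.even_of_evenClasses`). The
translation into Cartan matrices, with `A₃ = D₃` and `B₂ = C₂`, is `Base.admissible_iff`.

*Existence.* It suffices to arrange the positive roots in pairs with equal characters of `M`
(`HasPairing.nonempty`). In type `G₂` the multiplicativity of the characters already provides the
pairs. In types `C` and `D`, however, one needs equalities of characters on the whole of `M`, and
not just on the `m_i`. They come from the structure of `𝔨`, which is generated by the `U_i` of the
simple roots (`RootVectors.mem_of_theta_eq`). In type `D`, where `𝔨 = 𝔰𝔬 (n) ⊕ 𝔰𝔬 (n)`, the sum and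
the difference of the `U_i` of the last two simple roots lie in different ideals, which the
connected group `K` cannot interchange; so the two characters agree (`IsFork.exists_stable`,
`chi_eq_of_not_isLong`). In type `C`, where `𝔨 = 𝔲 (n)`, the central element, which `K` fixes, has
components at all long roots, so the latter have trivial characters (`IsLongChain.lie_sum_long`,
`chi_eq_one_of_isLong`).

*Non-integrability.* In types `C` and `G₂` the elements of `M` separate the simple roots, so an
equivariant `A` preserves their root spaces modulo `[𝔫⁻, 𝔫⁻]`; as a real number is not a square root
of `-1`, it follows that `𝔫⁻` is generated by `[𝔫⁻, 𝔫⁻]` under `A`. Integrability would propagate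
this down the descending central series to zero (`le_sup_map_of_integrable`,
`IsComplexStructure.not_integrable_of_separated`). In type `D` two simple roots have the same
character and this argument is not available. There the bracket with `A Z`, for a root vector `Z` of
the lowest root, commutes with an integrable `A`, and the vanishing of `N_A` makes `A` skew for the
symmetric form `ω` defined by `[X, [Y, A Z]] = ω(X, Y) Z` on the span of a congruence class; this
contradicts the shape of `ω` (`IsComplexStructure.not_integrable_of_simplyLaced`).
-/

/-! ### Congruent short roots and the vectors they define -/

namespace RootPairing

section Frame

variable {ι M N : Type*} [AddCommGroup M] [Module ℝ M] [AddCommGroup N] [Module ℝ N]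
  (P : RootPairing ι ℝ M N)

/-- Two roots are congruent if they pair with every coroot to integers of the same parity, that
is, if their difference lies in twice the weight lattice. -/
def Congr [P.IsCrystallographic] (i j : ι) : Prop :=
  ∀ k, Even (P.pairingIn ℤ i k - P.pairingIn ℤ j k)

/-- A Euclidean form on the ambient space of a root pairing for which the reflections are
orthogonal, normalized so that every root has square length `2` or `4`. -/
structure NormForm where
  form : LinearMap.BilinForm ℝ M
  symm : ∀ x y, form x y = form y x
  pos : ∀ x, x ≠ 0 → 0 < form x x
  coroot_mul : ∀ x i, P.coroot' i x * form (P.root i) (P.root i) = 2 * form x (P.root i)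
  len : ∀ i, form (P.root i) (P.root i) = 2 ∨ form (P.root i) (P.root i) = 4

variable {P}

namespace NormForm

variable (F : P.NormForm)

lemma eq_zero_of_form_self {x : M} (h : F.form x x = 0) : x = 0 := by
  by_contra hx
  exact (F.pos x hx).ne' h

lemma form_self_nonneg (x : M) : 0 ≤ F.form x x := by
  by_cases hx : x = 0
  · simp [hx]
  · exact (F.pos x hx).le

lemma form_root_pos (i : ι) : 0 < F.form (P.root i) (P.root i) := by
  rcases F.len i with h | h <;> rw [h] <;> norm_num

lemma pairing_mul (i j : ι) :
    P.pairing i j * F.form (P.root j) (P.root j) = 2 * F.form (P.root i) (P.root j) :=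
  F.coroot_mul (P.root i) j

lemma form_reflection (i : ι) (x y : M) :
    F.form (P.reflection i x) (P.reflection i y) = F.form x y := by
  have hx := F.coroot_mul x i
  have hy := F.coroot_mul y i
  have := F.symm y (P.root i)
  simp only [P.reflection_apply, map_sub, map_smul, LinearMap.sub_apply, LinearMap.smul_apply,
    smul_eq_mul]
  linear_combination (P.coroot' i x / 2) * hy + (P.coroot' i y / 2) * hx
    + P.coroot' i x * this

/-- The vectors of square length `1` in the coset `μ + Q` of the root lattice `Q`. -/
def unitCoset (μ : M) : Set M :=
  {x | F.form x x = 1 ∧ x - μ ∈ Submodule.span ℤ (Set.range P.root)}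

end NormForm

lemma reflection_mem_range (i j : ι) : P.reflection i (P.root j) ∈ Set.range P.root :=
  ⟨P.reflectionPerm i j, P.root_reflectionPerm i j⟩

lemma neg_mem_range_root {x : M} (hx : x ∈ Set.range P.root) : -x ∈ Set.range P.root := by
  obtain ⟨i, rfl⟩ := hx
  exact ⟨P.reflectionPerm i i, by simp⟩

end Frame

section Pair

variable {ι M N : Type*} [AddCommGroup M] [Module ℝ M] [AddCommGroup N] [Module ℝ N]
  {P : RootPairing ι ℝ M N} [P.IsCrystallographic] (F : P.NormForm)

/-- Two congruent orthogonal roots of minimal length, and half their difference `μ`. -/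
structure ShortPair where
  i : ι
  j : ι
  congr : P.Congr i j
  len_i : F.form (P.root i) (P.root i) = 2
  len_j : F.form (P.root j) (P.root j) = 2
  orth : F.form (P.root i) (P.root j) = 0

namespace ShortPair

variable {F} (S : ShortPair F)

/-- Half the difference of the two roots. -/
noncomputable def μ : M := (2⁻¹ : ℝ) • (P.root S.i - P.root S.j)

/-- The candidates for the orthonormal frame: the unit vectors in `μ + Q`. -/
def E : Set M := F.unitCoset S.μ

lemma two_smul_μ : (2 : ℝ) • S.μ = P.root S.i - P.root S.j := by
  rw [μ, smul_smul]; norm_num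

lemma μ_mem : S.μ ∈ S.E := by
  refine ⟨?_, by simp⟩
  have h1 := S.len_i
  have h2 := S.len_j
  have h3 := S.orth
  have h4 := F.symm (P.root S.j) (P.root S.i)
  simp only [μ, map_smul, map_sub, LinearMap.smul_apply, LinearMap.sub_apply, smul_eq_mul]
  rw [h4, h1, h2, h3]; norm_num

lemma coroot_μ (k : ι) : ∃ m : ℤ, P.coroot' k S.μ = m := by
  obtain ⟨m, hm⟩ := S.congr k
  refine ⟨m, ?_⟩
  have h : P.coroot' k S.μ = 2⁻¹ * (P.pairing S.i k - P.pairing S.j k) := by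
    rw [μ, map_smul, map_sub, smul_eq_mul]
    rfl
  rw [h, ← P.algebraMap_pairingIn ℤ S.i k, ← P.algebraMap_pairingIn ℤ S.j k]
  simp only [algebraMap_int_eq, eq_intCast, ← Int.cast_sub, hm]
  push_cast; ring

lemma coroot_span {x : M} (hx : x ∈ Submodule.span ℤ (Set.range P.root)) (k : ι) :
    ∃ m : ℤ, P.coroot' k x = m := by
  induction hx using Submodule.span_induction with
  | mem x hx =>
    obtain ⟨i, rfl⟩ := hx
    exact ⟨P.pairingIn ℤ i k, by
      have := P.algebraMap_pairingIn ℤ i k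
      rw [algebraMap_int_eq, eq_intCast] at this
      rw [this]; rfl⟩
  | zero => exact ⟨0, by simp⟩
  | add x y _ _ h h' =>
    obtain ⟨a, ha⟩ := h
    obtain ⟨b, hb⟩ := h'
    exact ⟨a + b, by rw [map_add, ha, hb]; push_cast; rfl⟩
  | smul n x _ h =>
    obtain ⟨a, ha⟩ := h
    exact ⟨n * a, by rw [map_zsmul, ha]; simp⟩

lemma coroot_E {x : M} (hx : x ∈ S.E) (k : ι) : ∃ m : ℤ, P.coroot' k x = m := by
  obtain ⟨a, ha⟩ := S.coroot_μ k
  obtain ⟨b, hb⟩ := coroot_span hx.2 k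
  exact ⟨a + b, by push_cast; rw [← ha, ← hb, ← map_add, add_sub_cancel]⟩

lemma reflection_E {x : M} (hx : x ∈ S.E) (k : ι) : P.reflection k x ∈ S.E := by
  refine ⟨by rw [F.form_reflection]; exact hx.1, ?_⟩
  obtain ⟨m, hm⟩ := S.coroot_E hx k
  rw [P.reflection_apply, hm, sub_right_comm, Int.cast_smul_eq_zsmul]
  exact Submodule.sub_mem _ hx.2
    (Submodule.smul_mem _ _ (Submodule.subset_span ⟨k, rfl⟩))

lemma neg_E {x : M} (hx : x ∈ S.E) : -x ∈ S.E := by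
  refine ⟨by simpa using hx.1, ?_⟩
  have h : -x - S.μ = -(x - S.μ) - (P.root S.i - P.root S.j) := by
    rw [← S.two_smul_μ, two_smul]; abel
  rw [h]
  exact Submodule.sub_mem _ (Submodule.neg_mem _ hx.2)
    (Submodule.sub_mem _ (Submodule.subset_span ⟨_, rfl⟩) (Submodule.subset_span ⟨_, rfl⟩))

lemma form_span {x y : M} (hx : x ∈ S.E) (hy : y ∈ Submodule.span ℤ (Set.range P.root)) :
    ∃ m : ℤ, F.form x y = m := by
  induction hy using Submodule.span_induction with
  | mem y hy =>
    obtain ⟨k, rfl⟩ := hy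
    obtain ⟨m, hm⟩ := S.coroot_E hx k
    have h := F.coroot_mul x k
    rw [hm] at h
    rcases F.len k with hk | hk <;> rw [hk] at h
    · exact ⟨m, by linarith⟩
    · exact ⟨2 * m, by push_cast; linarith⟩
  | zero => exact ⟨0, by simp⟩
  | add x y _ _ h h' =>
    obtain ⟨a, ha⟩ := h
    obtain ⟨b, hb⟩ := h'
    exact ⟨a + b, by rw [map_add, ha, hb]; push_cast; rfl⟩
  | smul n x _ h =>
    obtain ⟨a, ha⟩ := h
    exact ⟨n * a, by rw [map_zsmul, ha]; simp⟩

/-- Distinct non-opposite vectors of the frame are orthogonal: their product is an integer of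
absolute value less than `1`. -/
lemma form_E {x y : M} (hx : x ∈ S.E) (hy : y ∈ S.E) : x = y ∨ x = -y ∨ F.form x y = 0 := by
  have hxy : x - y ∈ Submodule.span ℤ (Set.range P.root) := by
    have := Submodule.sub_mem _ hx.2 hy.2
    rwa [sub_sub_sub_cancel_right] at this
  obtain ⟨m, hm⟩ := S.form_span hx hxy
  have h1 : F.form x y = 1 - m := by
    rw [← hm, map_sub, hx.1]; ring
  have hs := F.symm y x
  by_cases ha : x = y
  · exact Or.inl ha
  by_cases hb : x = -y
  · exact Or.inr (Or.inl hb)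
  have p1 := F.pos (x - y) (sub_ne_zero.mpr ha)
  have p2 := F.pos (x + y) (fun h ↦ hb (eq_neg_of_add_eq_zero_left h))
  simp only [map_sub, map_add, LinearMap.sub_apply, LinearMap.add_apply, hx.1, hy.1, hs] at p1 p2
  have q1 : (0 : ℝ) < m := by linarith
  have q2 : (m : ℝ) < 2 := by linarith
  have : m = 1 := by
    have q1' : 0 < m := by exact_mod_cast q1
    have q2' : m < 2 := by exact_mod_cast q2
    omega
  right; right
  rw [h1, this]; norm_num

omit [P.IsCrystallographic] in
lemma span_invt {A : Set M} (hA : ∀ k, ∀ x ∈ A, P.reflection k x ∈ A) (k : ι) :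
    Submodule.span ℝ A ∈ Module.End.invtSubmodule (P.reflection k : M →ₗ[ℝ] M) := by
  rw [Module.End.mem_invtSubmodule, Submodule.span_le]
  intro x hx
  exact Submodule.subset_span (hA k x hx)

omit [P.IsCrystallographic] in
lemma span_eq_top [P.IsIrreducible] {A : Set M} (hA : ∀ k, ∀ x ∈ A, P.reflection k x ∈ A) {x : M} (hx : x ∈ A)
    (hx0 : x ≠ 0) : Submodule.span ℝ A = ⊤ := by
  refine IsIrreducible.eq_top_of_invtSubmodule_reflection (P := P) _ (span_invt hA) ?_
  intro h
  have : x ∈ (⊥ : Submodule ℝ M) := h ▸ Submodule.subset_span hx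
  exact hx0 (by simpa using this)

lemma ne_zero_of_mem {x : M} (hx : x ∈ S.E) : x ≠ 0 := by
  rintro rfl
  have := hx.1
  simp at this

omit [P.IsCrystallographic] in
lemma eq_zero_of_orth {A : Set M} (hA : Submodule.span ℝ A = ⊤) {y : M}
    (h : ∀ x ∈ A, F.form y x = 0) : y = 0 := by
  have hy : y ∈ Submodule.span ℝ A := by rw [hA]; trivial
  apply F.eq_zero_of_form_self
  have : Submodule.span ℝ A ≤ LinearMap.ker (F.form y) := Submodule.span_le.mpr h
  exact this hy

variable [P.IsIrreducible]

lemma span_E : Submodule.span ℝ S.E = ⊤ :=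
  span_eq_top (fun k _ hx ↦ S.reflection_E hx k) S.μ_mem (S.ne_zero_of_mem S.μ_mem)

/-- Each root is a difference of two orthogonal vectors of the frame, or twice a vector of the
frame. -/
lemma root_cases (k : ι) :
    (∃ x ∈ S.E, ∃ y ∈ S.E, F.form x y = 0 ∧ P.root k = x - y) ∨
      ∃ x ∈ S.E, P.root k = (2 : ℝ) • x := by
  obtain ⟨x, hx, hne⟩ : ∃ x ∈ S.E, F.form (P.root k) x ≠ 0 := by
    by_contra! h
    have := eq_zero_of_orth S.span_E h
    have h2 := F.form_root_pos k
    rw [this] at h2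
    simp at h2
  obtain ⟨m, hm⟩ := S.coroot_E hx k
  have h1 := F.coroot_mul x k
  have hy := S.reflection_E hx k
  set y := P.reflection k x with hyd
  have hyx : y = x - (m : ℝ) • P.root k := by rw [hyd, P.reflection_apply, hm]
  rw [hm] at h1
  rw [F.symm] at hne
  have hm0 : (m : ℝ) ≠ 0 := by
    rintro h0
    rw [h0] at h1
    exact hne (by linarith)
  have hxx := hx.1
  have hF : F.form x y = 1 - m * F.form x (P.root k) := by
    rw [hyx, map_sub, map_smul, hxx, smul_eq_mul]
  have hm1 : (1 : ℝ) ≤ m ^ 2 := by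
    have : (m : ℤ) ≠ 0 := by exact_mod_cast hm0
    have : (1 : ℤ) ≤ m ^ 2 := by
      have := sq_nonneg m
      have h' : m ^ 2 ≠ 0 := pow_ne_zero 2 ‹_›
      omega
    exact_mod_cast this
  -- `y = x` is impossible, `y = -x` makes `k` long, and otherwise `k` is short
  rcases S.form_E hx hy with h | h | h
  · exfalso
    have : (m : ℝ) • P.root k = 0 := by
      have := hyx
      rw [← h] at this
      exact (sub_eq_self.mp this.symm)
    rcases smul_eq_zero.mp this with h' | h'
    · exact hm0 h'
    · have h2 := F.form_root_pos k
      rw [h'] at h2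
      simp at h2
  · right
    have h3 : F.form x y = -1 := by
      have : y = -x := by rw [h, neg_neg]
      rw [this, map_neg, hxx]
    have h4 : m * F.form x (P.root k) = 2 := by linarith
    have h2x : (m : ℝ) • P.root k = (2 : ℝ) • x := by
      have : y = -x := by rw [h, neg_neg]
      rw [this] at hyx
      rw [two_smul]
      have : (m : ℝ) • P.root k = x - -x := by rw [hyx]; abel
      rw [this]; abel
    rcases F.len k with hk | hk <;> rw [hk] at h1
    · exfalso
      have h5 : m ^ 2 = 2 := by
        have h6 : F.form x (P.root k) = m := by linarith
        rw [h6] at h4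
        have : (m : ℝ) ^ 2 = 2 := by linarith
        exact_mod_cast this
      have : m < 2 := by nlinarith
      have : -2 < m := by nlinarith
      interval_cases m <;> omega
    · have h5 : (m : ℝ) ^ 2 = 1 := by
        have h6 : F.form x (P.root k) = 2 * m := by linarith
        rw [h6] at h4
        linarith
      rcases sq_eq_one_iff.mp h5 with h6 | h6
      · exact ⟨x, hx, by rw [← h2x, h6, one_smul]⟩
      · exact ⟨-x, S.neg_E hx, by rw [smul_neg, ← h2x, h6, neg_smul, one_smul, neg_neg]⟩
  · left
    rw [hF] at h
    have h4 : m * F.form x (P.root k) = 1 := by linarith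
    have h5 : (m : ℝ) ^ 2 = 1 := by
      rcases F.len k with hk | hk <;> rw [hk] at h1
      · have h6 : F.form x (P.root k) = m := by linarith
        rw [h6] at h4
        linarith
      · have h6 : F.form x (P.root k) = 2 * m := by linarith
        rw [h6] at h4
        linarith
    have hmk : (m : ℝ) • P.root k = x - y := by rw [hyx]; abel
    have hxy : F.form x y = 0 := by rw [hF]; linarith
    rcases sq_eq_one_iff.mp h5 with h6 | h6
    · exact ⟨x, hx, y, hy, hxy, by rw [← hmk, h6, one_smul]⟩
    · refine ⟨-x, S.neg_E hx, -y, S.neg_E hy, by simpa using hxy, ?_⟩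
      have : -x - -y = -(x - y) := by abel
      rw [this, ← hmk, h6, neg_smul, one_smul, neg_neg]

end ShortPair

end Pair

end RootPairing

/-! ### Differences of vectors of the frame -/

namespace RootPairing

section

variable {ι M N : Type*} [AddCommGroup M] [Module ℝ M] [AddCommGroup N] [Module ℝ N]
  {P : RootPairing ι ℝ M N} {F : P.NormForm}

namespace NormForm

variable (F) in
/-- The reflection in a root `x - y`, for orthonormal `x` and `y`, moves `y` to `x` wherever it
occurs. -/
lemma reflect_sub {x y z : M} (hx : F.form x x = 1) (hy : F.form y y = 1) (hxy : F.form x y = 0)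
    (h : x - y ∈ Set.range P.root) (hz : z ∈ Set.range P.root) :
    z - (F.form z x - F.form z y) • (x - y) ∈ Set.range P.root := by
  obtain ⟨i, hi⟩ := h
  obtain ⟨j, rfl⟩ := hz
  have h2 := F.coroot_mul (P.root j) i
  have hs := F.symm y x
  have h3 : F.form (P.root i) (P.root i) = 2 := by
    rw [hi]
    simp only [map_sub, LinearMap.sub_apply, hx, hy, hxy, hs]; norm_num
  rw [h3, hi, map_sub] at h2
  have h4 : P.coroot' i (P.root j) = F.form (P.root j) x - F.form (P.root j) y := by linarith
  rw [← h4, ← hi, ← P.reflection_apply]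
  exact reflection_mem_range i j

end NormForm

end

section

variable {ι M N : Type*} [AddCommGroup M] [Module ℝ M] [AddCommGroup N] [Module ℝ N]
  {P : RootPairing ι ℝ M N} [P.IsCrystallographic] {F : P.NormForm}

namespace ShortPair

variable (S : ShortPair F)

/-- Half the sum of the two roots of a short pair. -/
noncomputable def ν : M := P.root S.i - S.μ

lemma ν_mem : S.ν ∈ S.E := by
  have h : S.ν = S.μ + P.root S.j := by
    have := S.two_smul_μ
    rw [two_smul] at this
    rw [ν, sub_eq_iff_eq_add, add_right_comm, this, sub_add_cancel]
  refine ⟨?_, ?_⟩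
  · have h1 := S.len_i
    have h2 := S.len_j
    have h3 := S.orth
    have h4 := F.symm (P.root S.j) (P.root S.i)
    simp only [ν, μ, map_smul, map_sub, LinearMap.smul_apply, LinearMap.sub_apply, smul_eq_mul]
    rw [h4, h1, h2, h3]; norm_num
  · rw [h, add_sub_cancel_left]
    exact Submodule.subset_span ⟨_, rfl⟩

lemma μ_add_ν : S.μ + S.ν = P.root S.i := by rw [ν]; abel

lemma ν_sub_μ : S.ν - S.μ = P.root S.j := by
  have := S.two_smul_μ
  rw [two_smul] at this
  rw [ν, sub_sub, this]; abel

lemma form_μ_ν : F.form S.μ S.ν = 0 := by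
  have h1 := S.len_i
  have h2 := S.len_j
  have h3 := S.orth
  have h4 := F.symm (P.root S.j) (P.root S.i)
  simp only [ν, μ, map_smul, map_sub, LinearMap.smul_apply, LinearMap.sub_apply, smul_eq_mul]
  rw [h4, h1, h2, h3]; norm_num

/-- The members `y` of the frame, other than `± μ`, for which both `μ - y` and `μ + y` are
roots. -/
def Linked (y : M) : Prop :=
  F.form S.μ y = 0 ∧ S.μ - y ∈ Set.range P.root ∧ S.μ + y ∈ Set.range P.root

variable {S} in
lemma Linked.neg {y : M} (h : S.Linked y) : S.Linked (-y) :=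
  ⟨by simpa using h.1, by simpa using h.2.2, by simpa [← sub_eq_add_neg] using h.2.1⟩

lemma linked_ν : S.Linked S.ν :=
  ⟨S.form_μ_ν, by
    rw [← neg_sub, S.ν_sub_μ]; exact neg_mem_range_root ⟨_, rfl⟩, by
    rw [S.μ_add_ν]; exact ⟨_, rfl⟩⟩

/-- If `μ` and `q` differ by a root up to the sign of `μ`, then `q` is linked to `μ`. The root
`± μ - q` gives the root `ν - q`, which is then used to carry `ν` to `q` in the root `± μ + ν`. -/
lemma linked_of_root_sub_μ {y q : M} (hy : y = S.μ ∨ y = -S.μ) (hq : q ∈ S.E)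
    (hyq : F.form y q = 0) (h : y - q ∈ Set.range P.root) : S.Linked q := by
  have hμq : F.form S.μ q = 0 := by
    rcases hy with rfl | rfl
    · exact hyq
    · simpa using hyq
  have hyE : y ∈ S.E := by
    rcases hy with rfl | rfl
    · exact S.μ_mem
    · exact S.neg_E S.μ_mem
  have hν := S.linked_ν
  rcases S.form_E hq S.ν_mem with rfl | rfl | hqν
  · exact S.linked_ν
  · exact S.linked_ν.neg
  have hyν : F.form y S.ν = 0 := by
    rcases hy with rfl | rfl
    · exact hν.1
    · simpa using hν.1
  have hsub : y - S.ν ∈ Set.range P.root := by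
    rcases hy with rfl | rfl
    · exact hν.2.1
    · rw [← neg_add']; exact neg_mem_range_root hν.2.2
  have hadd : y + S.ν ∈ Set.range P.root := by
    rcases hy with rfl | rfl
    · exact hν.2.2
    · rw [neg_add_eq_sub, ← neg_sub]; exact neg_mem_range_root hν.2.1
  have hqy := (F.symm q y).trans hyq
  have hνy := (F.symm S.ν y).trans hyν
  have hνq := (F.symm S.ν q).trans hqν
  have h1 := F.reflect_sub hyE.1 S.ν_mem.1 hyν hsub h
  have h2 : S.ν - q ∈ Set.range P.root := by
    convert h1 using 1
    simp only [map_sub, LinearMap.sub_apply, hyE.1, hqy, hyν, hqν]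
    module
  have h3 := F.reflect_sub S.ν_mem.1 hq.1 hνq h2 hadd
  have h4 : y + q ∈ Set.range P.root := by
    convert h3 using 1
    simp only [map_add, LinearMap.add_apply, S.ν_mem.1, hyν, hyq, hνq]
    module
  refine ⟨hμq, ?_⟩
  rcases hy with rfl | rfl
  · exact ⟨h, h4⟩
  · refine ⟨?_, ?_⟩
    · have := neg_mem_range_root h4
      rwa [neg_add, neg_neg, ← sub_eq_add_neg] at this
    · have := neg_mem_range_root h
      rwa [neg_sub, sub_neg_eq_add, add_comm] at this

/-- The reflection in the root `y - q` carries `y` to `q`, hence the roots `μ ± y` to `μ ± q`. -/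
lemma linked_of_root_sub {y q : M} (hyE : y ∈ S.E) (hy : S.Linked y) (hq : q ∈ S.E)
    (hyq : F.form y q = 0) (h : y - q ∈ Set.range P.root) :
    q = S.μ ∨ q = -S.μ ∨ S.Linked q := by
  rcases S.form_E hq S.μ_mem with h0 | h0 | h0
  · exact Or.inl h0
  · exact Or.inr (Or.inl h0)
  right; right
  have h1 := F.reflect_sub hyE.1 hq.1 hyq h hy.2.1
  have h2 := F.reflect_sub hyE.1 hq.1 hyq h hy.2.2
  have hμq := (F.symm S.μ q).trans h0
  refine ⟨hμq, ?_, ?_⟩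
  · convert h1 using 1
    simp only [map_sub, LinearMap.sub_apply, hyE.1, hy.1, hyq, hμq]
    module
  · convert h2 using 1
    simp only [map_add, LinearMap.add_apply, hyE.1, hy.1, hyq, hμq]
    module

/-- The part of the frame linked to `μ`. -/
def G : Set M := {y | y ∈ S.E ∧ (y = S.μ ∨ y = -S.μ ∨ S.Linked y)}

variable {S} in
lemma neg_G {y : M} (hy : y ∈ S.G) : -y ∈ S.G := by
  refine ⟨S.neg_E hy.1, ?_⟩
  rcases hy.2 with rfl | rfl | h
  · exact Or.inr (Or.inl rfl)
  · exact Or.inl (neg_neg _)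
  · exact Or.inr (Or.inr h.neg)

lemma mem_G_of_root_sub {y q : M} (hy : y ∈ S.G) (hq : q ∈ S.E)
    (hyq : F.form y q = 0) (h : y - q ∈ Set.range P.root) : q ∈ S.G := by
  refine ⟨hq, ?_⟩
  rcases hy.2 with h1 | h1 | h1
  · exact Or.inr (Or.inr (S.linked_of_root_sub_μ (Or.inl h1) hq hyq h))
  · exact Or.inr (Or.inr (S.linked_of_root_sub_μ (Or.inr h1) hq hyq h))
  · exact S.linked_of_root_sub hy.1 h1 hq hyq h

variable [P.IsIrreducible]

/-- The reflection in `p - q` interchanges `p` and `q`, the one in `2 x` changes the sign of `x`, and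
the other vectors of the frame, up to sign, are fixed. -/
lemma reflection_G (k : ι) {y : M} (hy : y ∈ S.G) : P.reflection k y ∈ S.G := by
  have hr := S.reflection_E hy.1 k
  have hrefl := P.reflection_apply k y
  have hmul := F.coroot_mul y k
  rcases S.root_cases k with ⟨p, hp, q, hq, hpq, hk⟩ | ⟨x, hx, hk⟩
  · have hqp := (F.symm q p).trans hpq
    have hkk : F.form (P.root k) (P.root k) = 2 := by
      rw [hk]
      simp only [map_sub, LinearMap.sub_apply, hp.1, hq.1, hpq, hqp]; norm_num
    rw [hkk, hk, map_sub] at hmul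
    have hc : P.coroot' k y = F.form y p - F.form y q := by linarith
    rw [hc, hk] at hrefl
    have hroot : p - q ∈ Set.range P.root := ⟨k, hk⟩
    rcases S.form_E hy.1 hp with h | h | h
    · subst h
      rw [hy.1.1, hpq] at hrefl
      have : P.reflection k y = q := by rw [hrefl]; module
      rw [this]
      exact S.mem_G_of_root_sub hy hq hpq hroot
    · have hp' : p = -y := by rw [h, neg_neg]
      have : P.reflection k y = -q := by
        rw [hrefl, h]; simp only [map_neg, LinearMap.neg_apply, hp.1, hpq]; module
      rw [this]
      subst h
      refine neg_G (S.mem_G_of_root_sub (y := p) ?_ hq hpq hroot)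
      simpa using neg_G hy
    · rcases S.form_E hy.1 hq with h' | h' | h'
      · subst h'
        rw [hy.1.1, h] at hrefl
        have : P.reflection k y = p := by rw [hrefl]; module
        rw [this]
        refine S.mem_G_of_root_sub hy hp hqp ?_
        rw [← neg_sub]; exact neg_mem_range_root hroot
      · have : P.reflection k y = -p := by
          rw [hrefl, h, h']; simp only [map_neg, LinearMap.neg_apply, hq.1]; module
        rw [this]
        subst h'
        refine neg_G (S.mem_G_of_root_sub (y := q) (by simpa using neg_G hy) hp hqp ?_)
        rw [← neg_sub]; exact neg_mem_range_root hroot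
      · rw [h, h'] at hrefl
        have : P.reflection k y = y := by rw [hrefl]; module
        rwa [this]
  · have hkk : F.form (P.root k) (P.root k) = 4 := by
      rw [hk]
      simp only [map_smul, LinearMap.smul_apply, smul_eq_mul, hx.1]; norm_num
    rw [hkk, hk, map_smul, smul_eq_mul] at hmul
    have hc : P.coroot' k y = F.form y x := by linarith
    rw [hc, hk] at hrefl
    rcases S.form_E hy.1 hx with h | h | h
    · subst h
      rw [hy.1.1] at hrefl
      have : P.reflection k y = -y := by rw [hrefl]; module
      rw [this]
      exact neg_G hy
    · have : P.reflection k y = -y := by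
        rw [hrefl, h]; simp only [map_neg, LinearMap.neg_apply, hx.1]; module
      rw [this]
      exact neg_G hy
    · rw [h] at hrefl
      have : P.reflection k y = y := by rw [hrefl]; module
      rwa [this]

/-- As the root system is irreducible, the stable set `G` spans the space, so that no vector of the
frame is orthogonal to it. -/
lemma mem_G {y : M} (hy : y ∈ S.E) : y ∈ S.G := by
  have htop : Submodule.span ℝ S.G = ⊤ :=
    span_eq_top (fun k _ hx ↦ S.reflection_G k hx) (x := S.μ) ⟨S.μ_mem, Or.inl rfl⟩
      (S.ne_zero_of_mem S.μ_mem)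
  by_contra hn
  refine S.ne_zero_of_mem hy (eq_zero_of_orth (F := F) htop fun x hx ↦ ?_)
  rcases S.form_E hy hx.1 with h | h | h
  · exact absurd (h ▸ hx) hn
  · exact absurd (h ▸ neg_G hx) hn
  · exact h

/-- Any two orthogonal vectors of the frame differ by a root. -/
lemma sub_mem_range {x y : M} (hx : x ∈ S.E) (hy : y ∈ S.E) (hxy : F.form x y = 0) :
    x - y ∈ Set.range P.root := by
  have key : ∀ z ∈ S.E, F.form S.μ z = 0 → S.Linked z := by
    intro z hz h0
    rcases (S.mem_G hz).2 with rfl | rfl | h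
    · rw [S.μ_mem.1] at h0; norm_num at h0
    · rw [map_neg, S.μ_mem.1] at h0; norm_num at h0
    · exact h
  rcases (S.mem_G hx).2 with rfl | rfl | h
  · exact (key y hy hxy).2.1
  · have := (key y hy (by simpa using hxy)).2.2
    rw [← neg_add']; exact neg_mem_range_root this
  · rcases (S.mem_G hy).2 with rfl | rfl | h'
    · rw [← neg_sub]; exact neg_mem_range_root h.2.1
    · rw [sub_neg_eq_add, add_comm]; exact h.2.2
    · have h1 := F.reflect_sub S.μ_mem.1 hx.1 h.1 h.2.1 h'.2.1
      convert h1 using 1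
      have hyx := (F.symm y x).trans hxy
      have hyμ := (F.symm y S.μ).trans h'.1
      simp only [map_sub, LinearMap.sub_apply, S.μ_mem.1, h.1, hyμ, hyx]
      module

/-- If twice one vector of the frame is a root, then this holds for all of them. -/
lemma two_smul_mem_range {x y : M} (hx : x ∈ S.E) (hy : y ∈ S.E)
    (h : (2 : ℝ) • x ∈ Set.range P.root) : (2 : ℝ) • y ∈ Set.range P.root := by
  rcases S.form_E hy hx with rfl | rfl | h'
  · exact h
  · rw [smul_neg]; exact neg_mem_range_root h
  · have hxy := (F.symm x y).trans h'
    have h1 := F.reflect_sub hx.1 hy.1 hxy (S.sub_mem_range hx hy hxy) h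
    convert h1 using 1
    simp only [map_smul, LinearMap.smul_apply, smul_eq_mul, hx.1, hxy]
    module

end ShortPair

end

end RootPairing

/-! ### The ordered frame -/

namespace RootPairing

section

variable {ι M N : Type*} [AddCommGroup M] [Module ℝ M] [AddCommGroup N] [Module ℝ N]
  {P : RootPairing ι ℝ M N} [P.IsRootSystem] [Finite ι]

namespace Base

variable (b : P.Base)

/-- The height of a root, as a linear functional on the ambient space. -/
noncomputable def heightFunctional : M →ₗ[ℝ] ℝ :=
  b.toWeightBasis.constr ℝ fun _ ↦ (1 : ℝ)

omit [Finite ι] in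
lemma heightFunctional_root (i : ι) : b.heightFunctional (P.root i) = b.height i := by
  obtain ⟨f, -, -, hf⟩ := b.exists_root_eq_sum_int i
  rw [height_eq_sum hf, hf, map_sum]
  push_cast
  refine Finset.sum_congr rfl fun j hj ↦ ?_
  have : b.heightFunctional (P.root j) = 1 := by
    have h := b.toWeightBasis.constr_basis ℝ (fun _ ↦ (1 : ℝ)) ⟨j, hj⟩
    simpa [heightFunctional] using h
  rw [map_zsmul, this]; simp

omit [P.IsRootSystem] [Finite ι] in
lemma isPos_iff_of_root_eq_neg {i j : ι} (h : P.root j = -P.root i) :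
    b.IsPos j ↔ ¬ b.IsPos i := by
  have : j = P.reflectionPerm i i := by
    apply P.root.injective
    rw [h, root_reflectionPerm, reflection_apply_self]
  rw [this]
  exact IsPos.neg_iff_not b i

omit [P.IsRootSystem] in
/-- A positive root that is not simple is a sum of two positive roots. -/
lemma exists_root_eq_add [P.IsCrystallographic] [P.IsReduced] {i : ι} (hi : b.IsPos i)
    (his : i ∉ b.support) :
    ∃ j k, b.IsPos j ∧ k ∈ b.support ∧ P.root i = P.root j + P.root k := by
  obtain ⟨j, hj, hp⟩ := hi.exists_mem_support_pos_pairingIn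
  have hne : i ≠ j := fun h ↦ his (h ▸ hj)
  rw [← P.zero_lt_pairingIn_iff' (S := ℤ)] at hp
  obtain ⟨k, hk⟩ := P.root_sub_root_mem_of_pairingIn_pos hp hne
  exact ⟨k, j, hi.sub hj hk, hj, by rw [hk]; abel⟩

omit [Finite ι] in
lemma card_support : b.support.card = Module.finrank ℝ M := by
  rw [Module.finrank_eq_card_basis b.toWeightBasis, Fintype.card_coe]

end Base

/-- An orthonormal frame `e₀, …, e_{n-1}` of the ambient space for which the positive roots are
the vectors `e_p - e_q` and `e_p + e_q` with `p < q`, and possibly vectors `2 e_p`. Only the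
values of `e` at the numbers less than `n` matter. -/
structure OrthFrame (F : P.NormForm) (b : P.Base) (n : ℕ) where
  e : ℕ → M
  form_self : ∀ p < n, F.form (e p) (e p) = 1
  form_ne : ∀ p < n, ∀ q < n, p ≠ q → F.form (e p) (e q) = 0
  card : b.support.card = n
  two_le : 2 ≤ n
  sub_mem : ∀ p q, p < q → q < n → ∃ i, b.IsPos i ∧ P.root i = e p - e q
  add_mem : ∀ p q, p < q → q < n → ∃ i, b.IsPos i ∧ P.root i = e p + e q
  cases : ∀ i, b.IsPos i → (∃ p q, p < q ∧ q < n ∧ (P.root i = e p - e q ∨ P.root i = e p + e q)) ∨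
    ∃ p < n, P.root i = (2 : ℝ) • e p
  long : (∀ p < n, ∃ i, b.IsPos i ∧ P.root i = (2 : ℝ) • e p) ∨
    ∀ i, ∀ p < n, P.root i ≠ (2 : ℝ) • e p

end

section

variable {ι M N : Type*} [AddCommGroup M] [Module ℝ M] [AddCommGroup N] [Module ℝ N]
  {P : RootPairing ι ℝ M N} [P.IsRootSystem] [Finite ι] [P.IsCrystallographic]
  [P.IsIrreducible] {F : P.NormForm}

namespace ShortPair

variable (b : P.Base)

omit [P.IsCrystallographic] [P.IsIrreducible] [Finite ι] in
lemma heightFunctional_ne_zero {x : M} (hx : x ∈ Set.range P.root) :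
    b.heightFunctional x ≠ 0 := by
  obtain ⟨i, rfl⟩ := hx
  rw [b.heightFunctional_root]
  exact_mod_cast b.height_ne_zero i

omit [Finite ι] in
/-- A choice of one vector from each pair `± x` of the frame, of non-negative height. -/
lemma exists_half (S : ShortPair F) : ∃ T ⊆ S.E, (∀ x ∈ S.E, x ∈ T ∨ -x ∈ T) ∧
    (∀ x ∈ T, 0 ≤ b.heightFunctional x) ∧ ∀ x ∈ T, ∀ y ∈ T, x ≠ y → F.form x y = 0 := by
  -- at most one pair `± x` has height zero
  by_cases h0 : ∃ x ∈ S.E, b.heightFunctional x = 0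
  · obtain ⟨x₀, hx₀, h0⟩ := h0
    refine ⟨insert x₀ {x ∈ S.E | 0 < b.heightFunctional x}, ?_, ?_, ?_, ?_⟩
    · rintro x (rfl | hx)
      exacts [hx₀, hx.1]
    · intro x hx
      rcases lt_trichotomy (b.heightFunctional x) 0 with h | h | h
      · exact Or.inr (Or.inr ⟨S.neg_E hx, by simpa using h⟩)
      · rcases S.form_E hx hx₀ with rfl | rfl | h'
        · exact Or.inl (Or.inl rfl)
        · exact Or.inr (Or.inl (neg_neg _))
        · exfalso
          apply heightFunctional_ne_zero b (S.sub_mem_range hx hx₀ h')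
          rw [map_sub, h, h0, sub_zero]
      · exact Or.inl (Or.inr ⟨hx, h⟩)
    · rintro x (rfl | hx)
      exacts [h0.ge, hx.2.le]
    · rintro x hx y hy hxy
      have hxE : x ∈ S.E := by
        rcases hx with rfl | hx
        exacts [hx₀, hx.1]
      have hyE : y ∈ S.E := by
        rcases hy with rfl | hy
        exacts [hx₀, hy.1]
      rcases S.form_E hxE hyE with h | h | h
      · exact absurd h hxy
      · exfalso
        have hl : b.heightFunctional x = -b.heightFunctional y := by rw [h, map_neg]
        rcases hx with rfl | hx <;> rcases hy with rfl | hy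
        · exact hxy rfl
        · have := hy.2; linarith
        · have := hx.2; linarith
        · have := hx.2; have := hy.2; linarith
      · exact h
  · push Not at h0
    refine ⟨{x ∈ S.E | 0 < b.heightFunctional x}, fun x hx ↦ hx.1, ?_, fun x hx ↦ hx.2.le, ?_⟩
    · intro x hx
      rcases lt_or_gt_of_ne (h0 x hx) with h | h
      · exact Or.inr ⟨S.neg_E hx, by simpa using h⟩
      · exact Or.inl ⟨hx, h⟩
    · rintro x hx y hy hxy
      rcases S.form_E hx.1 hy.1 with h | h | h
      · exact absurd h hxy
      · exfalso
        have hl : b.heightFunctional x = -b.heightFunctional y := by rw [h, map_neg]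
        have := hx.2; have := hy.2; linarith
      · exact h

/-- The frame of a short pair, ordered by decreasing height. -/
lemma exists_orthFrame (S : ShortPair F) : ∃ n, Nonempty (OrthFrame F b n) := by
  classical
  obtain ⟨T, hTE, hT, hT0, hTo⟩ := S.exists_half b
  have : Module.Finite ℝ M := Module.Finite.of_basis b.toWeightBasis
  have hli : LinearIndependent ℝ ((↑) : T → M) := by
    refine LinearMap.BilinForm.linearIndependent_of_iIsOrtho (B := F.form) ?_ ?_
    · intro x y hxy
      exact hTo _ x.2 _ y.2 (fun h ↦ hxy (Subtype.ext h))
    · intro x hx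
      have := (hTE x.2).1
      rw [this] at hx
      exact one_ne_zero hx
  have hspan : Submodule.span ℝ T = ⊤ := by
    rw [eq_top_iff, ← S.span_E, Submodule.span_le]
    intro x hx
    rcases hT x hx with h | h
    · exact Submodule.subset_span h
    · have := Submodule.neg_mem _ (Submodule.subset_span (R := ℝ) h)
      rwa [neg_neg] at this
  have hfin : T.Finite := hli.setFinite
  set T' := hfin.toFinset with hT'
  have hcard : T'.card = Module.finrank ℝ M := by
    let B := Module.Basis.mk hli (by rw [Subtype.range_coe, hspan])
    have : Fintype T := hfin.fintype
    rw [Module.finrank_eq_card_basis B, hT', Set.Finite.card_toFinset]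
  set n := T'.card with hn
  have hinj : Set.InjOn b.heightFunctional T := by
    intro x hx y hy h
    by_contra hxy
    apply heightFunctional_ne_zero b (S.sub_mem_range (hTE hx) (hTE hy) (hTo x hx y hy hxy))
    rw [map_sub, h, sub_self]
  -- the negatives of the heights, to be listed in increasing order
  have hs : (T'.image fun x ↦ -b.heightFunctional x).card = n := by
    rw [Finset.card_image_of_injOn]
    intro x hx y hy h
    exact hinj (by simpa [hT'] using hx) (by simpa [hT'] using hy) (neg_injective h)
  let o := Finset.orderEmbOfFin _ hs
  have ho : ∀ p : Fin n, ∃ x ∈ T, -b.heightFunctional x = o p := by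
    intro p
    have := Finset.orderEmbOfFin_mem _ hs p
    obtain ⟨x, hx, h⟩ := Finset.mem_image.mp this
    exact ⟨x, by simpa [hT'] using hx, h⟩
  choose g hgT hg using ho
  let e : ℕ → M := fun p ↦ if h : p < n then g ⟨p, h⟩ else 0
  have he : ∀ p (h : p < n), e p = g ⟨p, h⟩ := fun p h ↦ dif_pos h
  have heT : ∀ p < n, e p ∈ T := fun p h ↦ by rw [he p h]; exact hgT _
  have heE : ∀ p < n, e p ∈ S.E := fun p h ↦ hTE (heT p h)
  have hlt : ∀ p q, p < q → q < n → b.heightFunctional (e q) < b.heightFunctional (e p) := by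
    intro p q hpq hq
    have h1 := hg ⟨p, hpq.trans hq⟩
    have h2 := hg ⟨q, hq⟩
    have h3 : o ⟨p, hpq.trans hq⟩ < o ⟨q, hq⟩ := o.strictMono hpq
    rw [he q hq, he p (hpq.trans hq)]
    linarith
  have hnonneg : ∀ p < n, 0 ≤ b.heightFunctional (e p) := fun p h ↦ hT0 _ (heT p h)
  have hne : ∀ p < n, ∀ q < n, p ≠ q → F.form (e p) (e q) = 0 := by
    intro p hp q hq hpq
    refine hTo _ (heT p hp) _ (heT q hq) fun h ↦ ?_
    rcases lt_or_gt_of_ne hpq with h' | h'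
    · have := hlt p q h' hq
      rw [h] at this
      exact lt_irrefl _ this
    · have := hlt q p h' hp
      rw [h] at this
      exact lt_irrefl _ this
  have hex : ∀ x ∈ T, ∃ p < n, x = e p := by
    intro x hx
    have : -b.heightFunctional x ∈ (T'.image fun x ↦ -b.heightFunctional x) :=
      Finset.mem_image_of_mem _ (by simpa [hT'] using hx)
    obtain ⟨p, hp⟩ : -b.heightFunctional x ∈ Set.range o := by
      rw [Finset.range_orderEmbOfFin]; exact this
    refine ⟨p, p.2, ?_⟩
    rw [he p p.2]
    apply hinj hx (hgT _)
    have := hg p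
    simp only [Fin.eta]
    linarith
  have hexE : ∀ x ∈ S.E, ∃ p < n, x = e p ∨ x = -e p := by
    intro x hx
    rcases hT x hx with h | h
    · obtain ⟨p, hp, h⟩ := hex _ h
      exact ⟨p, hp, Or.inl h⟩
    · obtain ⟨p, hp, h⟩ := hex _ h
      exact ⟨p, hp, Or.inr (by rw [← h, neg_neg])⟩
  have hpos : ∀ i, b.IsPos i ↔ 0 < b.heightFunctional (P.root i) := by
    intro i
    rw [b.heightFunctional_root, Base.isPos_iff]
    norm_cast
  have h2n : 2 ≤ n := by
    obtain ⟨p, hp, h1⟩ := hexE _ S.μ_mem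
    obtain ⟨q, hq, h2⟩ := hexE _ S.ν_mem
    by_contra hlt
    have hp0 : p = q := by omega
    subst hp0
    have h3 := S.form_μ_ν
    have h4 := (heE p hp).1
    rcases h1 with h1 | h1 <;> rcases h2 with h2 | h2 <;> rw [h1, h2] at h3 <;>
      simp [h4] at h3
  refine ⟨n, ⟨e, fun p hp ↦ (heE p hp).1, hne, by rw [b.card_support, hcard], h2n, ?_, ?_, ?_, ?_⟩⟩
  · intro p q hpq hq
    have hp := hpq.trans hq
    obtain ⟨i, hi⟩ := S.sub_mem_range (heE p hp) (heE q hq) (hne p hp q hq hpq.ne)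
    refine ⟨i, ?_, hi⟩
    rw [hpos, hi, map_sub]
    have := hlt p q hpq hq
    linarith
  · intro p q hpq hq
    have hp := hpq.trans hq
    obtain ⟨i, hi⟩ := S.sub_mem_range (heE p hp) (S.neg_E (heE q hq))
      (by simpa using hne p hp q hq hpq.ne)
    rw [sub_neg_eq_add] at hi
    refine ⟨i, ?_, hi⟩
    rw [hpos, hi, map_add]
    have := hlt p q hpq hq
    have := hnonneg q hq
    linarith
  · intro i hi
    rw [hpos] at hi
    rcases S.root_cases i with ⟨x, hx, y, hy, hxy, h⟩ | ⟨x, hx, h⟩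
    · left
      obtain ⟨p, hp, h1⟩ := hexE x hx
      obtain ⟨q, hq, h2⟩ := hexE y hy
      have hpq : p ≠ q := by
        rintro rfl
        rcases h1 with h1 | h1 <;> rcases h2 with h2 | h2 <;> rw [h1, h2] at hxy <;>
          simp [(heE p hp).1] at hxy
      have hp0 := hnonneg p hp
      have hq0 := hnonneg q hq
      rcases lt_or_gt_of_ne hpq with hlt' | hlt'
      · have := hlt p q hlt' hq
        refine ⟨p, q, hlt', hq, ?_⟩
        rcases h1 with rfl | rfl <;> rcases h2 with rfl | rfl
        · exact Or.inl h
        · exact Or.inr (by rw [h, sub_neg_eq_add])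
        · rw [h, map_sub, map_neg] at hi; linarith
        · rw [h, map_sub, map_neg, map_neg] at hi; linarith
      · have := hlt q p hlt' hp
        refine ⟨q, p, hlt', hp, ?_⟩
        rcases h1 with rfl | rfl <;> rcases h2 with rfl | rfl
        · rw [h, map_sub] at hi; linarith
        · exact Or.inr (by rw [h, sub_neg_eq_add, add_comm])
        · rw [h, map_sub, map_neg] at hi; linarith
        · exact Or.inl (by rw [h]; abel)
    · right
      obtain ⟨p, hp, h1⟩ := hexE x hx
      refine ⟨p, hp, ?_⟩
      rcases h1 with rfl | rfl
      · exact h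
      · have := hnonneg p hp
        rw [h, map_smul, map_neg, smul_eq_mul] at hi; linarith
  · by_cases hl : ∃ i, ∃ p < n, P.root i = (2 : ℝ) • e p
    · left
      obtain ⟨i, p, hp, hi⟩ := hl
      intro q hq
      obtain ⟨j, hj⟩ := S.two_smul_mem_range (heE p hp) (heE q hq) ⟨i, hi⟩
      refine ⟨j, ?_, hj⟩
      rw [hpos]
      have h1 := heightFunctional_ne_zero b ⟨j, rfl⟩
      have h2 := hnonneg q hq
      rw [hj, map_smul, smul_eq_mul] at h1 ⊢
      exact lt_of_le_of_ne (by linarith) h1.symm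
    · right
      push Not at hl
      exact hl

end ShortPair

end

end RootPairing

/-! ### Simple roots and Cartan matrices of a frame -/

namespace RootPairing

section

variable {ι M N : Type*} [AddCommGroup M] [Module ℝ M] [AddCommGroup N] [Module ℝ N]
  {P : RootPairing ι ℝ M N} [P.IsRootSystem] [Finite ι]
  {F : P.NormForm} {b : P.Base} {n : ℕ}

namespace OrthFrame

variable (O : OrthFrame F b n)

/-- The frame contains long roots `2 e_p` (type `C`). -/
def IsLong : Prop := ∀ p < n, ∃ i, b.IsPos i ∧ P.root i = (2 : ℝ) • O.e p

open Classical in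
/-- The simple roots in terms of the frame: the differences of consecutive vectors, followed by
`2 e_{n-1}` in the presence of long roots and by `e_{n-2} + e_{n-1}` otherwise. -/
noncomputable def simple (p : ℕ) : M :=
  if p + 1 = n then
    if O.IsLong then (2 : ℝ) • O.e p else O.e (p - 1) + O.e p
  else O.e p - O.e (p + 1)

omit [P.IsRootSystem] [Finite ι] in
lemma form_eq {p q : ℕ} (hp : p < n) (hq : q < n) :
    F.form (O.e p) (O.e q) = if p = q then 1 else 0 := by
  split_ifs with h
  · subst h; exact O.form_self p hp
  · exact O.form_ne p hp q hq h

omit [P.IsRootSystem] [Finite ι] in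
lemma simple_lt {p : ℕ} (hp : p + 1 < n) : O.simple p = O.e p - O.e (p + 1) := by
  rw [simple, if_neg hp.ne]

omit [P.IsRootSystem] [Finite ι] in
lemma simple_last_of_isLong (h : O.IsLong) : O.simple (n - 1) = (2 : ℝ) • O.e (n - 1) := by
  have := O.two_le
  rw [simple, if_pos (by omega), if_pos h]

omit [P.IsRootSystem] [Finite ι] in
lemma simple_last_of_not_isLong (h : ¬ O.IsLong) :
    O.simple (n - 1) = O.e (n - 2) + O.e (n - 1) := by
  have := O.two_le
  rw [simple, if_pos (by omega), if_neg h]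
  rfl

/-- The functional with the values `n - 1 - p + δ` on the vectors `e_p` of the frame. With the shift
`δ` of `OrthFrame.shift` it takes the value `1` on the simple roots and at least `1` on all positive
roots. -/
noncomputable def weight (δ : ℝ) : M →ₗ[ℝ] ℝ :=
  ∑ p ∈ Finset.range n, ((n : ℝ) - 1 - p + δ) • F.form.flip (O.e p)

omit [P.IsRootSystem] [Finite ι] in
lemma weight_e (δ : ℝ) {p : ℕ} (hp : p < n) : O.weight δ (O.e p) = (n : ℝ) - 1 - p + δ := by
  rw [weight, LinearMap.sum_apply, Finset.sum_eq_single_of_mem p (Finset.mem_range.mpr hp)]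
  · simp [O.form_self p hp]
  · intro q hq hqp
    simp [O.form_ne p hp q (Finset.mem_range.mp hq) hqp.symm]

open Classical in
/-- The shift in `OrthFrame.weight` that suits the type of the frame: `½` for type `C`, where `2 e_p`
must have the value `1` for `p = n - 1`, and `0` for type `D`. -/
noncomputable def shift : ℝ := if O.IsLong then 2⁻¹ else 0

omit [P.IsRootSystem] [Finite ι] in
lemma one_le_weight {i : ι} (hi : b.IsPos i) : 1 ≤ O.weight O.shift (P.root i) := by
  have hs0 : 0 ≤ O.shift := by
    rw [shift]; split_ifs <;> norm_num
  rcases O.cases i hi with ⟨p, q, hpq, hq, h⟩ | ⟨p, hp, h⟩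
  · have h1 : (p : ℝ) + 1 ≤ q := by exact_mod_cast hpq
    have h2 : (q : ℝ) + 1 ≤ n := by exact_mod_cast hq
    rcases h with h | h
    · rw [h, map_sub, O.weight_e _ (hpq.trans hq), O.weight_e _ hq]; linarith
    · rw [h, map_add, O.weight_e _ (hpq.trans hq), O.weight_e _ hq]; linarith
  · have hl : O.IsLong := O.long.resolve_right fun hl ↦ hl i p hp h
    have h2 : (p : ℝ) + 1 ≤ n := by exact_mod_cast hp
    rw [h, map_smul, smul_eq_mul, O.weight_e _ hp, shift, if_pos hl]
    linarith

omit [P.IsRootSystem] in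
lemma mem_support_of_weight [P.IsCrystallographic] [P.IsReduced] {i : ι} (hi : b.IsPos i)
    (h : O.weight O.shift (P.root i) = 1) : i ∈ b.support := by
  by_contra his
  obtain ⟨j, k, hj, hk, hjk⟩ := b.exists_root_eq_add hi his
  have h1 := O.one_le_weight hj
  have h2 := O.one_le_weight (Base.isPos_of_mem_support hk)
  rw [hjk, map_add] at h
  linarith

omit [P.IsRootSystem] in
lemma exists_simple [P.IsCrystallographic] [P.IsReduced] {p : ℕ} (hp : p < n) :
    ∃ i ∈ b.support, P.root i = O.simple p := by
  have hn := O.two_le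
  suffices ∃ i, b.IsPos i ∧ P.root i = O.simple p ∧ O.weight O.shift (O.simple p) = 1 by
    obtain ⟨i, hi, h1, h2⟩ := this
    exact ⟨i, O.mem_support_of_weight hi (h1 ▸ h2), h1⟩
  rcases lt_or_ge (p + 1) n with hp' | hp'
  · obtain ⟨i, hi, h⟩ := O.sub_mem p (p + 1) (by omega) hp'
    refine ⟨i, hi, by rw [h, O.simple_lt hp'], ?_⟩
    rw [O.simple_lt hp', map_sub, O.weight_e _ hp, O.weight_e _ hp']
    push_cast; ring
  · obtain rfl : p = n - 1 := by omega
    have hc : ((n - 1 : ℕ) : ℝ) = n - 1 := by push_cast [Nat.cast_sub (by omega : 1 ≤ n)]; ring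
    by_cases hl : O.IsLong
    · obtain ⟨i, hi, h⟩ := hl (n - 1) hp
      refine ⟨i, hi, by rw [h, O.simple_last_of_isLong hl], ?_⟩
      rw [O.simple_last_of_isLong hl, map_smul, O.weight_e _ hp, shift, if_pos hl, hc, smul_eq_mul]
      ring
    · obtain ⟨i, hi, h⟩ := O.add_mem (n - 2) (n - 1) (by omega) hp
      have hc' : ((n - 2 : ℕ) : ℝ) = n - 2 := by push_cast [Nat.cast_sub hn]; ring
      refine ⟨i, hi, by rw [h, O.simple_last_of_not_isLong hl], ?_⟩
      rw [O.simple_last_of_not_isLong hl, map_add, O.weight_e _ hp, O.weight_e _ (by omega), shift,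
        if_neg hl, hc, hc']
      ring

omit [P.IsRootSystem] [Finite ι] in
lemma form_simple_lt_lt {p q : ℕ} (hp : p + 1 < n) (hq : q + 1 < n) :
    F.form (O.simple p) (O.simple q) =
      if p = q then 2 else if p + 1 = q ∨ q + 1 = p then -1 else 0 := by
  rw [O.simple_lt hp, O.simple_lt hq]
  simp only [map_sub, LinearMap.sub_apply, O.form_eq hp hq, O.form_eq hp (show q < n by omega),
    O.form_eq (show p < n by omega) hq, O.form_eq (show p < n by omega) (show q < n by omega)]
  split_ifs <;> first | omega | norm_num

omit [P.IsRootSystem] [Finite ι] in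
lemma form_simple_last_of_isLong (hl : O.IsLong) {p : ℕ} (hp : p + 1 < n) :
    F.form (O.simple p) (O.simple (n - 1)) = if p + 2 = n then -2 else 0 := by
  rw [O.simple_lt hp, O.simple_last_of_isLong hl]
  simp only [map_sub, map_smul, LinearMap.sub_apply, O.form_eq hp (show n - 1 < n by omega),
    O.form_eq (show p < n by omega) (show n - 1 < n by omega), smul_eq_mul]
  split_ifs <;> first | omega | norm_num

omit [P.IsRootSystem] [Finite ι] in
lemma form_simple_last_of_not_isLong (hl : ¬ O.IsLong) {p : ℕ} (hp : p + 1 < n) :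
    F.form (O.simple p) (O.simple (n - 1)) = if p + 3 = n then -1 else 0 := by
  rw [O.simple_lt hp, O.simple_last_of_not_isLong hl]
  simp only [map_sub, map_add, LinearMap.sub_apply, O.form_eq hp (show n - 1 < n by omega),
    O.form_eq (show p < n by omega) (show n - 1 < n by omega),
    O.form_eq hp (show n - 2 < n by omega),
    O.form_eq (show p < n by omega) (show n - 2 < n by omega)]
  split_ifs <;> first | omega | norm_num

omit [P.IsRootSystem] [Finite ι] in
lemma form_simple_last_last_of_isLong (hl : O.IsLong) :
    F.form (O.simple (n - 1)) (O.simple (n - 1)) = 4 := by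
  have := O.two_le
  rw [O.simple_last_of_isLong hl]
  simp only [map_smul, LinearMap.smul_apply, O.form_self (n - 1) (by omega), smul_eq_mul]
  norm_num

omit [P.IsRootSystem] [Finite ι] in
lemma form_simple_last_last_of_not_isLong (hl : ¬ O.IsLong) :
    F.form (O.simple (n - 1)) (O.simple (n - 1)) = 2 := by
  have := O.two_le
  rw [O.simple_last_of_not_isLong hl]
  simp only [map_add, LinearMap.add_apply, O.form_eq (show n - 1 < n by omega)
    (show n - 1 < n by omega), O.form_eq (show n - 2 < n by omega) (show n - 1 < n by omega),
    O.form_eq (show n - 1 < n by omega) (show n - 2 < n by omega),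
    O.form_eq (show n - 2 < n by omega) (show n - 2 < n by omega)]
  split_ifs <;> first | omega | norm_num

omit [P.IsRootSystem] [Finite ι] in
lemma simple_injOn {p q : ℕ} (hp : p < n) (hq : q < n) (h : O.simple p = O.simple q) : p = q := by
  wlog hpq : p ≤ q generalizing p q
  · exact (this hq hp h.symm (by omega)).symm
  by_contra hne
  have hp' : p + 1 < n := by omega
  have h1 := O.form_simple_lt_lt hp' hp'
  rw [if_pos rfl] at h1
  have h2 : F.form (O.simple p) (O.simple q) = 2 := by rw [← h, h1]
  rcases lt_or_ge (q + 1) n with hq' | hq'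
  · rw [O.form_simple_lt_lt hp' hq'] at h2
    split_ifs at h2 <;> norm_num at h2
  · obtain rfl : q = n - 1 := by omega
    by_cases hl : O.IsLong
    · rw [O.form_simple_last_of_isLong hl hp'] at h2
      split_ifs at h2 <;> norm_num at h2
    · rw [O.form_simple_last_of_not_isLong hl hp'] at h2
      split_ifs at h2 <;> norm_num at h2

omit [P.IsRootSystem] in
/-- The numbering of the simple roots given by the frame. -/
lemma exists_equiv [P.IsCrystallographic] [P.IsReduced] :
    ∃ f : b.support ≃ Fin n, ∀ i : b.support, P.root i = O.simple (f i) := by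
  choose g hg hg' using fun p : Fin n ↦ O.exists_simple p.2
  let g' : Fin n → b.support := fun p ↦ ⟨g p, hg p⟩
  have hinj : Function.Injective g' := by
    intro p q h
    have : g p = g q := congrArg Subtype.val h
    exact Fin.ext (O.simple_injOn p.2 q.2 (by rw [← hg' p, ← hg' q, this]))
  have hbij : Function.Bijective g' := by
    rw [Fintype.bijective_iff_injective_and_card]
    exact ⟨hinj, by simp [O.card]⟩
  refine ⟨(Equiv.ofBijective g' hbij).symm, fun i ↦ ?_⟩
  conv_lhs => rw [← (Equiv.ofBijective g' hbij).apply_symm_apply i]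
  exact hg' _

end OrthFrame

omit [P.IsRootSystem] [Finite ι] in
lemma NormForm.pairingIn_eq (F : P.NormForm) [P.IsCrystallographic] {i j : ι} {m : ℤ}
    (h : 2 * F.form (P.root i) (P.root j) = m * F.form (P.root j) (P.root j)) :
    P.pairingIn ℤ i j = m := by
  have h1 := F.pairing_mul i j
  rw [h] at h1
  have h2 := mul_right_cancel₀ (F.form_root_pos j).ne' h1
  rw [← P.algebraMap_pairingIn ℤ i j, algebraMap_int_eq, eq_intCast] at h2
  exact_mod_cast h2

namespace OrthFrame

variable (O : OrthFrame F b n)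

omit [P.IsRootSystem] in
lemma exists_cartanMatrix_eq_C [P.IsCrystallographic] [P.IsReduced] (hl : O.IsLong) :
    ∃ f : b.support ≃ Fin n, ∀ i j, b.cartanMatrix i j = CartanMatrix.C n (f i) (f j) := by
  obtain ⟨f, hf⟩ := O.exists_equiv
  refine ⟨f, fun i j ↦ ?_⟩
  rw [Base.cartanMatrix, Base.cartanMatrixIn_def]
  apply F.pairingIn_eq
  rw [hf i, hf j]
  have hn := O.two_le
  generalize f i = p
  generalize f j = q
  obtain ⟨p, hp⟩ := p
  obtain ⟨q, hq⟩ := q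
  simp only [CartanMatrix.C, Matrix.of_apply, Fin.mk.injEq]
  rcases lt_or_ge (p + 1) n with hp' | hp' <;> rcases lt_or_ge (q + 1) n with hq' | hq'
  · rw [O.form_simple_lt_lt hp' hq', O.form_simple_lt_lt hq' hq']
    split_ifs <;> first | omega | norm_num
  · obtain rfl : q = n - 1 := by omega
    rw [O.form_simple_last_of_isLong hl hp', O.form_simple_last_last_of_isLong hl]
    split_ifs <;> first | omega | norm_num
  · obtain rfl : p = n - 1 := by omega
    rw [F.symm, O.form_simple_last_of_isLong hl hq', O.form_simple_lt_lt hq' hq']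
    split_ifs <;> first | omega | norm_num
  · obtain rfl : q = n - 1 := by omega
    obtain rfl : p = n - 1 := by omega
    rw [O.form_simple_last_last_of_isLong hl]
    split_ifs <;> first | omega | norm_num

omit [P.IsRootSystem] in
lemma exists_cartanMatrix_eq_D [P.IsCrystallographic] [P.IsReduced] (hl : ¬ O.IsLong)
    (hn : 3 ≤ n) :
    ∃ f : b.support ≃ Fin n, ∀ i j, b.cartanMatrix i j = CartanMatrix.D n (f i) (f j) := by
  obtain ⟨f, hf⟩ := O.exists_equiv
  refine ⟨f, fun i j ↦ ?_⟩
  rw [Base.cartanMatrix, Base.cartanMatrixIn_def]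
  apply F.pairingIn_eq
  rw [hf i, hf j]
  generalize f i = p
  generalize f j = q
  obtain ⟨p, hp⟩ := p
  obtain ⟨q, hq⟩ := q
  simp only [CartanMatrix.D, Matrix.of_apply, Fin.mk.injEq]
  rcases lt_or_ge (p + 1) n with hp' | hp' <;> rcases lt_or_ge (q + 1) n with hq' | hq'
  · rw [O.form_simple_lt_lt hp' hq', O.form_simple_lt_lt hq' hq']
    split_ifs <;> first | omega | norm_num
  · obtain rfl : q = n - 1 := by omega
    rw [O.form_simple_last_of_not_isLong hl hp', O.form_simple_last_last_of_not_isLong hl]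
    split_ifs <;> first | omega | norm_num
  · obtain rfl : p = n - 1 := by omega
    rw [F.symm, O.form_simple_last_of_not_isLong hl hq', O.form_simple_lt_lt hq' hq']
    split_ifs <;> first | omega | norm_num
  · obtain rfl : q = n - 1 := by omega
    obtain rfl : p = n - 1 := by omega
    rw [O.form_simple_last_last_of_not_isLong hl]
    split_ifs <;> first | omega | norm_num

omit [P.IsRootSystem] [Finite ι] in
/-- A frame without long roots has at least three vectors: the roots `± e₀ ± e₁` form a reducible
root system. -/
lemma three_le [P.IsIrreducible] (hl : ¬ O.IsLong) : 3 ≤ n := by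
  by_contra hlt
  obtain rfl : n = 2 := by have := O.two_le; omega
  have hl' := O.long.resolve_left hl
  have h00 := O.form_self 0 (by omega)
  have h11 := O.form_self 1 (by omega)
  have h01 := O.form_ne 0 (by omega) 1 (by omega) (by omega)
  have h10 := O.form_ne 1 (by omega) 0 (by omega) (by omega)
  set x := O.e 0 - O.e 1 with hx
  set y := O.e 0 + O.e 1 with hy
  have hxy : F.form x y = 0 := by
    simp only [hx, hy, map_sub, map_add, LinearMap.sub_apply, h00, h11, h01, h10]
    norm_num
  have hyy : F.form y y = 2 := by
    simp only [hy, map_add, LinearMap.add_apply, h00, h11, h01, h10]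
    norm_num
  have hxx : F.form x x = 2 := by
    simp only [hx, map_sub, LinearMap.sub_apply, h00, h11, h01, h10]
    norm_num
  have hroot : ∀ i, b.IsPos i → P.root i = x ∨ P.root i = y := by
    intro i hi
    rcases O.cases i hi with ⟨p, q, hpq, hq, h⟩ | ⟨p, hp, h⟩
    · obtain rfl : p = 0 := by omega
      obtain rfl : q = 1 := by omega
      exact h
    · exact absurd h (hl' i p hp)
  -- the set of the vectors `± x` is stable under all reflections, although `y` is orthogonal to it
  have hA : Submodule.span ℝ ({x, -x} : Set M) = ⊤ := by
    refine ShortPair.span_eq_top (P := P) (x := x) ?_ (by simp) ?_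
    · have key : ∀ k, P.reflection k x = x ∨ P.reflection k x = -x := by
        intro k
        have hm := F.coroot_mul x k
        have hk : ∃ s : ℝ, s ^ 2 = 1 ∧ (P.root k = s • x ∨ P.root k = s • y) := by
          rcases Base.IsPos.or_neg b k with hk | hk
          · exact ⟨1, by norm_num, by simpa using hroot k hk⟩
          · have := hroot _ hk
            rw [P.indexNeg_neg, P.root_reflectionPerm, P.reflection_apply_self] at this
            refine ⟨-1, by norm_num, ?_⟩
            rw [neg_one_smul, neg_one_smul, ← neg_eq_iff_eq_neg, ← neg_eq_iff_eq_neg]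
            exact this
        obtain ⟨s, hs, hk⟩ := hk
        rw [P.reflection_apply]
        rcases hk with hk | hk <;>
          simp only [hk, map_smul, LinearMap.smul_apply, smul_eq_mul, hxx, hyy, hxy] at hm ⊢
        · right
          have h2 : P.coroot' k x * s = 2 * s ^ 2 := by
            linear_combination s * hm / 2 - P.coroot' k x * s * hs
          rw [smul_smul, h2, hs]; module
        · left
          have h2 : P.coroot' k x = 0 := by
            linear_combination hm / 2 - P.coroot' k x * hs
          rw [h2]; module
      rintro k z (rfl | hz)
      · rcases key k with h | h <;> simp [h]
      · rw [Set.mem_singleton_iff] at hz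
        rw [hz, map_neg]
        rcases key k with h | h <;> simp [h]
    · intro h
      rw [h] at hxx
      simp at hxx
  have := ShortPair.eq_zero_of_orth (F := F) hA (y := y) (by
    have := F.symm y x
    rintro z (rfl | hz)
    · rw [this, hxy]
    · rw [Set.mem_singleton_iff] at hz
      rw [hz, map_neg, this, hxy, neg_zero])
  rw [this] at hyy
  simp at hyy

end OrthFrame

end

end RootPairing

/-! ### Root lengths and congruence classes -/

namespace RootPairing

section

variable {ι M N : Type*} [AddCommGroup M] [Module ℝ M] [AddCommGroup N] [Module ℝ N]
  (P : RootPairing ι ℝ M N)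

/-- A Euclidean form on the ambient space for which the reflections are orthogonal. -/
structure EuclForm where
  form : LinearMap.BilinForm ℝ M
  symm : ∀ x y, form x y = form y x
  pos : ∀ x, x ≠ 0 → 0 < form x x
  coroot_mul : ∀ x i, P.coroot' i x * form (P.root i) (P.root i) = 2 * form x (P.root i)

lemma exists_euclForm [P.IsRootSystem] [Finite ι] : Nonempty P.EuclForm := by
  have := Fintype.ofFinite ι
  have hs : ∀ x y, P.RootForm x y = P.RootForm y x := by
    intro x y
    simpa using P.rootForm_symmetric.eq x y
  refine ⟨⟨P.RootForm, hs, fun x hx ↦ P.rootForm_pos_of_ne_zero ?_ hx, fun x i ↦ ?_⟩⟩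
  · rw [rootSpan, IsRootSystem.span_root_eq_top]; trivial
  · have h1 := P.rootForm_reflection_reflection_apply i x (P.root i)
    rw [P.reflection_apply, P.reflection_apply_self, map_neg, map_sub, map_smul,
      LinearMap.sub_apply, LinearMap.smul_apply, smul_eq_mul] at h1
    linarith

variable {P}

namespace EuclForm

variable (B : P.EuclForm)

/-- The square length of a root. -/
def len (i : ι) : ℝ := B.form (P.root i) (P.root i)

lemma len_pos (i : ι) : 0 < B.len i := by
  refine B.pos _ fun h ↦ ?_
  have := P.root_coroot_two i
  rw [h] at this
  simp at this

lemma pairing_mul (i j : ι) : P.pairing i j * B.len j = 2 * B.form (P.root i) (P.root j) :=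
  B.coroot_mul (P.root i) j

lemma pairingIn_mul [P.IsCrystallographic] (i j : ι) :
    (P.pairingIn ℤ i j : ℝ) * B.len j = 2 * B.form (P.root i) (P.root j) := by
  rw [← B.pairing_mul, ← P.algebraMap_pairingIn ℤ i j, algebraMap_int_eq, eq_intCast]

lemma pairingIn_mul_swap [P.IsCrystallographic] (i j : ι) :
    (P.pairingIn ℤ i j : ℝ) * B.len j = P.pairingIn ℤ j i * B.len i := by
  rw [B.pairingIn_mul, B.pairingIn_mul, B.symm]

lemma len_reflectionPerm (i j : ι) : B.len (P.reflectionPerm i j) = B.len j := by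
  have hx := B.coroot_mul (P.root j) i
  have := B.symm (P.root i) (P.root j)
  rw [len, len, P.root_reflectionPerm, P.reflection_apply]
  simp only [map_sub, map_smul, LinearMap.sub_apply, LinearMap.smul_apply, smul_eq_mul, this]
  linear_combination P.coroot' i (P.root j) * hx

/-- All root lengths occur among those of the simple roots. -/
lemma exists_mem_support_len_eq [P.IsRootSystem] [Finite ι] [P.IsCrystallographic] [P.IsReduced]
    (b : P.Base) (i : ι) : ∃ j ∈ b.support, B.len i = B.len j := by
  induction i using b.induction_reflect with
  | h₀ i h => rwa [B.len_reflectionPerm]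
  | h₁ i h => exact ⟨i, h, rfl⟩
  | h₂ i j h _ => rwa [B.len_reflectionPerm]

/-- A Euclidean form with two root lengths, in ratio `2`, can be normalized. -/
noncomputable def toNormForm {s : ℝ} (hs : 0 < s) (h : ∀ i, B.len i = s ∨ B.len i = 2 * s) :
    P.NormForm where
  form := (2 / s) • B.form
  symm x y := by
    simp only [LinearMap.smul_apply, smul_eq_mul, B.symm x y]
  pos x hx := by
    simp only [LinearMap.smul_apply, smul_eq_mul]
    exact mul_pos (by positivity) (B.pos x hx)
  coroot_mul x i := by
    simp only [LinearMap.smul_apply, smul_eq_mul]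
    linear_combination (2 / s) * B.coroot_mul x i
  len i := by
    simp only [LinearMap.smul_apply, smul_eq_mul]
    rcases h i with h | h
    · left
      rw [len] at h
      rw [h]; field_simp
    · right
      rw [len] at h
      rw [h]; field_simp; norm_num

lemma toNormForm_form_self {s : ℝ} (hs : 0 < s) (h : ∀ i, B.len i = s ∨ B.len i = 2 * s) {i : ι}
    (hi : B.len i = s) : (B.toNormForm hs h).form (P.root i) (P.root i) = 2 := by
  simp only [toNormForm, LinearMap.smul_apply, smul_eq_mul]
  rw [len] at hi
  rw [hi]; field_simp

end EuclForm

/-- The set of the roots of a given length is stable under all reflections, so that it spans the space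
by irreducibility, and no root is orthogonal to all of it. -/
lemma exists_pairingIn_ne_zero [P.IsRootSystem] [Finite ι] [P.IsIrreducible]
    [P.IsCrystallographic] (B : P.EuclForm) (i j : ι) :
    ∃ k, B.len k = B.len j ∧ P.pairingIn ℤ i k ≠ 0 := by
  by_contra! h
  let A : Set M := {x | ∃ k, B.len k = B.len j ∧ P.root k = x}
  have hA : Submodule.span ℝ A = ⊤ := by
    refine ShortPair.span_eq_top (P := P) (x := P.root j) ?_ ⟨j, rfl, rfl⟩ (P.ne_zero j)
    rintro k _ ⟨l, hl, rfl⟩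
    exact ⟨P.reflectionPerm k l, by rw [B.len_reflectionPerm, hl], P.root_reflectionPerm k l⟩
  have h0 : A ⊆ LinearMap.ker (B.form (P.root i)) := by
    rintro _ ⟨k, hk, rfl⟩
    have := B.pairingIn_mul i k
    rw [h k hk] at this
    rw [SetLike.mem_coe, LinearMap.mem_ker]
    push_cast at this
    linarith
  have := Submodule.span_le.mpr h0
  rw [hA] at this
  have h1 : B.len i = 0 := this (show P.root i ∈ ⊤ by trivial)
  exact (B.len_pos i).ne' h1

/-- Outside type `G₂` the root lengths can be normalized, with a short root. -/
lemma exists_normForm [P.IsRootSystem] [Finite ι] [Nonempty ι] (hP : P.IsNotG2) :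
    ∃ F : P.NormForm, ∃ i, F.form (P.root i) (P.root i) = 2 := by
  obtain ⟨B⟩ := P.exists_euclForm
  obtain ⟨i₀, hi₀⟩ := Finite.exists_min B.len
  have hlen : ∀ i, B.len i = B.len i₀ ∨ B.len i = 2 * B.len i₀ := by
    intro i
    obtain ⟨k, hk, hne⟩ := exists_pairingIn_ne_zero B i i₀
    have h1 := B.pairingIn_mul_swap i k
    have h2 := P.pairingIn_pairingIn_mem_set_of_isCrystal_of_isRed i k
    have h3 := IsNotG2.pairingIn_mem_zero_one_two (P := P) i k
    have h4 := hi₀ i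
    have h5 := B.len_pos i₀
    rw [hk] at h1
    simp only [Set.mem_insert_iff, Set.mem_singleton_iff, Prod.mk.injEq] at h2 h3
    rcases h2 with ⟨h, h'⟩ | ⟨h, h'⟩ | ⟨h, h'⟩ | ⟨h, h'⟩ | ⟨h, h'⟩ | ⟨h, h'⟩ | ⟨h, h'⟩ |
      ⟨h, h'⟩ | ⟨h, h'⟩ | ⟨h, h'⟩ | ⟨h, h'⟩ | ⟨h, h'⟩ | ⟨h, h'⟩ <;> rw [h, h'] at h1 <;>
      push_cast at h1 <;> first
      | (exfalso; omega)
      | (exfalso; linarith)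
      | (left; linarith)
      | (right; linarith)
  exact ⟨B.toNormForm (B.len_pos i₀) hlen, i₀, B.toNormForm_form_self _ _ rfl⟩

end

section

variable {ι M N : Type*} [AddCommGroup M] [Module ℝ M] [AddCommGroup N] [Module ℝ N]
  {P : RootPairing ι ℝ M N} [P.IsCrystallographic]

lemma Congr.refl (i : ι) : P.Congr i i := fun k ↦ by simp

lemma Congr.symm {i j : ι} (h : P.Congr i j) : P.Congr j i := fun k ↦ by
  rw [← neg_sub, even_neg]; exact h k

lemma Congr.trans {i j k : ι} (h : P.Congr i j) (h' : P.Congr j k) : P.Congr i k := fun l ↦ by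
  have := (h l).add (h' l)
  rwa [sub_add_sub_cancel] at this

lemma congr_neg (i : ι) : P.Congr i (P.reflectionPerm i i) := fun k ↦ by
  rw [P.pairingIn_reflectionPerm_self_left, sub_neg_eq_add, ← two_mul]
  exact even_two_mul _

lemma Congr.reflectionPerm {i j : ι} (h : P.Congr i j) (k : ι) :
    P.Congr (P.reflectionPerm k i) (P.reflectionPerm k j) := fun l ↦ by
  rw [← P.pairingIn_reflectionPerm, ← P.pairingIn_reflectionPerm]
  exact h _

/-- It suffices to test congruence on the simple coroots. -/
lemma congr_of_forall_mem_support (b : P.Base) {i j : ι}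
    (h : ∀ k ∈ b.support, Even (P.pairingIn ℤ i k - P.pairingIn ℤ j k)) : P.Congr i j := by
  have key : ∀ y ∈ Submodule.span ℤ (P.coroot '' b.support),
      ∃ m : ℤ, P.toLinearMap (P.root i) y - P.toLinearMap (P.root j) y = 2 * m := by
    intro y hy
    induction hy using Submodule.span_induction with
    | mem y hy =>
      obtain ⟨k, hk, rfl⟩ := hy
      obtain ⟨m, hm⟩ := h k hk
      refine ⟨m, ?_⟩
      have h1 := P.algebraMap_pairingIn ℤ i k
      have h2 := P.algebraMap_pairingIn ℤ j k
      rw [algebraMap_int_eq, eq_intCast] at h1 h2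
      rw [P.root_coroot_eq_pairing, P.root_coroot_eq_pairing, ← h1, ← h2, ← Int.cast_sub, hm]
      push_cast; ring
    | zero => exact ⟨0, by simp⟩
    | add x y _ _ h h' =>
      obtain ⟨m, hm⟩ := h
      obtain ⟨m', hm'⟩ := h'
      exact ⟨m + m', by rw [map_add, map_add]; push_cast; linarith⟩
    | smul n x _ h =>
      obtain ⟨m, hm⟩ := h
      refine ⟨n * m, ?_⟩
      rw [map_zsmul, map_zsmul, zsmul_eq_mul, zsmul_eq_mul, ← mul_sub, hm]
      push_cast; ring
  intro k
  obtain ⟨m, hm⟩ := key _ (b.coroot_mem_span_int k)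
  refine ⟨m, ?_⟩
  have h1 := P.algebraMap_pairingIn ℤ i k
  have h2 := P.algebraMap_pairingIn ℤ j k
  rw [algebraMap_int_eq, eq_intCast] at h1 h2
  rw [P.root_coroot_eq_pairing, P.root_coroot_eq_pairing, ← h1, ← h2, ← Int.cast_sub] at hm
  have : P.pairingIn ℤ i k - P.pairingIn ℤ j k = 2 * m := by exact_mod_cast hm
  omega

variable [Finite ι] [P.IsReduced]

/-- Non-proportional congruent roots are orthogonal. -/
lemma Congr.pairingIn_eq_zero {i j : ι} (h : P.Congr i j) (h1 : P.root i ≠ P.root j)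
    (h2 : P.root i ≠ -P.root j) : P.pairingIn ℤ i j = 0 := by
  have h3 := P.pairingIn_pairingIn_mem_set_of_isCrystal_of_isRed' i j h1 h2
  have h4 := h j
  have h5 := h i
  rw [P.pairingIn_same] at h4 h5
  have h4' : Even (P.pairingIn ℤ i j) := by
    have := h4.add even_two
    rwa [sub_add_cancel] at this
  have h5' : Even (P.pairingIn ℤ j i) := by
    have := even_two.sub h5
    rwa [sub_sub_cancel] at this
  simp only [Set.mem_insert_iff, Set.mem_singleton_iff, Prod.mk.injEq] at h3
  rw [Int.even_iff] at h4' h5'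
  omega

end

section

variable {ι M N : Type*} [AddCommGroup M] [Module ℝ M] [AddCommGroup N] [Module ℝ N]
  {P : RootPairing ι ℝ M N} [P.IsCrystallographic] [P.IsRootSystem] [Finite ι]

/-- Every congruence class of positive roots has an even number of elements. -/
def EvenClasses (b : P.Base) : Prop :=
  ∀ i, b.IsPos i → Even (Nat.card {j // b.IsPos j ∧ P.Congr i j})

open Classical in
/-- The positive one of a root and its negative. -/
noncomputable def Base.abs (b : P.Base) (i : ι) : ι :=
  if b.IsPos i then i else P.reflectionPerm i i

omit [P.IsCrystallographic] [P.IsRootSystem] [Finite ι] in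
lemma Base.isPos_abs (b : P.Base) (i : ι) : b.IsPos (b.abs i) := by
  rw [abs]
  split_ifs with h
  · exact h
  · exact (IsPos.neg_iff_not b i).mpr h

omit [P.IsCrystallographic] [P.IsRootSystem] [Finite ι] in
lemma Base.root_abs (b : P.Base) (i : ι) :
    P.root (b.abs i) = P.root i ∨ P.root (b.abs i) = -P.root i := by
  rw [abs]
  split_ifs with h
  · exact Or.inl rfl
  · right; simp

omit [P.IsRootSystem] [Finite ι] in
lemma Base.congr_abs (b : P.Base) (i : ι) : P.Congr i (b.abs i) := by
  rw [abs]
  split_ifs with h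
  · exact Congr.refl i
  · exact congr_neg i

omit [P.IsCrystallographic] [P.IsRootSystem] [Finite ι] in
lemma Base.eq_of_isPos (b : P.Base) {i j : ι} (hi : b.IsPos i) (hj : b.IsPos j)
    (h : P.root i = P.root j ∨ P.root i = -P.root j) : i = j := by
  rcases h with h | h
  · exact P.root.injective h
  · exact absurd hj ((b.isPos_iff_of_root_eq_neg h).mp hi)

/-- If all congruence classes are even, then two short roots are congruent. Otherwise some class
would consist of a short root and of long roots, and a reflection would permute the latter
without fixing any of them up to sign. -/
lemma NormForm.exists_shortPair [P.IsIrreducible] [P.IsReduced] (F : P.NormForm) {i : ι}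
    (hi : F.form (P.root i) (P.root i) = 2) {b : P.Base} (hE : EvenClasses b) :
    Nonempty (ShortPair F) := by
  classical
  have := Fintype.ofFinite ι
  wlog hpos : b.IsPos i generalizing i
  · refine this (i := P.reflectionPerm i i) ?_ ((Base.IsPos.neg_iff_not b i).mpr hpos)
    simpa using hi
  let B : P.EuclForm := ⟨F.form, F.symm, F.pos, F.coroot_mul⟩
  by_contra hS
  set T : Finset ι := Finset.univ.filter fun j ↦ (b.IsPos j ∧ P.Congr i j) ∧ j ≠ i with hT
  -- the other members of the class are long and orthogonal to `i`
  have horth : ∀ j ∈ T, P.pairingIn ℤ i j = 0 ∧ F.form (P.root i) (P.root j) = 0 ∧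
      F.form (P.root j) (P.root j) = 4 := by
    intro j hj
    simp only [hT, Finset.mem_filter, Finset.mem_univ, true_and] at hj
    obtain ⟨⟨hj, hc⟩, hne⟩ := hj
    have h0 := hc.pairingIn_eq_zero (fun h ↦ hne (P.root.injective h).symm)
      fun h ↦ hne (b.eq_of_isPos hpos hj (Or.inr h)).symm
    have h1 := B.pairingIn_mul i j
    rw [h0] at h1
    have h2 : F.form (P.root i) (P.root j) = 0 := by
      push_cast at h1
      have : B.form (P.root i) (P.root j) = 0 := by linarith
      exact this
    refine ⟨h0, h2, (F.len j).resolve_left fun h ↦ hS ⟨⟨i, j, hc, hi, h, h2⟩⟩⟩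
  have hcard : Nat.card {j // b.IsPos j ∧ P.Congr i j} = T.card + 1 := by
    rw [Nat.card_eq_fintype_card, Fintype.card_subtype]
    have : (Finset.univ.filter fun j ↦ b.IsPos j ∧ P.Congr i j) = insert i T := by
      ext j
      simp only [hT, Finset.mem_filter, Finset.mem_univ, true_and, Finset.mem_insert]
      by_cases h : j = i
      · subst h; simp [hpos, Congr.refl]
      · simp [h]
    rw [this, Finset.card_insert_of_notMem (by simp [hT])]
  have hodd : Odd T.card := by
    have := hE i hpos
    rw [hcard, Nat.even_add_one, Nat.not_even_iff_odd] at this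
    exact this
  obtain ⟨j₀, hj₀⟩ : T.Nonempty := Finset.card_pos.mp hodd.pos
  -- a long root `d` not orthogonal to `i`
  obtain ⟨d₀, hd₀, hne⟩ := exists_pairingIn_ne_zero B i j₀
  have hlen₀ : F.form (P.root d₀) (P.root d₀) = 4 := hd₀.trans (horth j₀ hj₀).2.2
  obtain ⟨d, hd, hpair⟩ : ∃ d, F.form (P.root d) (P.root d) = 4 ∧ 0 < P.pairingIn ℤ i d := by
    rcases lt_or_gt_of_ne hne with h | h
    · exact ⟨P.reflectionPerm d₀ d₀, by simpa using hlen₀, by simpa using h⟩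
    · exact ⟨d₀, hlen₀, h⟩
  have hswap := B.pairingIn_mul_swap i d
  have hi' : B.len i = 2 := hi
  have hd' : B.len d = 4 := hd
  rw [hi', hd'] at hswap
  have hswap' : P.pairingIn ℤ d i = 2 * P.pairingIn ℤ i d := by
    have : (P.pairingIn ℤ d i : ℝ) = 2 * P.pairingIn ℤ i d := by linarith
    exact_mod_cast this
  have hone : P.pairingIn ℤ i d = 1 ∧ P.pairingIn ℤ d i = 2 := by
    have h3 := P.pairingIn_pairingIn_mem_set_of_isCrystal_of_isRed i d
    simp only [Set.mem_insert_iff, Set.mem_singleton_iff, Prod.mk.injEq] at h3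
    omega
  have hfd : F.form (P.root i) (P.root d) = 2 := by
    have := B.pairingIn_mul i d
    rw [hone.1, hd'] at this
    have h' : B.form (P.root i) (P.root d) = 2 := by push_cast at this; linarith
    exact h'
  have hdne : d ≠ i := by rintro rfl; rw [hi] at hd; norm_num at hd
  obtain ⟨e, he⟩ := P.root_sub_root_mem_of_pairingIn_pos (i := d) (j := i) (by omega) hdne
  have hfe : F.form (P.root e) (P.root e) = 2 := by
    rw [he]
    simp only [map_sub, LinearMap.sub_apply, F.symm (P.root d) (P.root i), hfd, hd, hi]
    norm_num
  have hie : P.reflectionPerm e i = i := by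
    apply P.root.injective
    have h1 := F.coroot_mul (P.root i) e
    have h2 : F.form (P.root i) (P.root e) = 0 := by
      rw [he, map_sub, hfd, hi, sub_self]
    rw [h2, hfe] at h1
    rw [P.root_reflectionPerm, P.reflection_apply, show P.coroot' e (P.root i) = 0 by linarith,
      zero_smul, sub_zero]
  -- the reflection in `e` permutes the long members of the class up to sign, without fixed points
  have hfix : ∀ k ∈ T, F.form (P.root k) (P.root e) ≠ 0 := by
    intro k hk
    obtain ⟨-, h2, h3⟩ := horth k hk
    simp only [hT, Finset.mem_filter, Finset.mem_univ, true_and] at hk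
    have h4 := hk.1.2 d
    rw [hone.1] at h4
    have h5 := B.pairingIn_mul k d
    rw [hd'] at h5
    rw [he, map_sub, F.symm (P.root k) (P.root i), h2, sub_zero]
    intro h6
    have h7 : B.form (P.root k) (P.root d) = 0 := h6
    rw [h7] at h5
    have h8 : P.pairingIn ℤ k d = 0 := by
      have : (P.pairingIn ℤ k d : ℝ) = 0 := by linarith
      exact_mod_cast this
    rw [h8] at h4
    exact absurd h4 (by decide)
  let g : ι → ι := fun k ↦ b.abs (P.reflectionPerm e k)
  have hgroot : ∀ k, P.root (g k) = P.reflection e (P.root k) ∨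
      P.root (g k) = -P.reflection e (P.root k) := by
    intro k
    rw [← P.root_reflectionPerm]
    exact b.root_abs _
  have hgT : ∀ k ∈ T, g k ∈ T := by
    intro k hk
    have hk4 := (horth k hk).2.2
    simp only [hT, Finset.mem_filter, Finset.mem_univ, true_and] at hk ⊢
    refine ⟨⟨b.isPos_abs _, ?_⟩, ?_⟩
    · have := hk.1.2.reflectionPerm e
      rw [hie] at this
      exact this.trans (b.congr_abs _)
    · intro h
      have h1 : F.form (P.root (g k)) (P.root (g k)) = 4 := by
        rcases hgroot k with h | h <;> rw [h] <;>
          simp only [map_neg, LinearMap.neg_apply, neg_neg, F.form_reflection, hk4]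
      rw [h, hi] at h1
      norm_num at h1
  have hsum : ∑ _k ∈ T, (1 : ZMod 2) = 0 := by
    refine Finset.sum_involution (fun k _ ↦ g k) (fun k _ ↦ by decide) ?_ (fun k hk ↦ hgT k hk) ?_
    · intro k hk _ hgk
      have h1 := hfix k hk
      have h2 := F.coroot_mul (P.root k) e
      have h3 := (horth k hk).2.2
      rw [hfe] at h2
      have h4 := hgroot k
      rw [hgk, P.reflection_apply, show P.coroot' e (P.root k) = F.form (P.root k) (P.root e) by
        linarith] at h4
      rcases h4 with h4 | h4
      · have h5 : F.form (P.root k) (P.root e) • P.root e = 0 := by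
          rwa [eq_comm, sub_eq_self] at h4
        rcases smul_eq_zero.mp h5 with h6 | h6
        · exact h1 h6
        · exact P.ne_zero e h6
      · have h5 := congrArg (F.form (P.root k)) h4
        simp only [map_neg, map_sub, map_smul, h3, smul_eq_mul] at h5
        have h6 : F.form (P.root k) (P.root e) ^ 2 = 8 := by linarith
        obtain ⟨m, hm⟩ : ∃ m : ℤ, F.form (P.root k) (P.root e) = m := by
          refine ⟨P.pairingIn ℤ k e, ?_⟩
          have := B.pairingIn_mul k e
          have he' : B.len e = 2 := hfe
          rw [he'] at this
          have h7 : B.form (P.root k) (P.root e) = P.pairingIn ℤ k e := by linarith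
          exact h7
        rw [hm] at h6
        have h7 : m ^ 2 = 8 := by exact_mod_cast h6
        have : m < 3 := by nlinarith
        have : -3 < m := by nlinarith
        interval_cases m <;> omega
    · intro k hk
      have hk' := hk
      simp only [hT, Finset.mem_filter, Finset.mem_univ, true_and] at hk'
      refine b.eq_of_isPos (b.isPos_abs _) hk'.1.1 ?_
      have h1 : P.reflection e (P.reflection e (P.root k)) = P.root k :=
        P.reflection_same e (P.root k)
      rcases hgroot k with h | h <;> rcases hgroot (g k) with h' | h' <;> rw [h] at h' <;>
        simp only [map_neg, neg_neg, h1] at h'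
      · exact Or.inl h'
      · exact Or.inr h'
      · exact Or.inr h'
      · exact Or.inl h'
  rw [Finset.sum_const, nsmul_eq_mul, mul_one, ZMod.natCast_eq_zero_iff_even] at hsum
  exact Nat.not_even_iff_odd.mpr hodd hsum

end

end RootPairing

/-! ### The admissible Cartan matrices -/

namespace RootPairing

section

variable {ι M N : Type*} [AddCommGroup M] [Module ℝ M] [AddCommGroup N] [Module ℝ N]
  {P : RootPairing ι ℝ M N} [P.IsCrystallographic] [P.IsRootSystem] [Finite ι]

/-- The base `b` has the Cartan matrix `A`, up to a numbering of the simple roots. For the root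
system of a Lie algebra this is `RealFlag.HasCartanMatrix`. -/
def Base.HasMatrix (b : P.Base) {n : ℕ} (A : Matrix (Fin n) (Fin n) ℤ) : Prop :=
  ∃ e : b.support ≃ Fin n, ∀ i j, b.cartanMatrix i j = A (e i) (e j)

/-- The root systems for which invariant almost complex structures exist: `G₂`, and those that
admit a frame, of even rank if there are long roots. -/
def Admissible (b : P.Base) : Prop :=
  P.IsG2 ∨ ∃ (F : P.NormForm) (n : ℕ) (O : OrthFrame F b n), O.IsLong → Even n

namespace Base

variable {b : P.Base}

omit [P.IsRootSystem] [Finite ι] in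
lemma HasMatrix.submatrix {n : ℕ} {A A' : Matrix (Fin n) (Fin n) ℤ} (h : b.HasMatrix A)
    (σ : Fin n ≃ Fin n) (hσ : ∀ p q, A p q = A' (σ p) (σ q)) : b.HasMatrix A' := by
  obtain ⟨e, he⟩ := h
  exact ⟨e.trans σ, fun i j ↦ by rw [he, hσ]; rfl⟩

omit [P.IsRootSystem] [Finite ι] in
/-- A numbering of the simple roots by natural numbers. -/
lemma HasMatrix.exists_numbering {n : ℕ} {A : Matrix (Fin n) (Fin n) ℤ} (h : b.HasMatrix A)
    (hn : 0 < n) : ∃ a : ℕ → ι, (∀ i ∈ b.support, ∃ p < n, i = a p) ∧ (∀ p < n, a p ∈ b.support) ∧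
      b.support.card = n ∧
      ∀ p q (hp : p < n) (hq : q < n), P.pairingIn ℤ (a p) (a q) = A ⟨p, hp⟩ ⟨q, hq⟩ := by
  obtain ⟨e, he⟩ := h
  refine ⟨fun p ↦ if h : p < n then (e.symm ⟨p, h⟩).1 else (e.symm ⟨0, hn⟩).1, ?_, ?_, ?_, ?_⟩
  · intro i hi
    exact ⟨e ⟨i, hi⟩, (e ⟨i, hi⟩).2, by simp⟩
  · intro p hp
    simp [hp]
  · simpa using Fintype.card_congr e
  · intro p q hp hq
    have := he (e.symm ⟨p, hp⟩) (e.symm ⟨q, hq⟩)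
    rw [Base.cartanMatrix, Base.cartanMatrixIn_def] at this
    simpa [hp, hq] using this

variable [P.IsReduced]

/-- The short pair consists of the last short simple root and of its sum with the long simple root. -/
lemma HasMatrix.exists_shortPair_C {l : ℕ} (hl : 2 ≤ l) (h : b.HasMatrix (CartanMatrix.C l)) :
    ∃ F : P.NormForm, Nonempty (ShortPair F) := by
  obtain ⟨a, ha, hab, -, hA⟩ := h.exists_numbering (by omega)
  obtain ⟨B⟩ := P.exists_euclForm
  have hA' : ∀ p q, p < l → q < l → P.pairingIn ℤ (a p) (a q) =
      if p = q then 2 else if p + 1 = q then -1 else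
        if q + 1 = p then if p = l - 1 then -2 else -1 else 0 := by
    intro p q hp hq
    rw [hA p q hp hq]
    simp [CartanMatrix.C]
  have hlen : ∀ k, k + 2 ≤ l → B.len (a (l - 2 - k)) = B.len (a (l - 2)) := by
    intro k
    induction k with
    | zero => intro _; rfl
    | succ k ih =>
      intro hk
      rw [← ih (by omega)]
      have h1 := B.pairingIn_mul_swap (a (l - 2 - (k + 1))) (a (l - 2 - k))
      rw [hA' _ _ (by omega) (by omega), hA' _ _ (by omega) (by omega), if_neg (by omega),
        if_pos (by omega), if_neg (by omega), if_neg (by omega), if_pos (by omega),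
        if_neg (by omega)] at h1
      push_cast at h1
      linarith
  set s := B.len (a (l - 2)) with hs
  have hlast : B.len (a (l - 1)) = 2 * s := by
    have h1 := B.pairingIn_mul_swap (a (l - 1)) (a (l - 2))
    rw [hA' _ _ (by omega) (by omega), hA' _ _ (by omega) (by omega), if_neg (by omega),
      if_neg (by omega), if_pos (by omega), if_pos rfl, if_neg (by omega),
      if_pos (by omega)] at h1
    push_cast at h1
    linarith
  have hall : ∀ i, B.len i = s ∨ B.len i = 2 * s := by
    intro i
    obtain ⟨j, hj, hij⟩ := B.exists_mem_support_len_eq b i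
    obtain ⟨p, hp, rfl⟩ := ha j hj
    rw [hij]
    rcases lt_or_ge (p + 1) l with hp' | hp'
    · left
      have := hlen (l - 2 - p) (by omega)
      rwa [show l - 2 - (l - 2 - p) = p by omega] at this
    · right
      obtain rfl : p = l - 1 := by omega
      exact hlast
  have hs0 : 0 < s := B.len_pos _
  have hpair : P.pairingIn ℤ (a (l - 2)) (a (l - 1)) = -1 := by
    rw [hA' _ _ (by omega) (by omega), if_neg (by omega), if_pos (by omega)]
  have hroot : P.root (P.reflectionPerm (a (l - 1)) (a (l - 2))) =
      P.root (a (l - 2)) + P.root (a (l - 1)) := by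
    rw [P.root_reflectionPerm, P.reflection_apply_root' ℤ, hpair]
    module
  have hlen2 : B.len (P.reflectionPerm (a (l - 1)) (a (l - 2))) = s := by
    rw [B.len_reflectionPerm]
  have hform : B.form (P.root (a (l - 2))) (P.root (a (l - 1))) = -s := by
    have := B.pairingIn_mul (a (l - 2)) (a (l - 1))
    rw [hpair, hlast] at this
    push_cast at this
    linarith
  refine ⟨B.toNormForm hs0 hall, ⟨⟨a (l - 2), P.reflectionPerm (a (l - 1)) (a (l - 2)), ?_,
    B.toNormForm_form_self _ _ rfl, B.toNormForm_form_self _ _ hlen2, ?_⟩⟩⟩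
  · apply congr_of_forall_mem_support b
    intro k hk
    obtain ⟨q, hq, rfl⟩ := ha k hk
    have h1 : P.pairingIn ℤ (P.reflectionPerm (a (l - 1)) (a (l - 2))) (a q) =
        P.pairingIn ℤ (a (l - 2)) (a q) + P.pairingIn ℤ (a (l - 1)) (a q) := by
      have h := P.algebraMap_pairingIn ℤ (P.reflectionPerm (a (l - 1)) (a (l - 2))) (a q)
      rw [← P.root_coroot_eq_pairing, hroot, map_add, LinearMap.add_apply,
        P.root_coroot_eq_pairing, P.root_coroot_eq_pairing, ← P.algebraMap_pairingIn ℤ,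
        ← P.algebraMap_pairingIn ℤ, ← map_add] at h
      exact FaithfulSMul.algebraMap_injective ℤ ℝ h
    rw [h1, sub_add_cancel_left, even_neg, hA' _ _ (by omega) hq]
    split_ifs <;> first | omega | decide
  · simp only [EuclForm.toNormForm, LinearMap.smul_apply, smul_eq_mul]
    have h2 : B.form (P.root (a (l - 2))) (P.root (a (l - 2))) = s := rfl
    rw [hroot, map_add, hform, h2, add_neg_cancel, mul_zero]

/-- Roots of type `D` all have the same length, and the last two simple roots form a short pair. -/
lemma HasMatrix.exists_shortPair_D {l : ℕ} (hl : 3 ≤ l) (h : b.HasMatrix (CartanMatrix.D l)) :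
    ∃ F : P.NormForm, (∀ i, F.form (P.root i) (P.root i) = 2) ∧ Nonempty (ShortPair F) := by
  obtain ⟨a, ha, hab, -, hA⟩ := h.exists_numbering (by omega)
  obtain ⟨B⟩ := P.exists_euclForm
  have hA' : ∀ p q, p < l → q < l → P.pairingIn ℤ (a p) (a q) =
      if p = q then 2 else if p + 1 = q ∧ q + 2 < l then -1 else
        if q + 1 = p ∧ p + 2 < l then -1 else
          if p + 3 = l ∧ (q + 2 = l ∨ q + 1 = l) then -1 else
            if q + 3 = l ∧ (p + 2 = l ∨ p + 1 = l) then -1 else 0 := by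
    intro p q hp hq
    rw [hA p q hp hq]
    simp [CartanMatrix.D, show ¬ l ≤ 2 by omega]
  have hswap : ∀ p q, p < l → q < l → P.pairingIn ℤ (a p) (a q) = -1 →
      P.pairingIn ℤ (a q) (a p) = -1 → B.len (a p) = B.len (a q) := by
    intro p q hp hq h1 h2
    have h3 := B.pairingIn_mul_swap (a p) (a q)
    rw [h1, h2] at h3
    push_cast at h3
    linarith
  have hlen : ∀ k, k + 3 ≤ l → B.len (a (l - 3 - k)) = B.len (a (l - 3)) := by
    intro k
    induction k with
    | zero => intro _; rfl
    | succ k ih =>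
      intro hk
      rw [← ih (by omega)]
      apply hswap _ _ (by omega) (by omega)
      · rw [hA' _ _ (by omega) (by omega), if_neg (by omega), if_pos (by omega)]
      · rw [hA' _ _ (by omega) (by omega), if_neg (by omega), if_neg (by omega), if_pos (by omega)]
  set s := B.len (a (l - 3)) with hs
  have hlast : ∀ q, q < l → l < q + 3 → B.len (a q) = s := by
    intro q hq hq'
    apply hswap _ _ hq (by omega)
    · rw [hA' _ _ (by omega) (by omega), if_neg (by omega), if_neg (by omega), if_neg (by omega),
        if_neg (by omega), if_pos (by omega)]
    · rw [hA' _ _ (by omega) (by omega), if_neg (by omega), if_neg (by omega), if_neg (by omega),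
        if_pos (by omega)]
  have hall : ∀ i, B.len i = s := by
    intro i
    obtain ⟨j, hj, hij⟩ := B.exists_mem_support_len_eq b i
    obtain ⟨p, hp, rfl⟩ := ha j hj
    rw [hij]
    rcases lt_or_ge (p + 2) l with hp' | hp'
    · have := hlen (l - 3 - p) (by omega)
      rwa [show l - 3 - (l - 3 - p) = p by omega] at this
    · exact hlast p hp (by omega)
  have hs0 : 0 < s := B.len_pos _
  refine ⟨B.toNormForm hs0 fun i ↦ Or.inl (hall i), fun i ↦ B.toNormForm_form_self _ _ (hall i),
    ⟨⟨a (l - 2), a (l - 1), ?_, B.toNormForm_form_self _ _ (hall _),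
      B.toNormForm_form_self _ _ (hall _), ?_⟩⟩⟩
  · apply congr_of_forall_mem_support b
    intro k hk
    obtain ⟨q, hq, rfl⟩ := ha k hk
    rw [hA' _ _ (by omega) hq, hA' _ _ (by omega) hq]
    split_ifs <;> first | omega | decide
  · simp only [EuclForm.toNormForm, LinearMap.smul_apply, smul_eq_mul]
    have := B.pairingIn_mul (a (l - 2)) (a (l - 1))
    rw [hA' _ _ (by omega) (by omega), if_neg (by omega), if_neg (by omega), if_neg (by omega),
      if_neg (by omega), if_neg (by omega)] at this
    push_cast at this
    rw [show B.form (P.root (a (l - 2))) (P.root (a (l - 1))) = 0 by linarith, mul_zero]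

lemma HasMatrix.admissible_C [P.IsIrreducible] {l : ℕ} (hl : 2 ≤ l) (he : Even l)
    (h : b.HasMatrix (CartanMatrix.C l)) : Admissible b := by
  obtain ⟨F, ⟨S⟩⟩ := h.exists_shortPair_C hl
  obtain ⟨n, ⟨O⟩⟩ := ShortPair.exists_orthFrame b S
  obtain ⟨a, -, -, hcard, -⟩ := h.exists_numbering (by omega)
  have : n = l := by rw [← O.card, hcard]
  exact Or.inr ⟨F, n, O, fun _ ↦ this ▸ he⟩

lemma HasMatrix.admissible_D [P.IsIrreducible] {l : ℕ} (hl : 3 ≤ l)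
    (h : b.HasMatrix (CartanMatrix.D l)) : Admissible b := by
  obtain ⟨F, hF, ⟨S⟩⟩ := h.exists_shortPair_D hl
  obtain ⟨n, ⟨O⟩⟩ := ShortPair.exists_orthFrame b S
  refine Or.inr ⟨F, n, O, fun hlong ↦ ?_⟩
  have h0 : 0 < n := by have := O.two_le; omega
  obtain ⟨i, -, hi⟩ := hlong 0 h0
  have := hF i
  simp only [hi, map_smul, LinearMap.smul_apply, smul_eq_mul, O.form_self 0 h0] at this
  norm_num at this

omit [P.IsRootSystem] [Finite ι] in
lemma HasMatrix.isG2 [P.IsIrreducible] (h : b.HasMatrix CartanMatrix.G₂) : P.IsG2 := by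
  obtain ⟨a, -, -, -, hA⟩ := h.exists_numbering (by omega)
  exact (isG2_iff P).mpr ⟨a 0, a 1, by rw [hA 0 1 (by omega) (by omega)]; rfl⟩

/-- In type `G₂` the two simple roots pair to `-3` and `-1`. -/
lemma exists_support_eq_of_isG2 (hG : P.IsG2) (b : P.Base) :
    ∃ i j, i ∈ b.support ∧ j ∈ b.support ∧ P.pairingIn ℤ i j = -3 ∧ P.pairingIn ℤ j i = -1 := by
  classical
  obtain ⟨B⟩ := P.exists_euclForm
  obtain ⟨i, j, hij, hs⟩ := Finset.card_eq_two.mp (IsG2.card_base_support_eq_two b)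
  have hi : i ∈ b.support := by simp [hs]
  have hj : j ∈ b.support := by simp [hs]
  have hne : P.pairingIn ℤ j i ≠ 0 := by
    intro h0
    have := b.induction_on_cartanMatrix (fun k ↦ k = ⟨i, hi⟩) (i := ⟨i, hi⟩) (j := ⟨j, hj⟩) rfl ?_
    · exact hij (congrArg Subtype.val this).symm
    · rintro i' ⟨j', hj'⟩ rfl hne
      rw [hs, Finset.mem_insert, Finset.mem_singleton] at hj'
      rcases hj' with rfl | rfl
      · rfl
      · rw [Base.cartanMatrix, Base.cartanMatrixIn_def] at hne
        exact absurd h0 hne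
  have h1 := b.pairingIn_le_zero_of_ne hij hi hj
  have h2 := P.pairingIn_pairingIn_mem_set_of_isCrystal_of_isRed i j
  have hr : P.root i ≠ P.root j := fun h ↦ hij (P.root.injective h)
  have hr' := b.root_ne_neg_of_ne hi hj hij
  have h3 := IsG2.pairingIn_mem_zero_one_three P i j hr hr'
  have h4 := IsG2.pairingIn_mem_zero_one_three P j i hr.symm
    (fun h ↦ hr' (by rw [h, neg_neg]))
  -- otherwise all roots would have the same length
  have h5 : ¬ (P.pairingIn ℤ i j = -1 ∧ P.pairingIn ℤ j i = -1) := by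
    rintro ⟨h5, h6⟩
    have h7 := B.pairingIn_mul_swap i j
    rw [h5, h6] at h7
    have hlen : ∀ k, B.len k = B.len i := by
      intro k
      obtain ⟨m, hm, hk⟩ := B.exists_mem_support_len_eq b k
      rw [hs, Finset.mem_insert, Finset.mem_singleton] at hm
      rcases hm with rfl | rfl
      · exact hk
      · push_cast at h7; linarith
    obtain ⟨k, m, hkm⟩ := hG.exists_pairingIn_neg_three
    have h8 := B.pairingIn_mul_swap k m
    rw [hlen k, hlen m] at h8
    have h9 : P.pairingIn ℤ k m = P.pairingIn ℤ m k := by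
      exact_mod_cast mul_right_cancel₀ (B.len_pos i).ne' h8
    have h10 := P.pairingIn_pairingIn_mem_set_of_isCrystal_of_isRed k m
    simp only [Set.mem_insert_iff, Set.mem_singleton_iff, Prod.mk.injEq] at h10
    omega
  simp only [Set.mem_insert_iff, Set.mem_singleton_iff, Prod.mk.injEq] at h2 h3 h4
  rcases (show (P.pairingIn ℤ i j = -3 ∧ P.pairingIn ℤ j i = -1) ∨
    (P.pairingIn ℤ j i = -3 ∧ P.pairingIn ℤ i j = -1) by omega) with h | h
  · exact ⟨i, j, hi, hj, h⟩
  · exact ⟨j, i, hj, hi, h⟩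

lemma hasMatrix_G2 (hG : P.IsG2) (b : P.Base) : b.HasMatrix CartanMatrix.G₂ := by
  obtain ⟨i, j, hi, hj, hij, hji⟩ := exists_support_eq_of_isG2 hG b
  have hne : i ≠ j := by
    rintro rfl
    rw [P.pairingIn_same] at hij
    norm_num at hij
  let f : Fin 2 → b.support := ![⟨i, hi⟩, ⟨j, hj⟩]
  have hf : Function.Bijective f := by
    rw [Fintype.bijective_iff_injective_and_card]
    refine ⟨?_, by simp⟩
    intro p q h
    fin_cases p <;> fin_cases q <;> simp [f, hne, hne.symm] at h ⊢
  have key : ∀ p q, b.cartanMatrix (f p) (f q) = CartanMatrix.G₂ p q := by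
    intro p q
    rw [Base.cartanMatrix, Base.cartanMatrixIn_def]
    fin_cases p <;> fin_cases q <;> simp [f, CartanMatrix.G₂, hij, hji]
  refine ⟨(Equiv.ofBijective f hf).symm, fun i j ↦ ?_⟩
  rw [← key]
  congr 1
  · exact ((Equiv.ofBijective f hf).apply_symm_apply i).symm
  · exact ((Equiv.ofBijective f hf).apply_symm_apply j).symm

/-- The admissible root systems, in terms of Cartan matrices. -/
lemma admissible_iff [P.IsIrreducible] :
    Admissible b ↔ b.HasMatrix (CartanMatrix.A 3) ∨ b.HasMatrix (CartanMatrix.B 2) ∨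
      b.HasMatrix CartanMatrix.G₂ ∨
      (∃ l : ℕ, 2 ≤ l ∧ Even l ∧ b.HasMatrix (CartanMatrix.C l)) ∨
      ∃ l : ℕ, 4 ≤ l ∧ b.HasMatrix (CartanMatrix.D l) := by
  constructor
  · rintro (h | ⟨F, n, O, hO⟩)
    · exact Or.inr (Or.inr (Or.inl (hasMatrix_G2 h b)))
    by_cases hl : O.IsLong
    · exact Or.inr (Or.inr (Or.inr (Or.inl ⟨n, O.two_le, hO hl, O.exists_cartanMatrix_eq_C hl⟩)))
    · have hn := O.three_le hl
      have hD : b.HasMatrix (CartanMatrix.D n) := O.exists_cartanMatrix_eq_D hl hn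
      rcases hn.lt_or_eq with hn' | rfl
      · exact Or.inr (Or.inr (Or.inr (Or.inr ⟨n, hn', hD⟩)))
      · exact Or.inl (hD.submatrix (Equiv.swap 0 1) (by
        intro p q; fin_cases p <;> fin_cases q <;> rfl))
  · rintro (h | h | h | ⟨l, hl, he, h⟩ | ⟨l, hl, h⟩)
    · exact (h.submatrix (A' := CartanMatrix.D 3) (Equiv.swap 0 1) (by
        intro p q; fin_cases p <;> fin_cases q <;> rfl)).admissible_D le_rfl
    · exact (h.submatrix (A' := CartanMatrix.C 2) (Equiv.swap 0 1) (by
        intro p q; fin_cases p <;> fin_cases q <;> rfl)).admissible_C le_rfl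
        even_two
    · exact Or.inl h.isG2
    · exact h.admissible_C hl he
    · exact h.admissible_D (by omega)

end Base

omit [P.IsRootSystem] [Finite ι] in
/-- In the presence of long roots, the class of `2 e₀` consists of the roots `2 e_p`. -/
lemma OrthFrame.even_of_evenClasses [P.IsReduced] {F : P.NormForm} {b : P.Base} {n : ℕ}
    (O : OrthFrame F b n) (hl : O.IsLong) (hE : EvenClasses b) : Even n := by
  have hn := O.two_le
  choose r hr hr' using fun p : Fin n ↦ hl p p.2
  have hlen : ∀ p, F.form (P.root (r p)) (P.root (r p)) = 4 := by
    intro p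
    simp only [hr', map_smul, LinearMap.smul_apply, smul_eq_mul, O.form_self p p.2]
    norm_num
  let z : Fin n := ⟨0, by omega⟩
  have hform : ∀ x p, F.form x (P.root (r p)) = 2 * F.form x (O.e p) := by
    intro x p
    rw [hr', map_smul, smul_eq_mul]
  have hcongr : ∀ p, P.Congr (r z) (r p) := by
    intro p
    rcases eq_or_ne p z with rfl | hp
    · exact Congr.refl _
    obtain ⟨i, -, hi⟩ := O.sub_mem 0 p (by
      rw [Nat.pos_iff_ne_zero]; exact fun h ↦ hp (Fin.ext h)) p.2
    intro k
    refine ⟨P.pairingIn ℤ i k, ?_⟩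
    apply FaithfulSMul.algebraMap_injective ℤ ℝ
    simp only [map_sub, map_add, P.algebraMap_pairingIn]
    simp only [← P.root_coroot_eq_pairing, hr', hi, map_sub, map_smul, LinearMap.sub_apply,
      LinearMap.smul_apply, smul_eq_mul, z]
    ring
  let f : Fin n → {j // b.IsPos j ∧ P.Congr (r z) j} := fun p ↦ ⟨r p, hr p, hcongr p⟩
  have hf : Function.Bijective f := by
    constructor
    · intro p q h
      by_contra hpq
      have h1 : P.root (r p) = P.root (r q) := congrArg (fun j ↦ P.root j.1) h
      have h2 := hlen p
      nth_rw 2 [h1] at h2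
      rw [hform, hr', map_smul, LinearMap.smul_apply,
        O.form_ne p p.2 q q.2 (fun h ↦ hpq (Fin.ext h))] at h2
      simp at h2
    · rintro ⟨j, hj, hc⟩
      rcases O.cases j hj with ⟨p, q, hpq, hq, h⟩ | ⟨p, hp, h⟩
      · exfalso
        -- the coroot of `2 e_p` distinguishes `e_p ± e_q` from `2 e₀`
        have hp := hpq.trans hq
        have h1 : P.pairingIn ℤ j (r ⟨p, hp⟩) = 1 := by
          apply F.pairingIn_eq
          rw [hlen, hform]
          have h2 := O.form_self p hp
          have h3 := O.form_ne q hq p hp hpq.ne'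
          rcases h with h | h <;> rw [h] <;>
            simp only [map_sub, map_add, LinearMap.sub_apply, LinearMap.add_apply, h2, h3] <;>
            norm_num
        have h2 : ∃ m, P.pairingIn ℤ (r z) (r ⟨p, hp⟩) = 2 * m := by
          rcases Nat.eq_zero_or_pos p with h0 | h0
          · subst h0
            exact ⟨1, by rw [P.pairingIn_same]; rfl⟩
          · refine ⟨0, F.pairingIn_eq ?_⟩
            rw [hform, hr', map_smul, LinearMap.smul_apply, O.form_ne z z.2 p hp (by
              simp only [z]; omega)]
            simp
        obtain ⟨m, hm⟩ := h2
        have h3 := hc (r ⟨p, hp⟩)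
        rw [h1, hm, Int.even_iff] at h3
        omega
      · exact ⟨⟨p, hp⟩, Subtype.ext (P.root.injective (by rw [h]; exact hr' ⟨p, hp⟩))⟩
  have := hE (r z) (hr z)
  rwa [← Nat.card_congr (Equiv.ofBijective f hf), Nat.card_fin] at this

lemma admissible_of_evenClasses [P.IsIrreducible] [P.IsReduced] [Nonempty ι] {b : P.Base}
    (hE : EvenClasses b) : Admissible b := by
  by_cases hG : P.IsG2
  · exact Or.inl hG
  · obtain ⟨F, i, hi⟩ := exists_normForm ((not_isG2_iff_isNotG2 P).mp hG)
    obtain ⟨S⟩ := F.exists_shortPair hi hE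
    obtain ⟨n, ⟨O⟩⟩ := ShortPair.exists_orthFrame b S
    exact Or.inr ⟨F, n, O, fun hl ↦ O.even_of_evenClasses hl hE⟩

end

end RootPairing

/-! ### Exponentials and inner automorphisms -/

namespace RealFlag

section Exponential

variable {V W : Type*} [AddCommGroup V] [Module ℝ V] [FiniteDimensional ℝ V]
  [AddCommGroup W] [Module ℝ W] [FiniteDimensional ℝ W]

/-- The exponential series, read through a linear functional. -/
lemma hasSum_expEnd (T : Module.End ℝ V) (f : V →ₗ[ℝ] ℝ) (v : V) :
    HasSum (fun n : ℕ ↦ ((n.factorial : ℝ)⁻¹) * f ((T ^ n) v)) (f (expEnd T v)) := by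
  set A := LinearMap.toMatrixAlgEquiv (Module.finBasis ℝ V) T with hA
  have h1 : HasSum (fun n : ℕ ↦ ((n.factorial : ℝ)⁻¹) • A ^ n) (NormedSpace.exp A) := by
    let := Matrix.linftyOpNormedRing (n := Fin (Module.finrank ℝ V)) (α := ℝ)
    let := Matrix.linftyOpNormedAlgebra (n := Fin (Module.finrank ℝ V)) (R := ℝ) (α := ℝ)
    exact NormedSpace.exp_series_hasSum_exp' A
  let L : Matrix (Fin (Module.finrank ℝ V)) (Fin (Module.finrank ℝ V)) ℝ →ₗ[ℝ] ℝ :=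
    f ∘ₗ LinearMap.applyₗ v ∘ₗ
      (LinearMap.toMatrixAlgEquiv (Module.finBasis ℝ V)).symm.toLinearMap
  have h2 := h1.map L.toAddMonoidHom (LinearMap.continuous_of_finiteDimensional L)
  have h3 : ∀ n : ℕ, L (((n.factorial : ℝ)⁻¹) • A ^ n) =
      ((n.factorial : ℝ)⁻¹) * f ((T ^ n) v) := by
    intro n
    simp [L, hA, ← map_pow]
  have h4 : (⇑L.toAddMonoidHom ∘ fun n : ℕ ↦ ((n.factorial : ℝ)⁻¹) • A ^ n) =
      fun n : ℕ ↦ ((n.factorial : ℝ)⁻¹) * f ((T ^ n) v) := funext h3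
  rw [h4] at h2
  exact h2

lemma eq_of_forall_dual {x y : V} (h : ∀ f : V →ₗ[ℝ] ℝ, f x = f y) : x = y := by
  rw [← sub_eq_zero, ← Module.forall_dual_apply_eq_zero_iff ℝ]
  intro f
  rw [map_sub, h f, sub_self]

/-- The exponential is natural. -/
lemma map_expEnd {T : Module.End ℝ V} {T' : Module.End ℝ W} (S : V →ₗ[ℝ] W)
    (h : ∀ v, S (T v) = T' (S v)) (v : V) : S (expEnd T v) = expEnd T' (S v) := by
  have hpow : ∀ (n : ℕ) v, S ((T ^ n) v) = (T' ^ n) (S v) := by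
    intro n
    induction n with
    | zero => intro v; rfl
    | succ n ih => intro v; rw [pow_succ, pow_succ, Module.End.mul_apply, ih, h]; rfl
  refine eq_of_forall_dual fun f ↦ ?_
  have h1 := hasSum_expEnd T (f ∘ₗ S) v
  have h2 := hasSum_expEnd T' f (S v)
  simp only [LinearMap.comp_apply, hpow] at h1
  exact h1.unique h2

lemma expEnd_mem {T : Module.End ℝ V} {U : Submodule ℝ V} (h : ∀ v ∈ U, T v ∈ U) {v : V}
    (hv : v ∈ U) : expEnd T v ∈ U := by
  have hpow : ∀ n : ℕ, (T ^ n) v ∈ U := by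
    intro n
    induction n with
    | zero => exact hv
    | succ n ih => rw [pow_succ', Module.End.mul_apply]; exact h _ ih
  by_contra hn
  obtain ⟨f, hf, hfU⟩ := Submodule.exists_le_ker_of_notMem hn
  have h1 := hasSum_expEnd T f v
  have h2 : (fun n : ℕ ↦ ((n.factorial : ℝ)⁻¹) * f ((T ^ n) v)) = fun _ ↦ 0 := by
    funext n
    rw [show f ((T ^ n) v) = 0 from hfU (hpow n), mul_zero]
  rw [h2] at h1
  exact hf (h1.unique hasSum_zero)

lemma expEnd_zero : expEnd (0 : Module.End ℝ V) = 1 := by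
  simp [expEnd]

lemma expEnd_add {A B : Module.End ℝ V} (h : Commute A B) :
    expEnd (A + B) = expEnd A * expEnd B := by
  simp only [expEnd, map_add]
  rw [Matrix.exp_add_of_commute _ _ (h.map _), map_mul]

lemma expEnd_of_apply_eq_zero {T : Module.End ℝ V} {v : V} (h : T v = 0) : expEnd T v = v := by
  have := map_expEnd (T := (0 : Module.End ℝ ℝ)) (T' := T) (LinearMap.toSpanSingleton ℝ V v)
    (fun c ↦ by simp [h]) 1
  rw [expEnd_zero] at this
  simpa using this.symm

/-- On vectors with `T² v = - k² v` the exponential is a rotation. -/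
lemma expEnd_smul_of_sq {T : Module.End ℝ V} {v : V} {k : ℝ} (hk : k ≠ 0)
    (h : T (T v) = -(k ^ 2) • v) (t : ℝ) :
    expEnd (t • T) v = Real.cos (t * k) • v + (Real.sin (t * k) / k) • T v := by
  have heven : ∀ n : ℕ, (T ^ (2 * n)) v = ((-1) ^ n * k ^ (2 * n)) • v := by
    intro n
    induction n with
    | zero => simp
    | succ n ih =>
      rw [show 2 * (n + 1) = 2 * n + 1 + 1 by ring, pow_succ, pow_succ, Module.End.mul_apply,
        Module.End.mul_apply, h, map_smul, ih, smul_smul]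
      congr 1; ring
  refine eq_of_forall_dual fun f ↦ ?_
  have h0 := hasSum_expEnd (t • T) f v
  refine h0.unique ?_
  have h1 := (Real.hasSum_cos (t * k)).mul_right (f v)
  have h2 := (Real.hasSum_sin (t * k)).mul_right (f (T v) / k)
  rw [map_add, map_smul, map_smul, smul_eq_mul, smul_eq_mul, div_mul_eq_mul_div, mul_div_assoc]
  refine HasSum.even_add_odd ?_ ?_
  · have h3 : ∀ n : ℕ, (((2 * n).factorial : ℝ)⁻¹) * f (((t • T) ^ (2 * n)) v) =
        (-1) ^ n * (t * k) ^ (2 * n) / (2 * n).factorial * f v := by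
      intro n
      rw [smul_pow, LinearMap.smul_apply, heven, map_smul, map_smul, smul_eq_mul, smul_eq_mul,
        mul_pow]
      ring
    simpa only [h3] using h1
  · have h3 : ∀ n : ℕ, (((2 * n + 1).factorial : ℝ)⁻¹) * f (((t • T) ^ (2 * n + 1)) v) =
        (-1) ^ n * (t * k) ^ (2 * n + 1) / (2 * n + 1).factorial * (f (T v) / k) := by
      intro n
      rw [smul_pow, LinearMap.smul_apply, pow_succ' T, Module.End.mul_apply, heven, map_smul,
        map_smul, map_smul, smul_eq_mul, smul_eq_mul, mul_pow, pow_succ k]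
      field_simp
    simpa only [h3] using h2

lemma expEnd_pi_smul_of_sq {T : Module.End ℝ V} {v : V} (m : ℤ)
    (h : T (T v) = -((m : ℝ) ^ 2) • v) (h0 : m = 0 → T v = 0) :
    expEnd (Real.pi • T) v = (-1 : ℝ) ^ m • v := by
  by_cases hm : m = 0
  · rw [expEnd_of_apply_eq_zero (by rw [LinearMap.smul_apply, h0 hm, smul_zero]), hm, zpow_zero,
      one_smul]
  · rw [expEnd_smul_of_sq (by exact_mod_cast hm) h, mul_comm, Real.sin_int_mul_pi,
      Real.cos_int_mul_pi, zero_div, zero_smul, add_zero]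

end Exponential

section InnerAutomorphism

variable {𝔤 : Type*} [LieRing 𝔤] [LieAlgebra ℝ 𝔤] [FiniteDimensional ℝ 𝔤]

/-- The exponential of a derivation is multiplicative: the bracket intertwines `D ⊗ 1 + 1 ⊗ D`
with `D`, and the two summands commute. -/
lemma expEnd_ad_lie (X Y Z : 𝔤) :
    expEnd (LieAlgebra.ad ℝ 𝔤 X) ⁅Y, Z⁆ =
      ⁅expEnd (LieAlgebra.ad ℝ 𝔤 X) Y, expEnd (LieAlgebra.ad ℝ 𝔤 X) Z⁆ := by
  set D : Module.End ℝ 𝔤 := LieAlgebra.ad ℝ 𝔤 X with hD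
  let β : 𝔤 ⊗[ℝ] 𝔤 →ₗ[ℝ] 𝔤 := TensorProduct.lift
    (LinearMap.mk₂ ℝ (fun x y ↦ ⁅x, y⁆) add_lie smul_lie lie_add lie_smul)
  have hβ : ∀ x y, β (x ⊗ₜ y) = ⁅x, y⁆ := fun x y ↦ rfl
  let R : Module.End ℝ (𝔤 ⊗[ℝ] 𝔤) := D.rTensor 𝔤
  let L : Module.End ℝ (𝔤 ⊗[ℝ] 𝔤) := D.lTensor 𝔤
  have hcomm : Commute R L := by
    apply TensorProduct.ext'
    intro x y
    rfl
  have h1 := map_expEnd (T := R + L) (T' := D) β (by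
    intro v
    induction v using TensorProduct.induction_on with
    | zero => simp
    | add x y hx hy => rw [map_add, map_add, map_add, map_add, hx, hy]
    | tmul x y =>
      change β (D x ⊗ₜ y + x ⊗ₜ D y) = D ⁅x, y⁆
      rw [map_add, hβ, hβ]
      exact (leibniz_lie X x y).symm) (Y ⊗ₜ Z)
  rw [hβ, expEnd_add hcomm, Module.End.mul_apply] at h1
  have h2 := map_expEnd (T := D) (T' := L) (TensorProduct.mk ℝ 𝔤 𝔤 Y) (fun v ↦ rfl) Z
  have h3 := map_expEnd (T := D) (T' := R) ((TensorProduct.mk ℝ 𝔤 𝔤).flip (expEnd D Z))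
    (fun v ↦ rfl) Y
  simp only [TensorProduct.mk_apply, LinearMap.flip_apply] at h2 h3
  rw [← h1, ← h2, ← h3, hβ]

/-- The inner automorphism `exp (ad X)`. -/
noncomputable def expLie (X : 𝔤) : 𝔤 ≃ₗ⁅ℝ⁆ 𝔤 where
  toFun := expEnd (LieAlgebra.ad ℝ 𝔤 X)
  map_add' := map_add _
  map_smul' := map_smul _
  map_lie' {Y Z} := expEnd_ad_lie X Y Z
  invFun := expEnd (-LieAlgebra.ad ℝ 𝔤 X)
  left_inv Y := by
    change (expEnd (-LieAlgebra.ad ℝ 𝔤 X) * expEnd (LieAlgebra.ad ℝ 𝔤 X)) Y = Y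
    rw [← expEnd_add (Commute.refl (LieAlgebra.ad ℝ 𝔤 X)).neg_left, neg_add_cancel, expEnd_zero]
    rfl
  right_inv Y := by
    change (expEnd (LieAlgebra.ad ℝ 𝔤 X) * expEnd (-LieAlgebra.ad ℝ 𝔤 X)) Y = Y
    rw [← expEnd_add (Commute.refl (LieAlgebra.ad ℝ 𝔤 X)).neg_right, add_neg_cancel, expEnd_zero]
    rfl

lemma expLie_apply (X Y : 𝔤) : expLie X Y = expEnd (LieAlgebra.ad ℝ 𝔤 X) Y := rfl

variable {θ : 𝔤 ≃ₗ⁅ℝ⁆ 𝔤}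

lemma expLie_mem {X : 𝔤} (hX : θ X = X) : expLie X ∈ maximalCompact θ :=
  Subgroup.subset_closure ⟨X, hX, fun _ ↦ rfl⟩

/-- A subspace stable under `ad 𝔨` is stable under `K`. -/
lemma apply_mem_of_maximalCompact {U : Submodule ℝ 𝔤} (hU : ∀ X, θ X = X → ∀ Y ∈ U, ⁅X, Y⁆ ∈ U)
    {k : 𝔤 ≃ₗ⁅ℝ⁆ 𝔤} (hk : k ∈ maximalCompact θ) : ∀ Y ∈ U, k Y ∈ U := by
  induction hk using Subgroup.closure_induction with
  | mem φ hφ =>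
    obtain ⟨X, hX, h⟩ := hφ
    intro Y hY
    rw [h]
    exact expEnd_mem (fun v hv ↦ hU X hX v hv) hY
  | one => intro Y hY; exact hY
  | mul φ ψ _ _ h h' => intro Y hY; exact h _ (h' Y hY)
  | inv φ _ h =>
    intro Y hY
    -- an injective endomorphism of the finite-dimensional space `U` is surjective
    have hinj : Function.Injective ((φ : 𝔤 →ₗ[ℝ] 𝔤).restrict (p := U) (q := U) h) := by
      intro x y hxy
      exact Subtype.ext (φ.injective (congrArg Subtype.val hxy))
    obtain ⟨⟨Z, hZ⟩, hZY⟩ := LinearMap.surjective_of_injective hinj ⟨Y, hY⟩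
    have : φ Z = Y := congrArg Subtype.val hZY
    change φ.symm Y ∈ U
    rw [← this, LieEquiv.symm_apply_apply]
    exact hZ

/-- A vector centralized by `𝔨` is fixed by `K`. -/
lemma apply_eq_of_maximalCompact {Z : 𝔤} (hZ : ∀ X, θ X = X → ⁅X, Z⁆ = 0)
    {k : 𝔤 ≃ₗ⁅ℝ⁆ 𝔤} (hk : k ∈ maximalCompact θ) : k Z = Z := by
  induction hk using Subgroup.closure_induction with
  | mem φ hφ =>
    obtain ⟨X, hX, h⟩ := hφ
    rw [h]
    exact expEnd_of_apply_eq_zero (hZ X hX)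
  | one => rfl
  | mul φ ψ _ _ h h' => change φ (ψ Z) = Z; rw [h', h]
  | inv φ _ h =>
    change φ.symm Z = Z
    rw [LieEquiv.symm_apply_eq, h]

/-- The elements of `K` commute with the Cartan involution. -/
lemma map_theta_of_maximalCompact {k : 𝔤 ≃ₗ⁅ℝ⁆ 𝔤} (hk : k ∈ maximalCompact θ) :
    ∀ Y, k (θ Y) = θ (k Y) := by
  induction hk using Subgroup.closure_induction with
  | mem φ hφ =>
    obtain ⟨X, hX, h⟩ := hφ
    intro Y
    rw [h, h]
    refine (map_expEnd (θ : 𝔤 →ₗ[ℝ] 𝔤) (fun v ↦ ?_) Y).symm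
    change θ ⁅X, v⁆ = ⁅X, θ v⁆
    rw [LieEquiv.map_lie, hX]
  | one => intro Y; rfl
  | mul φ ψ _ _ h h' => intro Y; change φ (ψ (θ Y)) = θ (φ (ψ Y)); rw [h', h]
  | inv φ _ h =>
    intro Y
    change φ.symm (θ Y) = θ (φ.symm Y)
    rw [LieEquiv.symm_apply_eq, h, LieEquiv.apply_symm_apply]

end InnerAutomorphism

end RealFlag

/-! ### Weight vectors and root vectors -/

namespace RealFlag

section WeightVectors

variable {𝔤 : Type*} [LieRing 𝔤] [LieAlgebra ℝ 𝔤] {𝔞 : LieSubalgebra ℝ 𝔤}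

/-- The vector `v` has weight `χ` for the adjoint action of `𝔞`. -/
def IsWt (χ : Module.Dual ℝ 𝔞) (v : 𝔤) : Prop := ∀ H : 𝔞, ⁅(H : 𝔤), v⁆ = χ H • v

namespace IsWt

variable {χ ψ : Module.Dual ℝ 𝔞} {v w : 𝔤}

lemma lie (hv : IsWt χ v) (hw : IsWt ψ w) : IsWt (χ + ψ) ⁅v, w⁆ := by
  intro H
  rw [leibniz_lie, hv H, hw H, smul_lie, lie_smul, ← add_smul]
  rfl

lemma smul (c : ℝ) (hv : IsWt χ v) : IsWt χ (c • v) := by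
  intro H
  rw [lie_smul, hv H, smul_comm]

lemma neg (hv : IsWt χ v) : IsWt χ (-v) := by
  rw [← neg_one_smul ℝ v]
  exact hv.smul _

variable {θ : 𝔤 ≃ₗ⁅ℝ⁆ 𝔤}

lemma theta (h𝔞 : ∀ H ∈ 𝔞, θ H = -H) (hv : IsWt χ v) : IsWt (-χ) (θ v) := by
  intro H
  have h1 : (H : 𝔤) = θ (-H) := by rw [map_neg, h𝔞 _ H.2, neg_neg]
  rw [h1, ← LieEquiv.map_lie, neg_lie, hv H, map_neg, map_smul, LinearMap.neg_apply, neg_smul]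

lemma map {k : 𝔤 ≃ₗ⁅ℝ⁆ 𝔤} (hk : ∀ H ∈ 𝔞, k H = H) (hv : IsWt χ v) : IsWt χ (k v) := by
  intro H
  conv_lhs => rw [← hk H H.2]
  rw [← LieEquiv.map_lie, hv H, map_smul]

end IsWt

end WeightVectors

section SplitForm

variable {𝔤 : Type*} [LieRing 𝔤] [LieAlgebra ℝ 𝔤] [FiniteDimensional ℝ 𝔤]
  [LieAlgebra.IsKilling ℝ 𝔤] {𝔞 : LieSubalgebra ℝ 𝔤} [𝔞.IsCartanSubalgebra]
  [LieModule.IsTriangularizable ℝ 𝔞 𝔤]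

lemma isWt_neg_iff_mem_weightSpace (i : 𝔞.root) {v : 𝔤} :
    IsWt (-(rootSystem 𝔞).root i) v ↔ v ∈ weightSpace 𝔤 (-(i.1 : 𝔞 → ℝ)) := by
  rw [mem_weightSpace]
  rfl

lemma isWt_of_mem_rootSpace {χ : Module.Dual ℝ 𝔞} {v : 𝔤}
    (hv : v ∈ LieAlgebra.rootSpace 𝔞 (χ : 𝔞 → ℝ)) : IsWt χ v :=
  fun H ↦ lie_eq_smul_of_mem_rootSpace hv H

omit [FiniteDimensional ℝ 𝔤] [LieAlgebra.IsKilling ℝ 𝔤] [IsTriangularizable ℝ (↥𝔞) 𝔤] in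
lemma IsWt.mem_rootSpace {χ : Module.Dual ℝ 𝔞} {v : 𝔤} (hv : IsWt χ v) :
    v ∈ LieAlgebra.rootSpace 𝔞 (χ : 𝔞 → ℝ) :=
  weightSpace_le_genWeightSpace 𝔤 _ ((mem_weightSpace _ _).mpr hv)

/-- The weights of nonzero vectors are zero or roots. -/
lemma IsWt.exists_root {χ : Module.Dual ℝ 𝔞} {v : 𝔤} (hv : IsWt χ v) (hv0 : v ≠ 0) (hχ : χ ≠ 0) :
    ∃ i, (rootSystem 𝔞).root i = χ := by
  let δ : Weight ℝ 𝔞 𝔤 := ⟨χ, fun h ↦ hv0 (by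
    have h1 : v ∈ genWeightSpace 𝔤 (χ : 𝔞 → ℝ) := hv.mem_rootSpace
    rwa [h, LieSubmodule.mem_bot] at h1)⟩
  have hδ : δ.IsNonZero := by
    intro h
    apply hχ
    ext H
    exact congrFun h H
  exact ⟨⟨δ, by simpa [LieSubalgebra.root] using hδ⟩, by ext H; rfl⟩

lemma IsWt.eq_zero_of_notMem {χ : Module.Dual ℝ 𝔞} {v : 𝔤} (hv : IsWt χ v) (hχ : χ ≠ 0)
    (h : χ ∉ Set.range (rootSystem 𝔞).root) : v = 0 := by
  by_contra hv0
  exact h (hv.exists_root hv0 hχ)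

/-- Root spaces are lines. -/
lemma IsWt.exists_smul {i : 𝔞.root} {v w : 𝔤} (hv : IsWt ((rootSystem 𝔞).root i) v)
    (hw : IsWt ((rootSystem 𝔞).root i) w) (hw0 : w ≠ 0) : ∃ c : ℝ, v = c • w := by
  have h1 := finrank_rootSpace_eq_one i.1 (LieSubalgebra.isNonZero_coe_root i)
  have hv' : v ∈ LieAlgebra.rootSpace 𝔞 i.1 := hv.mem_rootSpace
  have hw' : w ∈ LieAlgebra.rootSpace 𝔞 i.1 := hw.mem_rootSpace
  obtain ⟨c, hc⟩ := (finrank_eq_one_iff_of_nonzero' (⟨w, hw'⟩ : LieAlgebra.rootSpace 𝔞 i.1)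
    (fun h ↦ hw0 (congrArg Subtype.val h))).mp h1 ⟨v, hv'⟩
  exact ⟨c, (congrArg Subtype.val hc).symm⟩

omit [LieAlgebra.IsKilling ℝ 𝔤] [IsTriangularizable ℝ (↥𝔞) 𝔤] in
lemma IsWt.mem_of_zero {v : 𝔤} (hv : IsWt (0 : Module.Dual ℝ 𝔞) v) : v ∈ 𝔞 := by
  have h1 : v ∈ LieAlgebra.rootSpace 𝔞 (0 : 𝔞 → ℝ) := hv.mem_rootSpace
  have h2 := LieAlgebra.mem_zeroRootSubalgebra ℝ 𝔤 𝔞 v |>.mpr ?_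
  · rwa [LieAlgebra.zeroRootSubalgebra_eq_of_is_cartan] at h2
  · intro H
    exact ⟨1, by simpa using hv H⟩

/-- The root space decomposition, as an induction principle. -/
lemma induction_weight {p : 𝔤 → Prop} (h0 : ∀ H ∈ 𝔞, p H)
    (h1 : ∀ (i : 𝔞.root) v, IsWt ((rootSystem 𝔞).root i) v → p v)
    (h2 : ∀ v w, p v → p w → p (v + w)) (v : 𝔤) : p v := by
  have htop := LieModule.iSup_genWeightSpace_eq_top' ℝ 𝔞 𝔤
  have hv : v ∈ (⨆ χ : Weight ℝ 𝔞 𝔤, (genWeightSpace 𝔤 χ).toSubmodule) := by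
    rw [← LieSubmodule.iSup_toSubmodule, htop]
    trivial
  induction hv using Submodule.iSup_induction' with
  | mem χ x hx =>
    by_cases hχ : χ.IsZero
    · refine h0 x (IsWt.mem_of_zero (isWt_of_mem_rootSpace ?_))
      have : (χ : 𝔞 → ℝ) = 0 := hχ
      change x ∈ genWeightSpace 𝔤 (0 : 𝔞 → ℝ)
      rw [← this]
      exact hx
    · exact h1 ⟨χ, by simpa [LieSubalgebra.root] using hχ⟩ x (isWt_of_mem_rootSpace hx)
  | zero => exact h0 0 (zero_mem _)
  | add x y _ _ hx hy => exact h2 x y hx hy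

omit [LieAlgebra.IsKilling ℝ 𝔤] in
lemma killingForm_eq_zero_of_isWt {χ ψ : Module.Dual ℝ 𝔞} {v w : 𝔤} (hv : IsWt χ v)
    (hw : IsWt ψ w) (h : χ + ψ ≠ 0) : killingForm ℝ 𝔤 v w = 0 := by
  refine LieAlgebra.killingForm_apply_eq_zero_of_mem_rootSpace_of_add_ne_zero ℝ 𝔤 𝔞 hv.mem_rootSpace
    hw.mem_rootSpace fun h' ↦ h ?_
  ext H
  exact congrFun h' H

variable {θ : 𝔤 ≃ₗ⁅ℝ⁆ 𝔤}

omit [FiniteDimensional ℝ 𝔤] in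
omit [LieAlgebra.IsKilling ℝ 𝔤] in
lemma killingForm_theta (x y : 𝔤) : killingForm ℝ 𝔤 (θ x) (θ y) = killingForm ℝ 𝔤 x y :=
  LieAlgebra.killingForm_of_equiv_apply θ x y

variable (θ) in
/-- The form `-κ(x, θ y)`, which is an inner product for a Cartan involution `θ`. -/
noncomputable def inn (x y : 𝔤) : ℝ := -killingForm ℝ 𝔤 x (θ y)

omit [FiniteDimensional ℝ 𝔤] in
omit [LieAlgebra.IsKilling ℝ 𝔤] in
lemma inn_comm (hθ : IsCartanInvolution θ) (x y : 𝔤) : inn θ x y = inn θ y x := by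
  rw [inn, inn, ← killingForm_theta (θ := θ) x, hθ.involutive, LieModule.traceForm_comm]

omit [FiniteDimensional ℝ 𝔤] in
omit [LieAlgebra.IsKilling ℝ 𝔤] in
lemma inn_self_pos (hθ : IsCartanInvolution θ) {x : 𝔤} (hx : x ≠ 0) : 0 < inn θ x x := by
  rw [inn, neg_pos]
  exact hθ.killing_neg x hx

omit [FiniteDimensional ℝ 𝔤] in
omit [LieAlgebra.IsKilling ℝ 𝔤] in
/-- The adjoint of `ad x` is `- ad (θ x)`. -/
lemma inn_lie (hθ : IsCartanInvolution θ) (x y z : 𝔤) :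
    inn θ ⁅x, y⁆ z = inn θ y ⁅-θ x, z⁆ := by
  rw [inn, inn, LieEquiv.map_lie, map_neg, hθ.involutive, neg_lie, map_neg, neg_neg]
  have h := LieModule.traceForm_apply_lie_apply ℝ 𝔤 𝔤 y x (θ z)
  have h' : killingForm ℝ 𝔤 ⁅y, x⁆ (θ z) = killingForm ℝ 𝔤 y ⁅x, θ z⁆ := h
  rw [← h', ← lie_skew, map_neg, LinearMap.neg_apply, neg_neg]

variable (hθ : IsCartanInvolution θ) (h𝔞 : ∀ H ∈ 𝔞, θ H = -H)

/-- The coroot of a root, as an element of `𝔤`. -/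
noncomputable def corootElt (i : 𝔞.root) : 𝔤 := ((rootSystem 𝔞).coroot i : 𝔞)

lemma lie_corootElt {i j : 𝔞.root} {v : 𝔤} (hv : IsWt ((rootSystem 𝔞).root j) v) :
    ⁅corootElt i, v⁆ = ((rootSystem 𝔞).pairingIn ℤ j i : ℝ) • v := by
  have h1 := (rootSystem 𝔞).algebraMap_pairingIn ℤ j i
  rw [algebraMap_int_eq, eq_intCast] at h1
  rw [corootElt, hv, h1]
  rfl

/-- Root vectors `e i` such that `e i`, `-θ (e i)` and the coroot form an `sl₂`-triple. -/
structure RootVectors (θ : 𝔤 ≃ₗ⁅ℝ⁆ 𝔤) (𝔞 : LieSubalgebra ℝ 𝔤) [𝔞.IsCartanSubalgebra]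
    [LieModule.IsTriangularizable ℝ 𝔞 𝔤] where
  e : 𝔞.root → 𝔤
  isWt : ∀ i, IsWt ((rootSystem 𝔞).root i) (e i)
  ne_zero : ∀ i, e i ≠ 0
  lie_theta : ∀ i, ⁅e i, -θ (e i)⁆ = corootElt i

include hθ h𝔞 in
lemma exists_rootVectors : Nonempty (RootVectors θ 𝔞) := by
  have key : ∀ i : 𝔞.root, ∃ e : 𝔤, IsWt ((rootSystem 𝔞).root i) e ∧ e ≠ 0 ∧
      ⁅e, -θ e⁆ = corootElt i := by
    intro i
    have hi := LieSubalgebra.isNonZero_coe_root i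
    obtain ⟨e, he, he0⟩ := i.1.exists_ne_zero
    have hw : IsWt ((rootSystem 𝔞).root i) e := isWt_of_mem_rootSpace he
    have hθw : IsWt (-(rootSystem 𝔞).root i) (θ e) := hw.theta h𝔞
    have hH := lie_eq_killingForm_smul_of_mem_rootSpace_of_mem_rootSpace_neg (α := i.1)
      hw.mem_rootSpace hθw.mem_rootSpace
    have hneg := hθ.killing_neg e he0
    set t : 𝔞 := (cartanEquivDual 𝔞).symm i.1.toLinear with ht
    have hcor : ((rootSystem 𝔞).coroot i : 𝔞) = (2 : ℝ) • ((i.1 t)⁻¹ • t) := by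
      rw [rootSystem_coroot_apply, coroot, two_smul, two_smul]
    have hpos : 0 < i.1 t := by
      have h1 := hθ.killing_neg (t : 𝔤) (fun h ↦ by
        have h2 := root_apply_cartanEquivDual_symm_ne_zero hi
        rw [← ht, Subtype.ext (a1 := t) (a2 := 0) h] at h2
        apply h2
        exact map_zero i.1.toLinear)
      rw [h𝔞 _ t.2, map_neg, neg_lt_zero] at h1
      have h3 : killingForm ℝ 𝔤 (t : 𝔤) t = i.1 t := by
        have := LinearMap.congr_fun ((cartanEquivDual 𝔞).apply_symm_apply i.1.toLinear) t
        exact this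
      rwa [h3] at h1
    set κ := killingForm ℝ 𝔤 e (θ e) with hκ
    set c : ℝ := Real.sqrt (2 / (-κ * i.1 t)) with hc
    have hc2 : c * c = 2 / (-κ * i.1 t) :=
      Real.mul_self_sqrt (div_nonneg zero_le_two (mul_pos (by linarith) hpos).le)
    have hc0 : c ≠ 0 := by
      intro h
      rw [h, mul_zero] at hc2
      have : 0 < 2 / (-κ * i.1 t) := div_pos two_pos (mul_pos (by linarith) hpos)
      linarith
    refine ⟨c • e, hw.smul c, smul_ne_zero hc0 he0, ?_⟩
    rw [map_smul, lie_neg, smul_lie, lie_smul, hH, corootElt, hcor, smul_smul, smul_smul, hc2]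
    push_cast
    rw [smul_smul, ← neg_smul]
    congr 1
    have : κ ≠ 0 := hneg.ne
    field_simp
  choose e h1 h2 h3 using key
  exact ⟨⟨e, h1, h2, h3⟩⟩

end SplitForm

end RealFlag

/-! ### The elements of `M` attached to roots -/

namespace RealFlag

section RootStrings

variable {𝔤 : Type*} [LieRing 𝔤] [LieAlgebra ℝ 𝔤] [FiniteDimensional ℝ 𝔤]
  [LieAlgebra.IsKilling ℝ 𝔤] {𝔞 : LieSubalgebra ℝ 𝔤} [𝔞.IsCartanSubalgebra]
  [LieModule.IsTriangularizable ℝ 𝔞 𝔤] {θ : 𝔤 ≃ₗ⁅ℝ⁆ 𝔤}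

namespace RootVectors

variable (V : RootVectors θ 𝔞)

/-- The opposite root vectors. -/
def f (i : 𝔞.root) : 𝔤 := -θ (V.e i)

/-- The elements `e i + θ (e i)` of `𝔨`, one for each root. -/
def U (i : 𝔞.root) : 𝔤 := V.e i + θ (V.e i)

lemma U_eq (i : 𝔞.root) : V.U i = V.e i - V.f i := by rw [U, f, sub_neg_eq_add]

lemma theta_U (hθ : IsCartanInvolution θ) (i : 𝔞.root) : θ (V.U i) = V.U i := by
  rw [U, map_add, hθ.involutive, add_comm]

lemma f_isWt (h𝔞 : ∀ H ∈ 𝔞, θ H = -H) (i : 𝔞.root) :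
    IsWt (-(rootSystem 𝔞).root i) (V.f i) := ((V.isWt i).theta h𝔞).neg

lemma f_ne_zero (i : 𝔞.root) : V.f i ≠ 0 := by
  rw [f, neg_ne_zero]
  exact fun h ↦ V.ne_zero i (θ.injective (h.trans (map_zero θ).symm))

lemma lie_e_f (i : 𝔞.root) : ⁅V.e i, V.f i⁆ = corootElt i := V.lie_theta i

lemma lie_e_lie_f (i : 𝔞.root) (v : 𝔤) :
    ⁅V.e i, ⁅V.f i, v⁆⁆ = ⁅corootElt i, v⁆ + ⁅V.f i, ⁅V.e i, v⁆⁆ := by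
  rw [leibniz_lie, lie_e_f]

lemma inn_lie_e (hθ : IsCartanInvolution θ) (i : 𝔞.root) (y z : 𝔤) :
    inn θ ⁅V.e i, y⁆ z = inn θ y ⁅V.f i, z⁆ := inn_lie hθ _ _ _

lemma inn_lie_f (hθ : IsCartanInvolution θ) (i : 𝔞.root) (y z : 𝔤) :
    inn θ ⁅V.f i, y⁆ z = inn θ y ⁅V.e i, z⁆ := by
  rw [inn_lie hθ, f, map_neg, neg_neg, hθ.involutive]

end RootVectors

variable (θ) in
omit [FiniteDimensional ℝ 𝔤] [LieAlgebra.IsKilling ℝ 𝔤] in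
lemma inn_add_right (x y z : 𝔤) : inn θ x (y + z) = inn θ x y + inn θ x z := by
  simp only [inn, map_add]
  ring

variable (θ) in
omit [FiniteDimensional ℝ 𝔤] [LieAlgebra.IsKilling ℝ 𝔤] in
lemma inn_smul_right (c : ℝ) (x y : 𝔤) : inn θ x (c • y) = c * inn θ x y := by
  simp only [inn, map_smul, smul_eq_mul]
  ring

omit [FiniteDimensional ℝ 𝔤] [LieAlgebra.IsKilling ℝ 𝔤] in
lemma inn_zero_right (x : 𝔤) : inn θ x 0 = 0 := by
  simp only [inn, map_zero, neg_zero]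

omit [FiniteDimensional ℝ 𝔤] [LieAlgebra.IsKilling ℝ 𝔤] in
lemma eq_zero_of_inn_self (hθ : IsCartanInvolution θ) {x : 𝔤} (h : inn θ x x = 0) : x = 0 := by
  by_contra hx
  exact (inn_self_pos hθ hx).ne' h

omit [FiniteDimensional ℝ 𝔤] [LieAlgebra.IsKilling ℝ 𝔤] in
lemma inn_self_nonneg (hθ : IsCartanInvolution θ) (x : 𝔤) : 0 ≤ inn θ x x := by
  by_cases hx : x = 0
  · rw [hx, inn_zero_right]
  · exact (inn_self_pos hθ hx).le

/-- The coefficient of `⁅corootElt i, v⁆ = m • v` measures the difference of the lengths of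
`⁅f, v⁆` and `⁅e, v⁆`. -/
lemma RootVectors.inn_lie_f_self (V : RootVectors θ 𝔞) (hθ : IsCartanInvolution θ) (i : 𝔞.root)
    {v : 𝔤} {m : ℝ} (hv : ⁅corootElt i, v⁆ = m • v) :
    inn θ ⁅V.f i, v⁆ ⁅V.f i, v⁆ = m * inn θ v v + inn θ ⁅V.e i, v⁆ ⁅V.e i, v⁆ := by
  rw [V.inn_lie_f hθ, V.lie_e_lie_f, inn_add_right, hv, inn_smul_right, V.inn_lie_e hθ]

/-- If the sum of two roots is a root, then the bracket of their root vectors is nonzero. -/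
lemma lie_ne_zero (hθ : IsCartanInvolution θ) (h𝔞 : ∀ H ∈ 𝔞, θ H = -H) {i j k : 𝔞.root} {x y : 𝔤}
    (hx : IsWt ((rootSystem 𝔞).root i) x) (hy : IsWt ((rootSystem 𝔞).root j) y) (hx0 : x ≠ 0)
    (hy0 : y ≠ 0)
    (hk : (rootSystem 𝔞).root k = (rootSystem 𝔞).root i + (rootSystem 𝔞).root j) :
    ⁅x, y⁆ ≠ 0 := by
  obtain ⟨V⟩ := exists_rootVectors hθ h𝔞
  obtain ⟨c, rfl⟩ := hx.exists_smul (V.isWt i) (V.ne_zero i)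
  rw [smul_lie]
  refine smul_ne_zero (fun h ↦ hx0 (by rw [h, zero_smul])) fun hxy ↦ ?_
  have h1 := V.inn_lie_f_self hθ i (lie_corootElt (i := i) hy)
  rw [hxy, inn_zero_right, add_zero] at h1
  have hm : 0 ≤ ((rootSystem 𝔞).pairingIn ℤ j i : ℝ) := by
    have h2 := inn_self_nonneg hθ ⁅V.f i, y⁆
    rw [h1] at h2
    exact nonneg_of_mul_nonneg_left h2 (inn_self_pos hθ hy0)
  set z := V.e k with hz
  have hpk : (rootSystem 𝔞).pairingIn ℤ k i = (rootSystem 𝔞).pairingIn ℤ j i + 2 := by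
    apply FaithfulSMul.algebraMap_injective ℤ ℝ
    rw [map_add, (rootSystem 𝔞).algebraMap_pairingIn, (rootSystem 𝔞).algebraMap_pairingIn,
      ← (rootSystem 𝔞).root_coroot'_eq_pairing, hk, map_add,
      (rootSystem 𝔞).root_coroot'_eq_pairing, (rootSystem 𝔞).root_coroot'_eq_pairing,
      (rootSystem 𝔞).pairing_same, add_comm]
    rfl
  -- the lowering operator kills `𝔤_{i+j}`, as its adjoint kills `y`
  have hfz : ⁅V.f i, z⁆ = 0 := by
    have hw := (V.f_isWt h𝔞 i).lie (V.isWt k)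
    rw [hk, neg_add_cancel_left] at hw
    obtain ⟨d, hd⟩ := hw.exists_smul hy hy0
    have h3 : inn θ y ⁅V.f i, z⁆ = 0 := by
      rw [← V.inn_lie_e hθ, hxy, inn_comm hθ, inn_zero_right]
    rw [hd, inn_smul_right] at h3
    rw [hz, hd, (mul_eq_zero.mp h3).resolve_right (inn_self_pos hθ hy0).ne', zero_smul]
  have h4 := V.inn_lie_f_self hθ i (lie_corootElt (i := i) (V.isWt k))
  rw [← hz, hfz, inn_zero_right, hpk] at h4
  have h5 := inn_self_nonneg hθ ⁅V.e i, z⁆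
  have h6 := inn_self_pos hθ (V.ne_zero k)
  rw [← hz] at h6
  push_cast at h4
  nlinarith

namespace RootVectors

variable (V : RootVectors θ 𝔞)

lemma lie_U (i : 𝔞.root) (v : 𝔤) : ⁅V.U i, v⁆ = ⁅V.e i, v⁆ - ⁅V.f i, v⁆ := by
  rw [V.U_eq, sub_lie]

lemma lie_f_lie_e (i : 𝔞.root) (v : 𝔤) :
    ⁅V.f i, ⁅V.e i, v⁆⁆ = ⁅V.e i, ⁅V.f i, v⁆⁆ - ⁅corootElt i, v⁆ := by
  rw [V.lie_e_lie_f, add_sub_cancel_left]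

/-- The rotation of the plane spanned by a root string of length one. -/
lemma lie_U_lie_U_of_neg_one {i : 𝔞.root} {v : 𝔤} (h : ⁅corootElt i, v⁆ = (-1 : ℝ) • v)
    (hf : ⁅V.f i, v⁆ = 0) (he : ⁅V.e i, ⁅V.e i, v⁆⁆ = 0) : ⁅V.U i, ⁅V.U i, v⁆⁆ = -v := by
  rw [V.lie_U i v, hf, sub_zero, V.lie_U, he, V.lie_f_lie_e, hf, h, lie_zero]
  module

/-- The rotation in the space spanned by a root string of length two. -/
lemma lie_U_lie_U_of_neg_two {i : 𝔞.root} {v : 𝔤} (h : ⁅corootElt i, v⁆ = (-2 : ℝ) • v)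
    (h' : ⁅corootElt i, ⁅V.e i, v⁆⁆ = 0)
    (hf : ⁅V.f i, v⁆ = 0) (he : ⁅V.e i, ⁅V.e i, ⁅V.e i, v⁆⁆⁆ = 0) :
    ⁅V.U i, ⁅V.U i, ⁅V.e i, v⁆⁆⁆ = (-4 : ℝ) • ⁅V.e i, v⁆ := by
  have h1 : ⁅V.f i, ⁅V.e i, v⁆⁆ = (2 : ℝ) • v := by
    rw [V.lie_f_lie_e, hf, h, lie_zero]
    module
  have h2 : ⁅V.f i, ⁅V.e i, ⁅V.e i, v⁆⁆⁆ = (2 : ℝ) • ⁅V.e i, v⁆ := by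
    rw [V.lie_f_lie_e, h1, h', lie_smul, sub_zero]
  rw [V.lie_U i ⁅V.e i, v⁆, h1, V.lie_U, lie_sub, lie_sub, he, h2, lie_smul, lie_smul, hf]
  module

/-- The element `exp (π ad (e + θ e))` of `M` attached to a root. -/
noncomputable def m (i : 𝔞.root) : 𝔤 ≃ₗ⁅ℝ⁆ 𝔤 := expLie (Real.pi • V.U i)

lemma m_mem (hθ : IsCartanInvolution θ) (i : 𝔞.root) : V.m i ∈ maximalCompact θ :=
  expLie_mem (by rw [map_smul, V.theta_U hθ])

lemma m_apply (i : 𝔞.root) (v : 𝔤) :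
    V.m i v = expEnd (Real.pi • LieAlgebra.ad ℝ 𝔤 (V.U i)) v := by
  rw [m, expLie_apply, map_smul]

lemma m_apply_of_eq_zero {i : 𝔞.root} {v : 𝔤} (h : ⁅V.U i, v⁆ = 0) : V.m i v = v := by
  rw [m_apply]
  exact expEnd_of_apply_eq_zero (by rw [LinearMap.smul_apply, LieAlgebra.ad_apply, h, smul_zero])

lemma m_apply_of_neg_one {i : 𝔞.root} {v : 𝔤} (h : ⁅V.U i, ⁅V.U i, v⁆⁆ = -v) :
    V.m i v = -v := by
  rw [m_apply, expEnd_pi_smul_of_sq 1 (by simpa using h) (by simp)]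
  simp

lemma m_apply_of_neg_four {i : 𝔞.root} {v : 𝔤} (h : ⁅V.U i, ⁅V.U i, v⁆⁆ = (-4 : ℝ) • v) :
    V.m i v = v := by
  rw [m_apply, expEnd_pi_smul_of_sq 2 ?_ (by simp)]
  · simp
  · rw [LieAlgebra.ad_apply, LieAlgebra.ad_apply, h]
    norm_num

/-- On such vectors `ad (U i)` has the eigenvalues `0` and `± 2 i`, whose multiples by `π` have
exponential `1`. -/
lemma m_apply_of_cube {i : 𝔞.root} {v : 𝔤}
    (h : ⁅V.U i, ⁅V.U i, ⁅V.U i, v⁆⁆⁆ = (-4 : ℝ) • ⁅V.U i, v⁆) : V.m i v = v := by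
  have h1 : V.m i (v + (4⁻¹ : ℝ) • ⁅V.U i, ⁅V.U i, v⁆⁆) = v + (4⁻¹ : ℝ) • ⁅V.U i, ⁅V.U i, v⁆⁆ := by
    apply m_apply_of_eq_zero
    rw [lie_add, lie_smul, h, smul_smul]
    module
  have h2 : V.m i ⁅V.U i, ⁅V.U i, v⁆⁆ = ⁅V.U i, ⁅V.U i, v⁆⁆ := by
    apply m_apply_of_neg_four
    rw [h, lie_smul]
  rw [map_add, map_smul, h2] at h1
  exact add_right_cancel h1

lemma m_apply_of_mem (h𝔞 : ∀ H ∈ 𝔞, θ H = -H) (i : 𝔞.root) {H : 𝔤} (hH : H ∈ 𝔞) :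
    V.m i H = H := by
  set c := (rootSystem 𝔞).root i ⟨H, hH⟩ with hc
  have hHe : ⁅H, V.e i⁆ = c • V.e i := V.isWt i ⟨H, hH⟩
  have hHf : ⁅H, V.f i⁆ = -c • V.f i := V.f_isWt h𝔞 i ⟨H, hH⟩
  have h1 : ⁅V.U i, H⁆ = -c • (V.e i + V.f i) := by
    rw [V.U_eq, ← lie_skew, lie_sub, hHe, hHf]
    module
  have h2 : ⁅V.U i, V.e i + V.f i⁆ = (2 : ℝ) • corootElt i := by
    rw [V.U_eq, sub_lie, lie_add, lie_add, lie_self, lie_self, V.lie_e_f, ← lie_skew (V.f i),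
      V.lie_e_f]
    module
  have h3 : ⁅V.U i, corootElt i⁆ = (-2 : ℝ) • (V.e i + V.f i) := by
    have h4 := lie_corootElt (i := i) (V.isWt i)
    have h5 : ⁅corootElt i, V.f i⁆ = (-2 : ℝ) • V.f i := by
      rw [f, lie_neg, show corootElt i = θ (-corootElt i) by
        rw [map_neg, corootElt, h𝔞 _ (Subtype.prop _), neg_neg], ← LieEquiv.map_lie, neg_lie, h4,
        (rootSystem 𝔞).pairingIn_same, map_neg, map_smul]
      push_cast
      module
    rw [V.U_eq, ← lie_skew, lie_sub, h4, h5, (rootSystem 𝔞).pairingIn_same]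
    push_cast
    module
  apply m_apply_of_cube
  rw [h1, lie_smul, lie_smul, h2, lie_smul, h3]
  module

lemma m_mem_centralizerM (hθ : IsCartanInvolution θ) (h𝔞 : ∀ H ∈ 𝔞, θ H = -H) (i : 𝔞.root) :
    (⟨V.m i, V.m_mem hθ i⟩ : maximalCompact θ) ∈ centralizerM θ 𝔞 :=
  fun _ hH ↦ V.m_apply_of_mem h𝔞 i hH

end RootVectors

/-- The coroot of `i` acts on a vector of weight `χ` by the number `χ (coroot i)`. -/
lemma IsWt.lie_corootElt {χ : Module.Dual ℝ 𝔞} {v : 𝔤} (hv : IsWt χ v) (i : 𝔞.root) :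
    ⁅corootElt i, v⁆ = (rootSystem 𝔞).coroot' i χ • v := hv _

/-- If all pairings with the coroot of `i` are at most two in absolute value, then vectors of
other weights vanish. -/
lemma IsWt.eq_zero_of_two_lt {i : 𝔞.root} (h2 : ∀ j, |(rootSystem 𝔞).pairingIn ℤ j i| ≤ 2)
    {χ : Module.Dual ℝ 𝔞} {v : 𝔤} (hv : IsWt χ v) (h : 2 < |(rootSystem 𝔞).coroot' i χ|) :
    v = 0 := by
  by_contra hv0
  have hχ : χ ≠ 0 := by
    rintro rfl
    rw [map_zero, abs_zero] at h
    linarith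
  obtain ⟨j, rfl⟩ := hv.exists_root hv0 hχ
  rw [(rootSystem 𝔞).root_coroot'_eq_pairing, ← (rootSystem 𝔞).algebraMap_pairingIn ℤ] at h
  have h3 : ((|(rootSystem 𝔞).pairingIn ℤ j i| : ℤ) : ℝ) ≤ 2 := by exact_mod_cast h2 j
  rw [Int.cast_abs] at h3
  rw [algebraMap_int_eq, eq_intCast] at h
  linarith

namespace RootVectors

variable (V : RootVectors θ 𝔞)

/-- The element of `M` attached to the root `i` acts on a root space by the sign given by the
parity of the pairing with the coroot of `i`. Pairings
of absolute value `3`, which occur in type `G₂`, are excluded. -/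
lemma m_apply_of_isWt (hθ : IsCartanInvolution θ) (h𝔞 : ∀ H ∈ 𝔞, θ H = -H) {i : 𝔞.root}
    (h2 : ∀ j, |(rootSystem 𝔞).pairingIn ℤ j i| ≤ 2) {j : 𝔞.root} {v : 𝔤}
    (hv : IsWt ((rootSystem 𝔞).root j) v) :
    V.m i v = (-1 : ℝ) ^ (rootSystem 𝔞).pairingIn ℤ j i • v := by
  have hcj : ∀ j, (rootSystem 𝔞).coroot' i ((rootSystem 𝔞).root j) = (rootSystem 𝔞).pairingIn ℤ j i := fun j ↦ by
    rw [(rootSystem 𝔞).root_coroot'_eq_pairing, ← (rootSystem 𝔞).algebraMap_pairingIn ℤ, algebraMap_int_eq, eq_intCast]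
  have hci : (rootSystem 𝔞).coroot' i ((rootSystem 𝔞).root i) = 2 := by
    rw [hcj, (rootSystem 𝔞).pairingIn_same]; norm_num
  have hθm : ∀ w, V.m i (θ w) = θ (V.m i w) := map_theta_of_maximalCompact (V.m_mem hθ i)
  wlog hle : (rootSystem 𝔞).pairingIn ℤ j i ≤ 0 generalizing j v
  · have h1 := this (j := (rootSystem 𝔞).reflectionPerm j j) (v := θ v) (by
      rw [(rootSystem 𝔞).root_reflectionPerm, (rootSystem 𝔞).reflection_apply_self]
      exact hv.theta h𝔞) (by rw [(rootSystem 𝔞).pairingIn_reflectionPerm_self_left]; omega)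
    rw [hθm, (rootSystem 𝔞).pairingIn_reflectionPerm_self_left, ← map_smul] at h1
    rw [θ.injective h1, zpow_neg, ← inv_zpow]
    norm_num
  have hm := h2 j
  rw [abs_le] at hm
  have hev := (V.isWt i).lie hv
  have heev := (V.isWt i).lie hev
  have heeev := (V.isWt i).lie heev
  have hfv := (V.f_isWt h𝔞 i).lie hv
  have hhv := hv.lie_corootElt i
  rw [hcj] at hhv
  have hcases : (rootSystem 𝔞).pairingIn ℤ j i = -2 ∨ (rootSystem 𝔞).pairingIn ℤ j i = -1 ∨ (rootSystem 𝔞).pairingIn ℤ j i = 0 := by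
    omega
  rcases hcases with h | h | h <;> rw [h] at hhv ⊢
  · have hf : ⁅V.f i, v⁆ = 0 := hfv.eq_zero_of_two_lt h2 (by
      rw [map_add, map_neg, hci, hcj, h]; norm_num)
    have he : ⁅V.e i, ⁅V.e i, ⁅V.e i, v⁆⁆⁆ = 0 := heeev.eq_zero_of_two_lt h2 (by
      rw [map_add, map_add, map_add, hci, hcj, h]; norm_num)
    have h' : ⁅corootElt i, ⁅V.e i, v⁆⁆ = 0 := by
      rw [hev.lie_corootElt, map_add, hci, hcj, h]; norm_num
    have h3 := V.lie_U_lie_U_of_neg_two (by simpa using hhv) h' hf he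
    rw [V.m_apply_of_cube]
    · norm_num
    · rw [V.lie_U i v, hf, sub_zero, h3]
  · have hf : ⁅V.f i, v⁆ = 0 := hfv.eq_zero_of_two_lt h2 (by
      rw [map_add, map_neg, hci, hcj, h]; norm_num)
    have he : ⁅V.e i, ⁅V.e i, v⁆⁆ = 0 := heev.eq_zero_of_two_lt h2 (by
      rw [map_add, map_add, hci, hcj, h]; norm_num)
    rw [V.m_apply_of_neg_one (V.lie_U_lie_U_of_neg_one (by simpa using hhv) hf he)]
    norm_num
  · rw [zpow_zero, one_smul]
    rw [Int.cast_zero] at hhv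
    by_cases hf : ⁅V.f i, v⁆ = 0
    · apply V.m_apply_of_eq_zero
      have h3 := V.inn_lie_f_self hθ i hhv
      rw [hf, inn_zero_right, zero_mul, zero_add] at h3
      rw [V.lie_U, hf, eq_zero_of_inn_self hθ h3.symm, sub_zero]
    · -- `v` is a multiple of `⁅e, w⁆`, where `w = ⁅f, v⁆`
      have hefv := (V.isWt i).lie hfv
      rw [add_neg_cancel_left] at hefv
      have hffv := (V.f_isWt h𝔞 i).lie hfv
      have heeefv := (V.isWt i).lie ((V.isWt i).lie hefv)
      have hne : ⁅V.e i, ⁅V.f i, v⁆⁆ ≠ 0 := by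
        intro h0
        have h3 := V.inn_lie_f hθ i v ⁅V.f i, v⁆
        rw [h0, inn_zero_right] at h3
        exact hf (eq_zero_of_inn_self hθ h3)
      obtain ⟨c, hc⟩ := hv.exists_smul hefv hne
      have hff : ⁅V.f i, ⁅V.f i, v⁆⁆ = 0 := hffv.eq_zero_of_two_lt h2 (by
        rw [map_add, map_add, map_neg, hci, hcj, h]; norm_num)
      have he : ⁅V.e i, ⁅V.e i, ⁅V.e i, ⁅V.f i, v⁆⁆⁆⁆ = 0 := heeefv.eq_zero_of_two_lt h2 (by
        rw [map_add, map_add, hci, hcj, h]; norm_num)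
      have h3 := V.lie_U_lie_U_of_neg_two (v := ⁅V.f i, v⁆) (by
        rw [hfv.lie_corootElt, map_add, map_neg, hci, hcj, h]; norm_num) (by
        rw [hefv.lie_corootElt, hcj, h]; norm_num) hff he
      have h4 := V.m_apply_of_neg_four h3
      rw [hc, map_smul, h4]

/-- The sign by which an element `k` of `M` acts on the root space of `i`, read off with the inner
product. The definition makes sense for every automorphism `k`. -/
noncomputable def chi (k : 𝔤 ≃ₗ⁅ℝ⁆ 𝔤) (i : 𝔞.root) : ℝ :=
  inn θ (V.e i) (k (V.e i)) / inn θ (V.e i) (V.e i)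

variable (hθ : IsCartanInvolution θ) {k : 𝔤 ≃ₗ⁅ℝ⁆ 𝔤} (hk : ∀ H ∈ 𝔞, k H = H)

include hθ hk in
lemma apply_eq_chi_smul {i : 𝔞.root} {v : 𝔤} (hv : IsWt ((rootSystem 𝔞).root i) v) :
    k v = V.chi k i • v := by
  obtain ⟨c, hc⟩ := ((V.isWt i).map hk).exists_smul (V.isWt i) (V.ne_zero i)
  obtain ⟨d, rfl⟩ := hv.exists_smul (V.isWt i) (V.ne_zero i)
  have h1 : V.chi k i = c := by
    rw [chi, hc, inn_smul_right, mul_div_assoc, div_self (inn_self_pos hθ (V.ne_zero i)).ne',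
      mul_one]
  rw [map_smul, hc, h1, smul_comm]

include hθ hk in
lemma chi_eq {i : 𝔞.root} {v : 𝔤} (hv : IsWt ((rootSystem 𝔞).root i) v) (hv0 : v ≠ 0) {c : ℝ}
    (h : k v = c • v) : V.chi k i = c := by
  rw [V.apply_eq_chi_smul hθ hk hv] at h
  exact smul_left_injective ℝ hv0 h

include hθ hk in
/-- An element of `M` commutes with `θ` and fixes the coroot, which is a multiple of `[e, θ e]`. -/
lemma chi_mul_self (hkK : k ∈ maximalCompact θ) (i : 𝔞.root) : V.chi k i * V.chi k i = 1 := by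
  have h1 := hk (corootElt i) (Subtype.prop _)
  rw [← V.lie_e_f, LieEquiv.map_lie, f, map_neg, map_theta_of_maximalCompact hkK,
    V.apply_eq_chi_smul hθ hk (V.isWt i), map_smul, smul_lie, ← smul_neg, lie_smul, smul_smul] at h1
  change (V.chi k i * V.chi k i) • ⁅V.e i, V.f i⁆ = ⁅V.e i, V.f i⁆ at h1
  have h2 : ⁅V.e i, V.f i⁆ ≠ 0 := by
    rw [V.lie_e_f]
    intro h0
    have h3 := lie_corootElt (i := i) (V.isWt i)
    rw [h0, zero_lie, (rootSystem 𝔞).pairingIn_same] at h3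
    exact smul_ne_zero (by norm_num) (V.ne_zero i) h3.symm
  exact smul_left_injective ℝ h2 (by simpa using h1)

include hθ hk in
lemma chi_add (h𝔞 : ∀ H ∈ 𝔞, θ H = -H) {i j l : 𝔞.root}
    (h : (rootSystem 𝔞).root l = (rootSystem 𝔞).root i + (rootSystem 𝔞).root j) :
    V.chi k l = V.chi k i * V.chi k j := by
  refine V.chi_eq hθ hk (v := ⁅V.e i, V.e j⁆) (by rw [h]; exact (V.isWt i).lie (V.isWt j))
    (lie_ne_zero hθ h𝔞 (V.isWt i) (V.isWt j) (V.ne_zero i) (V.ne_zero j) h) ?_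
  rw [LieEquiv.map_lie, V.apply_eq_chi_smul hθ hk (V.isWt i),
    V.apply_eq_chi_smul hθ hk (V.isWt j), smul_lie, lie_smul, smul_smul]

end RootVectors

end RootStrings

end RealFlag

/-! ### Relations in `𝔰𝔬 (n) ⊕ 𝔰𝔬 (n)` and in `𝔲 (n)` -/

namespace RealFlag

section Chains

variable {L : Type*} [LieRing L] [LieAlgebra ℝ L]

omit [LieAlgebra ℝ L] in
lemma lie_comm_eq_neg {x y : L} : ⁅x, y⁆ = -⁅y, x⁆ := (lie_skew x y).symm

/-- Commuting elements on which `(ad a)²` is `-1` have commuting images under `ad a`. -/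
lemma lie_lie_eq_zero_of_sq {a x q : L} (h : ⁅x, q⁆ = 0) (hx : ⁅a, ⁅a, x⁆⁆ = -x)
    (hq : ⁅a, ⁅a, q⁆⁆ = -q) : ⁅⁅a, x⁆, ⁅a, q⁆⁆ = 0 := by
  have h1 : ⁅a, ⁅a, ⁅x, q⁆⁆⁆ = 0 := by rw [h, lie_zero, lie_zero]
  rw [leibniz_lie a x, lie_add, leibniz_lie a ⁅a, x⁆, leibniz_lie a x, hx, hq, neg_lie, lie_neg,
    h] at h1
  have h2 : (2 : ℝ) • ⁅⁅a, x⁆, ⁅a, q⁆⁆ = 0 := by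
    rw [two_smul]
    simpa using h1
  exact (smul_eq_zero.mp h2).resolve_left two_ne_zero

omit [LieAlgebra ℝ L] in
lemma lie_lie_of_comm {a b v : L} (h : ⁅a, b⁆ = 0) : ⁅a, ⁅b, v⁆⁆ = ⁅b, ⁅a, v⁆⁆ := by
  rw [leibniz_lie, h, zero_lie, zero_add]

omit [LieAlgebra ℝ L] in
lemma lie_lie_eq_zero {a b v : L} (h : ⁅a, b⁆ = 0) (h' : ⁅a, v⁆ = 0) : ⁅a, ⁅b, v⁆⁆ = 0 := by
  rw [lie_lie_of_comm h, h', lie_zero]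

/-- Elements `u 0, …, u (K - 1)` that satisfy the relations of the standard generators
`E_{p,p+1} - E_{p+1,p}` of `𝔰𝔬 (K + 1)`. -/
structure SoChain (K : ℕ) (u : ℕ → L) : Prop where
  comm : ∀ p q, p + 1 < q → q < K → ⁅u p, u q⁆ = 0
  up : ∀ p, p + 1 < K → ⁅u p, ⁅u p, u (p + 1)⁆⁆ = -u (p + 1)
  down : ∀ p, p + 1 < K → ⁅u (p + 1), ⁅u (p + 1), u p⁆⁆ = -u p

namespace SoChain

variable {K : ℕ} {u : ℕ → L}

omit [LieAlgebra ℝ L] in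
lemma comm' (hu : SoChain K u) {p q : ℕ} (h : p + 1 < q) (hq : q < K) : ⁅u q, u p⁆ = 0 := by
  rw [lie_comm_eq_neg, hu.comm p q h hq, neg_zero]

/-- The vectors `⁅u (k - 1), ⋯ ⁅u 0, y⁆⋯⁆` obtained from `y` by moving along a chain. If `y` behaves
like the next generator of a longer chain, then they behave like the standard basis of the vector
representation. -/
def orbit (u : ℕ → L) (y : L) : ℕ → L
  | 0 => y
  | k + 1 => ⁅u k, orbit u y k⁆

variable {y : L} (hu : SoChain K u) (hy : ∀ p, 0 < p → p < K → ⁅u p, y⁆ = 0)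
  (h0 : 0 < K → ⁅u 0, ⁅u 0, y⁆⁆ = -y)

omit [LieAlgebra ℝ L] in
include hu hy in
lemma lie_orbit_of_lt {k p : ℕ} (hkp : k < p) (hp : p < K) : ⁅u p, orbit u y k⁆ = 0 := by
  induction k with
  | zero => exact hy p hkp hp
  | succ k ih => exact lie_lie_eq_zero (hu.comm' hkp hp) (ih (by omega))

omit [LieAlgebra ℝ L] in
include hu hy h0 in
lemma lie_orbit_succ {k : ℕ} (hk : k < K) : ⁅u k, orbit u y (k + 1)⁆ = -orbit u y k := by
  cases k with
  | zero => exact h0 hk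
  | succ k =>
    have h1 := hu.lie_orbit_of_lt hy (Nat.lt_succ_self k) hk
    change ⁅u (k + 1), ⁅u (k + 1), ⁅u k, orbit u y k⁆⁆⁆ = -⁅u k, orbit u y k⁆
    rw [leibniz_lie (u (k + 1)) (u k), h1, lie_zero, add_zero, leibniz_lie, h1, lie_zero, add_zero,
      hu.down k hk, neg_lie]

include hu hy h0 in
lemma lie_orbit_of_add_lt {k p : ℕ} (hpk : p + 1 < k) (hk : k ≤ K) : ⁅u p, orbit u y k⁆ = 0 := by
  induction k, hpk using Nat.le_induction with
  | base =>
    have h1 := hu.lie_orbit_of_lt hy (Nat.lt_succ_self p) (by omega)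
    have h2 : ⁅u p, ⁅u p, orbit u y p⁆⁆ = -orbit u y p := hu.lie_orbit_succ hy h0 (by omega)
    have h3 := lie_lie_eq_zero_of_sq h1 (hu.up p (by omega)) h2
    change ⁅u p, ⁅u (p + 1), ⁅u p, orbit u y p⁆⁆⁆ = 0
    rw [leibniz_lie, h3, zero_add, h2, lie_neg, h1, neg_zero]
  | succ k hk' ih => exact lie_lie_eq_zero (hu.comm p k hk' (by omega)) (ih (by omega))

/-- The span of the vectors obtained from `y` by moving along the chain. -/
def orbitSpan (K : ℕ) (u : ℕ → L) (y : L) : Submodule ℝ L :=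
  Submodule.span ℝ (orbit u y '' {k | k ≤ K})

lemma orbit_mem {k : ℕ} (hk : k ≤ K) : orbit u y k ∈ orbitSpan K u y :=
  Submodule.subset_span ⟨k, hk, rfl⟩

include hu hy h0 in
lemma lie_mem_orbitSpan {p : ℕ} (hp : p < K) {v : L} (hv : v ∈ orbitSpan K u y) :
    ⁅u p, v⁆ ∈ orbitSpan K u y := by
  induction hv using Submodule.span_induction with
  | mem v hv =>
    obtain ⟨k, hk, rfl⟩ := hv
    rcases lt_trichotomy p k with h | rfl | h
    · rcases Nat.lt_or_ge (p + 1) k with h' | h'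
      · rw [hu.lie_orbit_of_add_lt hy h0 h' hk]
        exact zero_mem _
      · obtain rfl : k = p + 1 := by omega
        rw [hu.lie_orbit_succ hy h0 hp]
        exact neg_mem (orbit_mem (by omega))
    · exact orbit_mem (k := p + 1) hp
    · rw [hu.lie_orbit_of_lt hy h hp]
      exact zero_mem _
  | zero => rw [lie_zero]; exact zero_mem _
  | add v w _ _ hv hw => rw [lie_add]; exact add_mem hv hw
  | smul c v _ hv => rw [lie_smul]; exact Submodule.smul_mem _ c hv

end SoChain

/-- A chain that forks at its beginning: the relations of the generators of the maximal compact
subalgebra `𝔰𝔬 (K + 2) ⊕ 𝔰𝔬 (K + 2)` of the split real form of type `D`. -/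
structure IsFork (K : ℕ) (u : ℕ → L) (z z' : L) : Prop extends SoChain K u where
  pos : 0 < K
  lie_fork : ⁅z, z'⁆ = 0
  lie_left : ∀ p, 0 < p → p < K → ⁅u p, z⁆ = 0
  lie_right : ∀ p, 0 < p → p < K → ⁅u p, z'⁆ = 0
  left_up : ⁅u 0, ⁅u 0, z⁆⁆ = -z
  right_up : ⁅u 0, ⁅u 0, z'⁆⁆ = -z'
  left_down : ⁅z, ⁅z, u 0⁆⁆ = -u 0
  right_down : ⁅z', ⁅z', u 0⁆⁆ = -u 0

namespace IsFork

open SoChain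

variable {K : ℕ} {u : ℕ → L} {z z' : L} (h : IsFork K u z z')

include h

omit [LieAlgebra ℝ L] in
lemma lie_add : ∀ p, 0 < p → p < K → ⁅u p, z + z'⁆ = 0 := fun p h0 hp ↦ by
  rw [LieRing.lie_add, h.lie_left p h0 hp, h.lie_right p h0 hp, add_zero]

omit [LieAlgebra ℝ L] in
lemma add_up : ⁅u 0, ⁅u 0, z + z'⁆⁆ = -(z + z') := by
  rw [LieRing.lie_add, LieRing.lie_add, h.left_up, h.right_up, neg_add]

omit [LieAlgebra ℝ L] in
lemma sub_lie_add : ⁅z - z', z + z'⁆ = 0 := by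
  rw [sub_lie, LieRing.lie_add, LieRing.lie_add, lie_self, lie_self, h.lie_fork,
    lie_comm_eq_neg (x := z') (y := z), h.lie_fork]
  simp

omit [LieAlgebra ℝ L] in
/-- The difference of the two ends of the fork centralizes the vectors obtained from their sum. -/
lemma lie_sub_orbit {k : ℕ} (hk : k ≤ K) : ⁅z - z', orbit u (z + z') k⁆ = 0 := by
  induction k with
  | zero => exact h.sub_lie_add
  | succ k ih =>
    rcases Nat.eq_zero_or_pos k with rfl | hk0
    · have h1 : ⁅z, ⁅u 0, z⁆⁆ = u 0 := by
        rw [lie_comm_eq_neg (x := u 0), lie_neg, h.left_down, neg_neg]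
      have h2 : ⁅z', ⁅u 0, z'⁆⁆ = u 0 := by
        rw [lie_comm_eq_neg (x := u 0), lie_neg, h.right_down, neg_neg]
      have h3 : ⁅z, ⁅u 0, z'⁆⁆ - ⁅z', ⁅u 0, z⁆⁆ = 0 := by
        have h4 : ⁅u 0, ⁅z, z'⁆⁆ = 0 := by rw [h.lie_fork, lie_zero]
        rw [leibniz_lie, lie_comm_eq_neg (x := ⁅u 0, z⁆)] at h4
        rw [← h4]
        abel
      change ⁅z - z', ⁅u 0, z + z'⁆⁆ = 0
      rw [LieRing.lie_add, sub_lie, LieRing.lie_add, LieRing.lie_add, h1, h2]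
      calc u 0 + ⁅z, ⁅u 0, z'⁆⁆ - (⁅z', ⁅u 0, z⁆⁆ + u 0)
          = ⁅z, ⁅u 0, z'⁆⁆ - ⁅z', ⁅u 0, z⁆⁆ := by abel
        _ = 0 := h3
    · refine lie_lie_eq_zero ?_ (ih (by omega))
      rw [lie_comm_eq_neg, lie_sub, h.lie_left k hk0 hk, h.lie_right k hk0 hk]
      simp

/-- The sum `y` of the two ends of the fork acts with square `-4`, and not `-1`, on the other vectors
of its orbit: on the ideal that it generates, `z` and `z'` both act as `½ ad y`. -/
lemma add_sq_orbit {k : ℕ} (hk0 : 0 < k) (hk : k ≤ K) :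
    ⁅z + z', ⁅z + z', orbit u (z + z') k⁆⁆ = (-4 : ℝ) • orbit u (z + z') k := by
  induction k, hk0 using Nat.le_induction with
  | base =>
    have hc : ∀ v : L, ⁅z', ⁅z, v⁆⁆ = ⁅z, ⁅z', v⁆⁆ := fun v ↦ (lie_lie_of_comm h.lie_fork).symm
    have h1 : ⁅z, ⁅z, ⁅z', u 0⁆⁆⁆ = -⁅z', u 0⁆ := by
      rw [← hc, ← hc, h.left_down, lie_neg]
    change ⁅z + z', ⁅z + z', ⁅u 0, z + z'⁆⁆⁆ = (-4 : ℝ) • ⁅u 0, z + z'⁆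
    rw [lie_comm_eq_neg (x := u 0)]
    simp only [add_lie, LieRing.lie_add, lie_neg, hc, h1, h.left_down, h.right_down]
    module
  | succ k hk' ih =>
    have hc : ⁅z + z', u k⁆ = 0 := by
      rw [lie_comm_eq_neg, h.lie_add k hk' hk, neg_zero]
    change ⁅z + z', ⁅z + z', ⁅u k, orbit u (z + z') k⁆⁆⁆ = (-4 : ℝ) • ⁅u k, orbit u (z + z') k⁆
    rw [lie_lie_of_comm hc, lie_lie_of_comm hc, ih (by omega), lie_smul]

lemma lie_orbit_one_orbit_two (hK : 2 ≤ K) :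
    ⁅z + z', ⁅orbit u (z + z') 1, orbit u (z + z') 2⁆⁆ = 0 := by
  set y := z + z' with hy
  set q := orbit u y 1 with hq
  set q' := orbit u y 2 with hq'
  have a1 : ⁅u 0, y⁆ = q := rfl
  have a2 : ⁅u 0, q⁆ = -y := h.add_up
  have a3 : ⁅u 0, q'⁆ = 0 := h.lie_orbit_of_add_lt h.lie_add (fun _ ↦ h.add_up) (by omega) hK
  have b1 : ⁅u 1, y⁆ = 0 := h.lie_add 1 one_pos hK
  have b2 : ⁅u 1, q⁆ = q' := rfl
  have s1 : ⁅y, ⁅y, q⁆⁆ = (-4 : ℝ) • q := h.add_sq_orbit one_pos (by omega)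
  have s2 : ⁅y, ⁅y, q'⁆⁆ = (-4 : ℝ) • q' := h.add_sq_orbit two_pos hK
  -- apply `ad (u 0)`, which rotates the plane of `y` and `q`, to the relation `s1`
  have s3 : ⁅q, ⁅y, q⁆⁆ = (4 : ℝ) • y := by
    have := congrArg (fun v ↦ ⁅u 0, v⁆) s1
    simp only [leibniz_lie (u 0), a1, a2, lie_smul, lie_self, lie_neg, neg_zero, lie_zero,
      add_zero, smul_neg] at this
    rw [this]
    module
  -- apply `ad (u 0)` to `s2`, and to `s3` the derivation `ad (u 1)`, which takes `q` to `q'`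
  have s4 : ⁅q, ⁅y, q'⁆⁆ + ⁅y, ⁅q, q'⁆⁆ = 0 := by
    have := congrArg (fun v ↦ ⁅u 0, v⁆) s2
    simpa only [leibniz_lie (u 0), a1, a3, lie_smul, lie_zero, add_zero, smul_zero] using this
  have s5 : ⁅q', ⁅y, q⁆⁆ + ⁅q, ⁅y, q'⁆⁆ = 0 := by
    have := congrArg (fun v ↦ ⁅u 1, v⁆) s3
    simpa only [leibniz_lie (u 1), b1, b2, lie_smul, zero_lie, zero_add, smul_zero] using this
  -- the trilinear expression is alternating, so that the Jacobi identity kills it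
  have s6 := lie_jacobi y q q'
  rw [lie_comm_eq_neg (x := q') (y := y), lie_neg] at s6
  have e1 : ⁅q, ⁅y, q'⁆⁆ = -⁅y, ⁅q, q'⁆⁆ := eq_neg_of_add_eq_zero_left s4
  have e2 : ⁅q', ⁅y, q⁆⁆ = ⁅y, ⁅q, q'⁆⁆ := by
    rw [eq_neg_of_add_eq_zero_left s5, e1, neg_neg]
  rw [e1, e2, neg_neg] at s6
  have s7 : (3 : ℝ) • ⁅y, ⁅q, q'⁆⁆ = 0 := by
    rw [← s6]
    module
  exact (smul_eq_zero.mp s7).resolve_left three_ne_zero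

lemma lie_orbit_orbit {i j : ℕ} (hi : 0 < i) (hij : i < j) (hj : j ≤ K) :
    ⁅z + z', ⁅orbit u (z + z') i, orbit u (z + z') j⁆⁆ = 0 := by
  have hc : ∀ k, 0 < k → k < K → ⁅z + z', u k⁆ = 0 := fun k hk0 hk ↦ by
    rw [lie_comm_eq_neg, h.lie_add k hk0 hk, neg_zero]
  induction i, hi using Nat.le_induction with
  | base =>
    induction j, hij using Nat.le_induction with
    | base => exact h.lie_orbit_one_orbit_two hj
    | succ j hj' ih =>
      have h1 : ⁅orbit u (z + z') 1, u j⁆ = 0 := by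
        rw [lie_comm_eq_neg, h.lie_orbit_of_lt h.lie_add hj' hj, neg_zero]
      change ⁅z + z', ⁅orbit u (z + z') 1, ⁅u j, orbit u (z + z') j⁆⁆⁆ = 0
      rw [lie_lie_of_comm h1]
      exact lie_lie_eq_zero (hc j (by omega) hj) (ih (by omega))
  | succ i hi' ih =>
    have h1 : ⁅u i, orbit u (z + z') j⁆ = 0 :=
      h.lie_orbit_of_add_lt h.lie_add (fun _ ↦ h.add_up) hij hj
    have h2 : ⁅orbit u (z + z') (i + 1), orbit u (z + z') j⁆ =
        ⁅u i, ⁅orbit u (z + z') i, orbit u (z + z') j⁆⁆ := by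
      rw [leibniz_lie (u i), h1, lie_zero, add_zero]
      rfl
    rw [h2]
    exact lie_lie_eq_zero (hc i hi' (by omega)) (ih (by omega))

/-- The ideal `𝔰𝔬 (K + 2)` generated by `z + z'`: it is stable under the generators, and it is
centralized by `z - z'`. It is realized as the sum of the orbit span `m` of `z + z'` and of
`[m, m]`. -/
lemma exists_stable : ∃ I : Submodule ℝ L, z + z' ∈ I ∧ ⁅u 0, z + z'⁆ ∈ I ∧
    (∀ p < K, ∀ v ∈ I, ⁅u p, v⁆ ∈ I) ∧ (∀ v ∈ I, ⁅z, v⁆ ∈ I) ∧ (∀ v ∈ I, ⁅z', v⁆ ∈ I) ∧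
    ∀ v ∈ I, ⁅z - z', v⁆ = 0 := by
  set y := z + z' with hy
  set m := orbitSpan K u y with hm
  set c : Submodule ℝ L := Submodule.span ℝ {v | ∃ a ∈ m, ∃ b ∈ m, ⁅a, b⁆ = v} with hcdef
  have hym : y ∈ m := orbit_mem (k := 0) (Nat.zero_le K)
  have hcm : ∀ a ∈ m, ∀ b ∈ m, ⁅a, b⁆ ∈ c := fun a ha b hb ↦
    Submodule.subset_span ⟨a, ha, b, hb, rfl⟩
  have hum : ∀ p < K, ∀ v ∈ m, ⁅u p, v⁆ ∈ m := fun p hp v hv ↦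
    h.lie_mem_orbitSpan h.lie_add (fun _ ↦ h.add_up) hp hv
  have hdm : ∀ v ∈ m, ⁅z - z', v⁆ = 0 := by
    intro v hv
    induction hv using Submodule.span_induction with
    | mem v hv => obtain ⟨k, hk, rfl⟩ := hv; exact h.lie_sub_orbit hk
    | zero => exact lie_zero _
    | add v w _ _ hv hw => rw [LieRing.lie_add, hv, hw, add_zero]
    | smul r v _ hv => rw [lie_smul, hv, smul_zero]
  have hyy : ∀ j ≤ K, ⁅y, ⁅y, orbit u y j⁆⁆ ∈ m := by
    intro j hj
    rcases Nat.eq_zero_or_pos j with rfl | hj0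
    · change ⁅y, ⁅y, y⁆⁆ ∈ m
      rw [lie_self, lie_zero]
      exact zero_mem _
    · rw [h.add_sq_orbit hj0 hj]
      exact Submodule.smul_mem _ _ (orbit_mem hj)
  have hyo : ∀ i ≤ K, ∀ j ≤ K, i < j → ⁅y, ⁅orbit u y i, orbit u y j⁆⁆ ∈ m := by
    intro i hi j hj hij
    rcases Nat.eq_zero_or_pos i with rfl | hi0
    · exact hyy j hj
    · rw [h.lie_orbit_orbit hi0 hij hj]
      exact zero_mem _
  have hyc : ∀ v ∈ c, ⁅y, v⁆ ∈ m := by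
    intro v hv
    induction hv using Submodule.span_induction with
    | mem v hv =>
      obtain ⟨a, ha, b, hb, rfl⟩ := hv
      induction ha using Submodule.span_induction with
      | mem a ha =>
        obtain ⟨i, hi, rfl⟩ := ha
        induction hb using Submodule.span_induction with
        | mem b hb =>
          obtain ⟨j, hj, rfl⟩ := hb
          rcases lt_trichotomy i j with hij | rfl | hij
          · exact hyo i hi j hj hij
          · rw [lie_self, lie_zero]
            exact zero_mem _
          · rw [lie_comm_eq_neg (x := orbit u y i), lie_neg]
            exact neg_mem (hyo j hj i hi hij)
        | zero => rw [lie_zero, lie_zero]; exact zero_mem _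
        | add v w _ _ hv hw => rw [LieRing.lie_add, LieRing.lie_add]; exact add_mem hv hw
        | smul r v _ hv => rw [lie_smul, lie_smul]; exact Submodule.smul_mem _ r hv
      | zero => rw [zero_lie, lie_zero]; exact zero_mem _
      | add v w _ _ hv hw => rw [add_lie v w b, LieRing.lie_add]; exact add_mem hv hw
      | smul r v _ hv => rw [smul_lie, lie_smul]; exact Submodule.smul_mem _ r hv
    | zero => rw [lie_zero]; exact zero_mem _
    | add v w _ _ hv hw => rw [LieRing.lie_add]; exact add_mem hv hw
    | smul r v _ hv => rw [lie_smul]; exact Submodule.smul_mem _ r hv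
  have hdc : ∀ v ∈ c, ⁅z - z', v⁆ = 0 := by
    intro v hv
    induction hv using Submodule.span_induction with
    | mem v hv =>
      obtain ⟨a, ha, b, hb, rfl⟩ := hv
      rw [leibniz_lie, hdm a ha, hdm b hb, zero_lie, lie_zero, add_zero]
    | zero => exact lie_zero _
    | add v w _ _ hv hw => rw [LieRing.lie_add, hv, hw, add_zero]
    | smul r v _ hv => rw [lie_smul, hv, smul_zero]
  have huc : ∀ p < K, ∀ v ∈ c, ⁅u p, v⁆ ∈ c := by
    intro p hp v hv
    induction hv using Submodule.span_induction with
    | mem v hv =>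
      obtain ⟨a, ha, b, hb, rfl⟩ := hv
      rw [leibniz_lie]
      exact add_mem (hcm _ (hum p hp a ha) _ hb) (hcm _ ha _ (hum p hp b hb))
    | zero => rw [lie_zero]; exact zero_mem _
    | add v w _ _ hv hw => rw [LieRing.lie_add]; exact add_mem hv hw
    | smul r v _ hv => rw [lie_smul]; exact Submodule.smul_mem _ r hv
  have hyI : ∀ v ∈ m ⊔ c, ⁅y, v⁆ ∈ m ⊔ c := by
    intro v hv
    obtain ⟨a, ha, b, hb, rfl⟩ := Submodule.mem_sup.mp hv
    rw [LieRing.lie_add]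
    exact add_mem (Submodule.mem_sup_right (hcm _ hym _ ha)) (Submodule.mem_sup_left (hyc b hb))
  have hdI : ∀ v ∈ m ⊔ c, ⁅z - z', v⁆ = 0 := by
    intro v hv
    obtain ⟨a, ha, b, hb, rfl⟩ := Submodule.mem_sup.mp hv
    rw [LieRing.lie_add, hdm a ha, hdc b hb, add_zero]
  have hz : ∀ v ∈ m ⊔ c, ⁅z, v⁆ = (2⁻¹ : ℝ) • ⁅y, v⁆ ∧ ⁅z', v⁆ = (2⁻¹ : ℝ) • ⁅y, v⁆ := by
    intro v hv
    have h1 := hdI v hv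
    rw [sub_lie, sub_eq_zero] at h1
    rw [hy, add_lie, h1]
    constructor <;> module
  refine ⟨m ⊔ c, Submodule.mem_sup_left hym, Submodule.mem_sup_left (orbit_mem (k := 1) h.pos),
    fun p hp v hv ↦ ?_, fun v hv ↦ ?_, fun v hv ↦ ?_, hdI⟩
  · obtain ⟨a, ha, b, hb, rfl⟩ := Submodule.mem_sup.mp hv
    rw [LieRing.lie_add]
    exact add_mem (Submodule.mem_sup_left (hum p hp a ha))
      (Submodule.mem_sup_right (huc p hp b hb))
  · rw [(hz v hv).1]
    exact Submodule.smul_mem _ _ (hyI v hv)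
  · rw [(hz v hv).2]
    exact Submodule.smul_mem _ _ (hyI v hv)

end IsFork

/-- A chain with a long element at its beginning: the relations of the generators of the maximal
compact subalgebra `𝔲 (K + 1)` of the split real form of type `C`. -/
structure IsLongChain (K : ℕ) (u : ℕ → L) (w : L) : Prop extends SoChain K u where
  lie_long : ∀ p, 0 < p → p < K → ⁅u p, w⁆ = 0
  long_up : 0 < K → ⁅u 0, ⁅u 0, ⁅u 0, w⁆⁆⁆ = (-4 : ℝ) • ⁅u 0, w⁆
  long_down : 0 < K → ⁅w, ⁅w, u 0⁆⁆ = -u 0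

namespace IsLongChain

variable {K : ℕ} {u : ℕ → L} {w : L} (h : IsLongChain K u w)

/-- The elements `w, w + ½ (ad (u 0))² w, …`, whose sum spans the centre of `𝔲 (K + 1)`. -/
noncomputable def long (u : ℕ → L) (w : L) : ℕ → L
  | 0 => w
  | k + 1 => long u w k + (2⁻¹ : ℝ) • ⁅u k, ⁅u k, long u w k⁆⁆

lemma long_succ (k : ℕ) :
    long u w (k + 1) = long u w k + (2⁻¹ : ℝ) • ⁅u k, ⁅u k, long u w k⁆⁆ := rfl

include h

lemma lie_long_of_lt {k p : ℕ} (hkp : k < p) (hp : p < K) : ⁅u p, long u w k⁆ = 0 := by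
  induction k with
  | zero => exact h.lie_long p hkp hp
  | succ k ih =>
    have h1 := ih (by omega)
    have h2 := h.comm' hkp hp
    rw [long_succ, lie_add, lie_smul, h1, lie_lie_eq_zero h2 (lie_lie_eq_zero h2 h1), smul_zero,
      add_zero]

lemma cube {k : ℕ} (hk : k < K) :
    ⁅u k, ⁅u k, ⁅u k, long u w k⁆⁆⁆ = (-4 : ℝ) • ⁅u k, long u w k⁆ := by
  cases k with
  | zero => exact h.long_up hk
  | succ k =>
    have h1 := h.lie_long_of_lt (Nat.lt_succ_self k) hk
    have h2 := h.down k hk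
    rw [long_succ]
    simp only [leibniz_lie (u (k + 1)) (u k), leibniz_lie (u (k + 1)) ⁅u (k + 1), u k⁆, lie_add,
      lie_smul, h1, h2, lie_zero, lie_neg, neg_lie]
    module

lemma lie_long_add {k : ℕ} (hk : k < K) : ⁅u k, long u w k + long u w (k + 1)⁆ = 0 := by
  rw [long_succ, lie_add, lie_add, lie_smul, h.cube hk]
  module

/-- Only the two neighbouring long elements fail to commute with a generator of the chain. The point
is that `long (p + 2)` arises from `long p` by means of the bracket of `u (p + 1)` and `u p`, in the
place of a single generator. -/
lemma lie_long_of_add_lt {k p : ℕ} (hpk : p + 1 < k) (hk : k ≤ K) : ⁅u p, long u w k⁆ = 0 := by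
  induction k, hpk using Nat.le_induction with
  | base =>
    set r := u (p + 1) with hr
    set s := u p with hs
    set t := long u w p with ht
    set v := ⁅r, s⁆ with hv
    have hrt : ⁅r, t⁆ = 0 := h.lie_long_of_lt (Nat.lt_succ_self p) hk
    have hrv : ⁅r, v⁆ = -s := h.down p hk
    have hsr : ⁅s, r⁆ = -v := lie_comm_eq_neg
    have hsv : ⁅s, v⁆ = r := by
      rw [hv, lie_comm_eq_neg (x := r), lie_neg, h.up p hk, neg_neg]
    have h3 : ⁅s, ⁅s, ⁅s, t⁆⁆⁆ = (-4 : ℝ) • ⁅s, t⁆ := h.cube (by omega)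
    have hvr : ⁅v, r⁆ = s := by rw [lie_comm_eq_neg, hrv, neg_neg]
    -- `long (p + 2)` is obtained from `t` by means of `v`
    have e1 : long u w (p + 1 + 1) = t + (2⁻¹ : ℝ) • ⁅v, ⁅v, t⁆⁆ := by
      have e2 : ⁅r, ⁅r, ⁅s, ⁅s, t⁆⁆⁆⁆ = (-2 : ℝ) • ⁅s, ⁅s, t⁆⁆ + (2 : ℝ) • ⁅v, ⁅v, t⁆⁆ := by
        simp only [leibniz_lie r s, leibniz_lie r v, lie_add, ← hv, hrt, hrv, lie_zero, add_zero,
          neg_lie, lie_neg]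
        module
      rw [long_succ (p + 1), long_succ p, lie_add, lie_add, ← hr, ← ht, hrt, lie_zero, zero_add,
        lie_smul, lie_smul, ← hs, e2]
      module
    have f1 : ⁅r, ⁅s, t⁆⁆ = ⁅v, t⁆ := by rw [leibniz_lie, hrt, lie_zero, add_zero]
    have f2 : ⁅r, ⁅v, t⁆⁆ = -⁅s, t⁆ := by rw [leibniz_lie, hrt, hrv, lie_zero, add_zero, neg_lie]
    have f3 : ⁅s, ⁅v, t⁆⁆ = ⁅v, ⁅s, t⁆⁆ := by rw [leibniz_lie, hsv, hrt, zero_add]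
    have f4 : ⁅r, ⁅s, ⁅s, t⁆⁆⁆ = (2 : ℝ) • ⁅v, ⁅s, t⁆⁆ := by
      rw [leibniz_lie, ← hv, f1, f3, two_smul]
    have f5 : ⁅v, ⁅s, ⁅s, t⁆⁆⁆ = (-2 : ℝ) • ⁅v, t⁆ := by
      have g1 := congrArg (fun x ↦ ⁅s, x⁆) f4
      simp only [lie_smul] at g1
      rw [leibniz_lie s r, hsr, h3, leibniz_lie s v, hsv, lie_smul, f1, neg_lie] at g1
      linear_combination (norm := module) (-3⁻¹ : ℝ) • g1
    have f6 : ⁅v, ⁅v, ⁅s, t⁆⁆⁆ = -⁅s, t⁆ := by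
      have g1 := congrArg (fun x ↦ ⁅v, x⁆) f4
      simp only [lie_smul] at g1
      rw [leibniz_lie v r, hvr, h3, f5, lie_smul, f2] at g1
      linear_combination (norm := module) (-2⁻¹ : ℝ) • g1
    rw [e1, lie_add, lie_smul, leibniz_lie s v, hsv, f2, f3, f6]
    module
  | succ k hk' ih =>
    have h1 := ih (by omega)
    have h2 := h.comm p k hk' hk
    rw [long_succ, lie_add, lie_smul, h1, lie_lie_eq_zero h2 (lie_lie_eq_zero h2 h1), smul_zero,
      add_zero]

lemma long_lie_long {k : ℕ} (hk : k ≤ K) : ⁅w, long u w k⁆ = 0 := by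
  induction k with
  | zero => exact lie_self w
  | succ k ih =>
    rw [long_succ, lie_add, lie_smul, ih (by omega), zero_add]
    rcases Nat.eq_zero_or_pos k with rfl | hk0
    · change (2⁻¹ : ℝ) • ⁅w, ⁅u 0, ⁅u 0, w⁆⁆⁆ = 0
      rw [lie_comm_eq_neg (x := u 0) (y := w), lie_neg, lie_neg, leibniz_lie, lie_self,
        h.long_down hk, lie_neg, lie_self]
      simp
    · have h2 : ⁅w, u k⁆ = 0 := by rw [lie_comm_eq_neg, h.lie_long k hk0 hk, neg_zero]
      rw [lie_lie_eq_zero h2 (lie_lie_eq_zero h2 (ih (by omega))), smul_zero]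

/-- The sum of the long elements is central. -/
lemma lie_sum_long : ⁅w, ∑ k ∈ Finset.range (K + 1), long u w k⁆ = 0 ∧
    ∀ p < K, ⁅u p, ∑ k ∈ Finset.range (K + 1), long u w k⁆ = 0 := by
  constructor
  · rw [lie_sum]
    exact Finset.sum_eq_zero fun k hk ↦ h.long_lie_long (by simpa [Nat.lt_succ_iff] using hk)
  · intro p hp
    have hsub : ({p, p + 1} : Finset ℕ) ⊆ Finset.range (K + 1) := by
      intro k hk
      simp only [Finset.mem_insert, Finset.mem_singleton] at hk
      simp only [Finset.mem_range]
      omega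
    rw [lie_sum, ← Finset.sum_subset hsub, Finset.sum_pair (by omega), ← lie_add,
      h.lie_long_add hp]
    intro k hk hk'
    simp only [Finset.mem_insert, Finset.mem_singleton, not_or] at hk'
    rw [Finset.mem_range] at hk
    rcases lt_or_ge k p with h1 | h1
    · exact h.lie_long_of_lt h1 hp
    · exact h.lie_long_of_add_lt (by omega) (by omega)

end IsLongChain

end Chains

end RealFlag

/-! ### Generators of `𝔨` -/

namespace RealFlag

section CompactGenerators

variable {𝔤 : Type*} [LieRing 𝔤] [LieAlgebra ℝ 𝔤] [FiniteDimensional ℝ 𝔤]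
  [LieAlgebra.IsKilling ℝ 𝔤] {𝔞 : LieSubalgebra ℝ 𝔤} [𝔞.IsCartanSubalgebra]
  [LieModule.IsTriangularizable ℝ 𝔞 𝔤] {θ : 𝔤 ≃ₗ⁅ℝ⁆ 𝔤} {b : (rootSystem 𝔞).Base}

omit [LieAlgebra.IsKilling ℝ 𝔤] in
/-- Vectors of different weights are orthogonal. -/
lemma inn_eq_zero_of_isWt (h𝔞 : ∀ H ∈ 𝔞, θ H = -H) {χ ψ : Module.Dual ℝ 𝔞} {v w : 𝔤}
    (hv : IsWt χ v) (hw : IsWt ψ w) (h : χ ≠ ψ) : inn θ v w = 0 := by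
  rw [inn, killingForm_eq_zero_of_isWt hv (hw.theta h𝔞), neg_zero]
  rwa [← sub_eq_add_neg, sub_ne_zero]

namespace RootVectors

variable (V : RootVectors θ 𝔞) (hθ : IsCartanInvolution θ) (h𝔞 : ∀ H ∈ 𝔞, θ H = -H)

include hθ h𝔞 in
/-- A subalgebra that contains the elements `U i` of the simple roots contains `𝔨`. The proof is
by induction on the height, using `U ⁅x, y⁆ = ⁅U x, U y⁆ - U ⁅x, θ y⁆`. -/
lemma mem_of_theta_eq {S : LieSubalgebra ℝ 𝔤} (hS : ∀ i ∈ b.support, V.U i ∈ S) {X : 𝔤}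
    (hX : θ X = X) : X ∈ S := by
  have key : ∀ (n : ℕ) (i : 𝔞.root), (b.height i).natAbs = n →
      ∀ v, IsWt ((rootSystem 𝔞).root i) v → v + θ v ∈ S := by
    intro n
    induction n using Nat.strong_induction_on with
    | _ n ih =>
      intro i hi v hv
      wlog hpos : b.IsPos i generalizing i v
      · have hh : b.height ((rootSystem 𝔞).reflectionPerm i i) = -b.height i :=
          b.height_reflectionPerm_self i
        have hw : IsWt ((rootSystem 𝔞).root ((rootSystem 𝔞).reflectionPerm i i)) (θ v) := by
          rw [(rootSystem 𝔞).root_reflectionPerm, (rootSystem 𝔞).reflection_apply_self]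
          exact hv.theta h𝔞
        have h1 := this _ (by rw [hh, Int.natAbs_neg, hi]) _ hw
          ((RootPairing.Base.IsPos.neg_iff_not b i).mpr hpos)
        rwa [hθ.involutive, add_comm] at h1
      by_cases his : i ∈ b.support
      · obtain ⟨c, rfl⟩ := hv.exists_smul (V.isWt i) (V.ne_zero i)
        rw [map_smul, ← smul_add]
        exact S.smul_mem c (hS i his)
      · obtain ⟨j, k, hj, hk, hjk⟩ := b.exists_root_eq_add hpos his
        have hij := b.height_add hjk
        have hk1 := b.height_one_of_mem_support hk
        have hj1 : 0 < b.height j := hj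
        have hjS := ih _ (by omega) j rfl _ (V.isWt j)
        have hkS := hS k hk
        have hw := (V.isWt j).lie (V.isWt k)
        rw [← hjk] at hw
        obtain ⟨c, rfl⟩ := hv.exists_smul hw
          (lie_ne_zero hθ h𝔞 (V.isWt j) (V.isWt k) (V.ne_zero j) (V.ne_zero k) hjk)
        rw [map_smul, ← smul_add]
        apply S.smul_mem
        have hw' := (V.isWt j).lie ((V.isWt k).theta h𝔞)
        have h2 : ⁅V.e j, θ (V.e k)⁆ + θ ⁅V.e j, θ (V.e k)⁆ ∈ S := by
          by_cases h0 : ⁅V.e j, θ (V.e k)⁆ = 0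
          · rw [h0, map_zero, add_zero]
            exact zero_mem _
          by_cases h1 : (rootSystem 𝔞).root j + -(rootSystem 𝔞).root k = 0
          · rw [h1] at hw'
            rw [h𝔞 _ hw'.mem_of_zero, add_neg_cancel]
            exact zero_mem _
          · obtain ⟨l, hl⟩ := hw'.exists_root h0 h1
            have h3 := b.height_sub (hl.trans (sub_eq_add_neg _ _).symm)
            have h4 := b.height_ne_zero l
            exact ih _ (by omega) l rfl _ (by rwa [hl])
        have h3 := S.lie_mem hjS hkS
        have h4 : ⁅V.e j, V.e k⁆ + θ ⁅V.e j, V.e k⁆ =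
            ⁅V.e j + θ (V.e j), V.U k⁆ - (⁅V.e j, θ (V.e k)⁆ + θ ⁅V.e j, θ (V.e k)⁆) := by
          rw [U, LieEquiv.map_lie, LieEquiv.map_lie, hθ.involutive, add_lie, lie_add, lie_add]
          abel
        rw [h4]
        exact S.sub_mem h3 h2
  have h1 : ∀ v, v + θ v ∈ S := by
    intro v
    induction v using induction_weight (𝔞 := 𝔞) with
    | h0 H hH => rw [h𝔞 H hH, add_neg_cancel]; exact zero_mem _
    | h1 i v hv => exact key _ i rfl v hv
    | h2 v w hv hw =>
      rw [map_add, add_add_add_comm]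
      exact add_mem hv hw
  have h2 := S.smul_mem (2⁻¹ : ℝ) (h1 X)
  rwa [hX, ← two_smul ℝ, smul_smul, inv_mul_cancel₀ two_ne_zero, one_smul] at h2

include hθ h𝔞 in
lemma lie_mem_of_forall_simple {I : Submodule ℝ 𝔤}
    (hI : ∀ i ∈ b.support, ∀ v ∈ I, ⁅V.U i, v⁆ ∈ I) {X : 𝔤} (hX : θ X = X) :
    ∀ v ∈ I, ⁅X, v⁆ ∈ I := by
  let S : LieSubalgebra ℝ 𝔤 :=
    { carrier := {X | ∀ v ∈ I, ⁅X, v⁆ ∈ I}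
      add_mem' := fun ha hb v hv ↦ by rw [add_lie]; exact I.add_mem (ha v hv) (hb v hv)
      zero_mem' := fun v _ ↦ by rw [zero_lie]; exact I.zero_mem
      smul_mem' := fun c x hx v hv ↦ by rw [smul_lie]; exact I.smul_mem c (hx v hv)
      lie_mem' := fun {x y} hx hy v hv ↦ by
        rw [lie_lie]; exact I.sub_mem (hx _ (hy v hv)) (hy _ (hx v hv)) }
  exact V.mem_of_theta_eq (S := S) hθ h𝔞 hI hX

include hθ h𝔞 in
lemma lie_eq_zero_of_forall_simple {Z : 𝔤} (hZ : ∀ i ∈ b.support, ⁅V.U i, Z⁆ = 0) {X : 𝔤}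
    (hX : θ X = X) : ⁅X, Z⁆ = 0 := by
  let S : LieSubalgebra ℝ 𝔤 :=
    { carrier := {X | ⁅X, Z⁆ = 0}
      add_mem' := fun {x y} ha hb ↦ by
        change ⁅x + y, Z⁆ = 0
        rw [add_lie, show ⁅x, Z⁆ = 0 from ha, show ⁅y, Z⁆ = 0 from hb, add_zero]
      zero_mem' := zero_lie Z
      smul_mem' := fun c x hx ↦ by
        change ⁅c • x, Z⁆ = 0
        rw [smul_lie, show ⁅x, Z⁆ = 0 from hx, smul_zero]
      lie_mem' := fun {x y} hx hy ↦ by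
        change ⁅⁅x, y⁆, Z⁆ = 0
        rw [lie_lie, show ⁅x, Z⁆ = 0 from hx, show ⁅y, Z⁆ = 0 from hy, lie_zero, lie_zero, sub_zero] }
  exact V.mem_of_theta_eq (S := S) hθ h𝔞 hZ hX

include hθ in
lemma theta_lie_U (i : 𝔞.root) (v : 𝔤) : θ ⁅V.U i, v⁆ = ⁅V.U i, θ v⁆ := by
  rw [LieEquiv.map_lie, V.theta_U hθ]

include hθ h𝔞 in
lemma lie_U_U_eq_zero {i j : 𝔞.root} (hi : i ∈ b.support) (hj : j ∈ b.support)
    (h : (rootSystem 𝔞).pairingIn ℤ j i = 0) : ⁅V.U i, V.U j⁆ = 0 := by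
  have hij : i ≠ j := by
    rintro rfl
    rw [(rootSystem 𝔞).pairingIn_same] at h
    omega
  have hf : ⁅V.f i, V.e j⁆ = 0 := by
    have hw := (V.f_isWt h𝔞 i).lie (V.isWt j)
    rw [neg_add_eq_sub] at hw
    refine hw.eq_zero_of_notMem (fun h0 ↦ hij ?_) (b.sub_notMem_range_root hj hi)
    exact ((rootSystem 𝔞).root.injective (sub_eq_zero.mp h0)).symm
  have h1 := V.inn_lie_f_self hθ i (lie_corootElt (i := i) (V.isWt j))
  rw [hf, inn_zero_right, h, Int.cast_zero, zero_mul, zero_add] at h1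
  have h2 : ⁅V.U i, V.e j⁆ = 0 := by
    rw [V.lie_U, hf, eq_zero_of_inn_self hθ h1.symm, sub_zero]
  rw [U.eq_def V j, lie_add, ← V.theta_lie_U hθ, h2, map_zero, add_zero]

variable {i : 𝔞.root} (h2 : ∀ j, |(rootSystem 𝔞).pairingIn ℤ j i| ≤ 2)

lemma coroot'_eq (i j : 𝔞.root) :
    (rootSystem 𝔞).coroot' i ((rootSystem 𝔞).root j) = (rootSystem 𝔞).pairingIn ℤ j i := by
  rw [(rootSystem 𝔞).root_coroot'_eq_pairing, ← (rootSystem 𝔞).algebraMap_pairingIn ℤ,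
    algebraMap_int_eq, eq_intCast]

lemma coroot'_self (i : 𝔞.root) : (rootSystem 𝔞).coroot' i ((rootSystem 𝔞).root i) = 2 := by
  rw [coroot'_eq, (rootSystem 𝔞).pairingIn_same]
  norm_num

include h𝔞 hθ h2 in
lemma lie_U_lie_U_U {j : 𝔞.root} (h : (rootSystem 𝔞).pairingIn ℤ j i = -1) :
    ⁅V.U i, ⁅V.U i, V.U j⁆⁆ = -V.U j := by
  have hv := V.isWt j
  have h1 := V.lie_U_lie_U_of_neg_one (i := i) (v := V.e j)
    (by rw [lie_corootElt hv, h]; norm_num)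
    (((V.f_isWt h𝔞 i).lie hv).eq_zero_of_two_lt h2 (by
      rw [map_add, map_neg, coroot'_self, coroot'_eq, h]; norm_num))
    (((V.isWt i).lie ((V.isWt i).lie hv)).eq_zero_of_two_lt h2 (by
      rw [map_add, map_add, coroot'_self, coroot'_eq, h]; norm_num))
  rw [U.eq_def V j, lie_add, lie_add, ← V.theta_lie_U hθ, ← V.theta_lie_U hθ, h1, map_neg, neg_add]

include h𝔞 h2 in
/-- The action of `U i` on a vector of weight `χ` whose value on the coroot of `i` is `-2`. -/
lemma lie_U_of_coroot'_eq_neg_two {χ : Module.Dual ℝ 𝔞} {v : 𝔤} (hv : IsWt χ v)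
    (h : (rootSystem 𝔞).coroot' i χ = -2) :
    ⁅V.U i, ⁅V.U i, v⁆⁆ = ⁅V.e i, ⁅V.e i, v⁆⁆ - (2 : ℝ) • v ∧
      ⁅V.U i, ⁅V.U i, ⁅V.U i, v⁆⁆⁆ = (-4 : ℝ) • ⁅V.U i, v⁆ := by
  have hev := (V.isWt i).lie hv
  have heeev := (V.isWt i).lie ((V.isWt i).lie hev)
  have hhv := hv.lie_corootElt i
  rw [h] at hhv
  have hf : ⁅V.f i, v⁆ = 0 := ((V.f_isWt h𝔞 i).lie hv).eq_zero_of_two_lt h2 (by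
    rw [map_add, map_neg, coroot'_self, h]; norm_num)
  have he : ⁅V.e i, ⁅V.e i, ⁅V.e i, v⁆⁆⁆ = 0 := heeev.eq_zero_of_two_lt h2 (by
    rw [map_add, map_add, map_add, coroot'_self, h]; norm_num)
  have h' : ⁅corootElt i, ⁅V.e i, v⁆⁆ = 0 := by
    rw [hev.lie_corootElt, map_add, coroot'_self, h]; norm_num
  have h3 := V.lie_U_lie_U_of_neg_two hhv h' hf he
  have hUv : ⁅V.U i, v⁆ = ⁅V.e i, v⁆ := by rw [V.lie_U, hf, sub_zero]
  refine ⟨?_, by rw [hUv, h3]⟩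
  rw [hUv, V.lie_U, V.lie_f_lie_e, hf, lie_zero, hhv]
  module

include h𝔞 hθ h2 in
lemma lie_U_cube_U {j : 𝔞.root} (h : (rootSystem 𝔞).pairingIn ℤ j i = -2) :
    ⁅V.U i, ⁅V.U i, ⁅V.U i, V.U j⁆⁆⁆ = (-4 : ℝ) • ⁅V.U i, V.U j⁆ := by
  have h1 := (V.lie_U_of_coroot'_eq_neg_two h𝔞 h2 (V.isWt j) (by
    rw [coroot'_eq, h]; norm_num)).2
  rw [U.eq_def V j, lie_add, lie_add, lie_add, ← V.theta_lie_U hθ, ← V.theta_lie_U hθ,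
    ← V.theta_lie_U hθ, h1, map_smul, smul_add]

end RootVectors

end CompactGenerators

end RealFlag

namespace RootPairing.NormForm

variable {ι M N : Type*} [AddCommGroup M] [Module ℝ M] [AddCommGroup N] [Module ℝ N]
  {P : RootPairing ι ℝ M N} [P.IsCrystallographic]

lemma abs_pairingIn_le_two (F : P.NormForm) (j i : ι) : |P.pairingIn ℤ j i| ≤ 2 := by
  have h1 := F.pairing_mul j i
  rw [← P.algebraMap_pairingIn ℤ, algebraMap_int_eq, eq_intCast] at h1
  set p : ℝ := ((P.pairingIn ℤ j i : ℤ) : ℝ) with hp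
  have h2 := F.form_self_nonneg (P.root j - (p / 2) • P.root i)
  simp only [map_sub, map_smul, LinearMap.sub_apply, LinearMap.smul_apply, smul_eq_mul,
    F.symm (P.root i) (P.root j)] at h2
  have h3 : p ^ 2 * F.form (P.root i) (P.root i) ≤ 4 * F.form (P.root j) (P.root j) := by
    rw [show F.form (P.root j) (P.root i) = p / 2 * F.form (P.root i) (P.root i) by linarith] at h2
    linarith
  have h4 : p ^ 2 ≤ 8 := by
    rcases F.len i with hi | hi <;> rcases F.len j with hj | hj <;> rw [hi, hj] at h3 <;> linarith
  have h5 : (P.pairingIn ℤ j i) ^ 2 ≤ 8 := by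
    rw [hp] at h4
    exact_mod_cast h4
  rw [abs_le]
  constructor <;> nlinarith

end RootPairing.NormForm

/-! ### Characters of `M` at the end of the Dynkin diagram -/

namespace RealFlag

section FrameCharacters

variable {𝔤 : Type*} [LieRing 𝔤] [LieAlgebra ℝ 𝔤] [FiniteDimensional ℝ 𝔤]
  [LieAlgebra.IsKilling ℝ 𝔤] {𝔞 : LieSubalgebra ℝ 𝔤} [𝔞.IsCartanSubalgebra]
  [LieModule.IsTriangularizable ℝ 𝔞 𝔤] {θ : 𝔤 ≃ₗ⁅ℝ⁆ 𝔤} {b : (rootSystem 𝔞).Base}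

namespace RootVectors

variable (V : RootVectors θ 𝔞) (hθ : IsCartanInvolution θ) (h𝔞 : ∀ H ∈ 𝔞, θ H = -H)
  (F : (rootSystem 𝔞).NormForm)

include hθ h𝔞 in
lemma lie_U_U_of_form {i j : 𝔞.root} (hi : i ∈ b.support) (hj : j ∈ b.support)
    (h : F.form ((rootSystem 𝔞).root i) ((rootSystem 𝔞).root j) = 0) : ⁅V.U i, V.U j⁆ = 0 := by
  refine V.lie_U_U_eq_zero hθ h𝔞 hi hj (F.pairingIn_eq ?_)
  rw [F.symm, h]
  simp

include hθ h𝔞 in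
lemma lie_U_lie_U_U_of_form {i j : 𝔞.root}
    (h : 2 * F.form ((rootSystem 𝔞).root i) ((rootSystem 𝔞).root j) =
      -F.form ((rootSystem 𝔞).root i) ((rootSystem 𝔞).root i)) :
    ⁅V.U i, ⁅V.U i, V.U j⁆⁆ = -V.U j := by
  refine V.lie_U_lie_U_U hθ h𝔞 (fun j ↦ F.abs_pairingIn_le_two j i) (F.pairingIn_eq ?_)
  rw [F.symm, h]
  simp

include hθ h𝔞 in
lemma lie_U_cube_U_of_form {i j : 𝔞.root}
    (h : F.form ((rootSystem 𝔞).root i) ((rootSystem 𝔞).root j) =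
      -F.form ((rootSystem 𝔞).root i) ((rootSystem 𝔞).root i)) :
    ⁅V.U i, ⁅V.U i, ⁅V.U i, V.U j⁆⁆⁆ = (-4 : ℝ) • ⁅V.U i, V.U j⁆ := by
  refine V.lie_U_cube_U hθ h𝔞 (fun j ↦ F.abs_pairingIn_le_two j i) (F.pairingIn_eq ?_)
  rw [F.symm, h]
  push_cast
  ring

end RootVectors

open RootPairing

variable {F : (rootSystem 𝔞).NormForm} {n : ℕ} (O : OrthFrame F b n) (V : RootVectors θ 𝔞)
  (hθ : IsCartanInvolution θ) (h𝔞 : ∀ H ∈ 𝔞, θ H = -H)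

include hθ h𝔞 in
/-- In the absence of long roots, the last two simple roots of a frame have the same character of
`M`: an element of `M` that separates them would interchange, up to sign, the sum and the
difference of the two elements `U`, which lie in different ideals of `𝔨`. -/
lemma chi_eq_of_not_isLong (hl : ¬ O.IsLong) (hn : 3 ≤ n) {i j : 𝔞.root}
    (hi : (rootSystem 𝔞).root i = O.simple (n - 2))
    (hj : (rootSystem 𝔞).root j = O.simple (n - 1)) {k : 𝔤 ≃ₗ⁅ℝ⁆ 𝔤} (hk : ∀ H ∈ 𝔞, k H = H)
    (hkK : k ∈ maximalCompact θ) : V.chi k i = V.chi k j := by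
  have : Nonempty 𝔞.root := ⟨i⟩
  choose! a ha ha' using fun p (hp : p < n) ↦ O.exists_simple hp
  obtain rfl : i = a (n - 2) :=
    (rootSystem 𝔞).root.injective (hi.trans (ha' _ (by omega)).symm)
  obtain rfl : j = a (n - 1) :=
    (rootSystem 𝔞).root.injective (hj.trans (ha' _ (by omega)).symm)
  have hself : ∀ p < n, F.form (O.simple p) (O.simple p) = 2 := by
    intro p hp
    rcases Nat.lt_or_ge (p + 1) n with h | h
    · rw [O.form_simple_lt_lt h h, if_pos rfl]
    · obtain rfl : p = n - 1 := by omega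
      exact O.form_simple_last_last_of_not_isLong hl
  have hcomm : ∀ p q, p < n → q < n → F.form (O.simple p) (O.simple q) = 0 →
      ⁅V.U (a p), V.U (a q)⁆ = 0 := fun p q hp hq h ↦
    V.lie_U_U_of_form hθ h𝔞 F (ha p hp) (ha q hq) (by rw [ha' p hp, ha' q hq, h])
  have hadj : ∀ p q, p < n → q < n → F.form (O.simple p) (O.simple q) = -1 →
      ⁅V.U (a p), ⁅V.U (a p), V.U (a q)⁆⁆ = -V.U (a q) := fun p q hp hq h ↦
    V.lie_U_lie_U_U_of_form hθ h𝔞 F (by rw [ha' p hp, ha' q hq, h, hself p hp]; norm_num)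
  have hadj' : ∀ p q, p < n → q < n → F.form (O.simple p) (O.simple q) = -1 →
      ⁅V.U (a q), ⁅V.U (a q), V.U (a p)⁆⁆ = -V.U (a p) := fun p q hp hq h ↦
    hadj q p hq hp (by rw [F.symm, h])
  have hfork : IsFork (n - 2) (fun k ↦ V.U (a (n - 3 - k))) (V.U (a (n - 2))) (V.U (a (n - 1))) :=
    { comm := fun p q hpq hq ↦ hcomm _ _ (by omega) (by omega) (by
        rw [O.form_simple_lt_lt (by omega) (by omega), if_neg (by omega), if_neg (by omega)])
      up := fun p hp ↦ hadj _ _ (by omega) (by omega) (by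
        rw [O.form_simple_lt_lt (by omega) (by omega), if_neg (by omega), if_pos (by omega)])
      down := fun p hp ↦ hadj' _ _ (by omega) (by omega) (by
        rw [O.form_simple_lt_lt (by omega) (by omega), if_neg (by omega), if_pos (by omega)])
      pos := by omega
      lie_fork := hcomm _ _ (by omega) (by omega) (by
        rw [O.form_simple_last_of_not_isLong hl (by omega), if_neg (by omega)])
      lie_left := fun p hp0 hp ↦ hcomm _ _ (by omega) (by omega) (by
        rw [O.form_simple_lt_lt (by omega) (by omega), if_neg (by omega), if_neg (by omega)])
      lie_right := fun p hp0 hp ↦ hcomm _ _ (by omega) (by omega) (by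
        rw [O.form_simple_last_of_not_isLong hl (by omega), if_neg (by omega)])
      left_up := hadj _ _ (by omega) (by omega) (by
        rw [O.form_simple_lt_lt (by omega) (by omega), if_neg (by omega), if_pos (by omega)])
      right_up := hadj _ _ (by omega) (by omega) (by
        rw [O.form_simple_last_of_not_isLong hl (by omega), if_pos (by omega)])
      left_down := hadj' _ _ (by omega) (by omega) (by
        rw [O.form_simple_lt_lt (by omega) (by omega), if_neg (by omega), if_pos (by omega)])
      right_down := hadj' _ _ (by omega) (by omega) (by
        rw [O.form_simple_last_of_not_isLong hl (by omega), if_pos (by omega)]) }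
  obtain ⟨I, hyI, hqI, hI, hzI, hz'I, hdI⟩ := hfork.exists_stable
  have hIK : ∀ v ∈ I, k v ∈ I := by
    refine apply_mem_of_maximalCompact (fun X hX ↦ V.lie_mem_of_forall_simple hθ h𝔞 (b := b)
      (fun l hl ↦ ?_) hX) hkK
    obtain ⟨f, hf⟩ := O.exists_equiv
    obtain ⟨p, hpn, hl'⟩ : ∃ p < n, (rootSystem 𝔞).root l = O.simple p :=
      ⟨f ⟨l, hl⟩, (f ⟨l, hl⟩).2, hf ⟨l, hl⟩⟩
    obtain rfl : l = a p := (rootSystem 𝔞).root.injective (hl'.trans (ha' p hpn).symm)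
    rcases Nat.lt_or_ge p (n - 2) with h | h
    · have := hI (n - 3 - p) (by omega)
      rwa [show n - 3 - (n - 3 - p) = p by omega] at this
    · rcases (show p = n - 2 ∨ p = n - 1 by omega) with h | h <;> rw [h]
      · exact hzI
      · exact hz'I
  set z := V.U (a (n - 2)) with hz
  set z' := V.U (a (n - 1)) with hz'
  have hkU : ∀ l, k (V.U l) = V.chi k l • V.U l := by
    intro l
    rw [RootVectors.U, map_add, map_theta_of_maximalCompact hkK,
      V.apply_eq_chi_smul hθ hk (V.isWt l), map_smul, smul_add]
  by_contra hne
  -- since the characters have values `± 1`, they are opposite to each other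
  have hop : V.chi k (a (n - 1)) = -V.chi k (a (n - 2)) := by
    have h1 := V.chi_mul_self hθ hk hkK (a (n - 2))
    have h2 := V.chi_mul_self hθ hk hkK (a (n - 1))
    rcases mul_self_eq_mul_self_iff.mp (h2.trans h1.symm) with h | h
    · exact absurd h.symm hne
    · exact h
  have hky : k (z + z') = V.chi k (a (n - 2)) • (z - z') := by
    rw [map_add, hkU, hkU, hop]
    module
  set q := ⁅V.U (a (n - 3 - 0)), z + z'⁆ with hq
  have hq0 : ⁅z + z', q⁆ = 0 := by
    refine k.injective (?_ : k ⁅z + z', q⁆ = k 0)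
    rw [LieEquiv.map_lie, hky, smul_lie, hdI _ (hIK _ hqI), smul_zero, map_zero]
  have h4 : ⁅z + z', ⁅z + z', q⁆⁆ = (-4 : ℝ) • q :=
    hfork.add_sq_orbit (k := 1) one_pos hfork.pos
  rw [hq0, lie_zero] at h4
  have hq1 : q = 0 := (smul_eq_zero.mp h4.symm).resolve_left (by norm_num)
  have h5 : ⁅V.U (a (n - 3 - 0)), ⁅V.U (a (n - 3 - 0)), z + z'⁆⁆ = -(z + z') := hfork.add_up
  rw [← hq, hq1, lie_zero] at h5
  have h6 : z + z' = 0 := neg_eq_zero.mp h5.symm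
  have h7 : inn θ (V.e (a (n - 2))) (z + z') = inn θ (V.e (a (n - 2))) (V.e (a (n - 2))) := by
    have horth : F.form (O.simple (n - 2)) (O.simple (n - 1)) = 0 := by
      rw [O.form_simple_last_of_not_isLong hl (by omega), if_neg (by omega)]
    have hs := hself (n - 2) (by omega)
    rw [hz, hz', RootVectors.U, RootVectors.U, inn_add_right, inn_add_right, inn_add_right,
      inn_eq_zero_of_isWt h𝔞 (V.isWt _) ((V.isWt (a (n - 2))).theta h𝔞),
      inn_eq_zero_of_isWt h𝔞 (V.isWt _) (V.isWt (a (n - 1))),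
      inn_eq_zero_of_isWt h𝔞 (V.isWt _) ((V.isWt (a (n - 1))).theta h𝔞)]
    · ring
    · rw [ha' _ (by omega), ha' _ (by omega)]
      intro h
      rw [← neg_eq_iff_eq_neg] at h
      rw [← h, map_neg, hs] at horth
      norm_num at horth
    · rw [ha' _ (by omega), ha' _ (by omega)]
      intro h
      rw [← h, hs] at horth
      norm_num at horth
    · rw [ha' _ (by omega)]
      intro h
      have h8 := congrArg (F.form (O.simple (n - 2))) h
      rw [map_neg, hs] at h8
      norm_num at h8
  rw [h6, inn_zero_right] at h7
  exact (inn_self_pos hθ (V.ne_zero (a (n - 2)))).ne h7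

include hθ h𝔞 in
/-- In the presence of long roots, the character of `M` on the root space of the last simple root
of a frame is trivial: the corresponding element `U` is a component of a central element of `𝔨`. -/
lemma chi_eq_one_of_isLong (hl : O.IsLong) {j : 𝔞.root}
    (hj : (rootSystem 𝔞).root j = O.simple (n - 1)) {k : 𝔤 ≃ₗ⁅ℝ⁆ 𝔤} (hk : ∀ H ∈ 𝔞, k H = H)
    (hkK : k ∈ maximalCompact θ) : V.chi k j = 1 := by
  have hn := O.two_le
  have : Nonempty 𝔞.root := ⟨j⟩
  choose! a ha ha' using fun p (hp : p < n) ↦ O.exists_simple hp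
  obtain rfl : j = a (n - 1) :=
    (rootSystem 𝔞).root.injective (hj.trans (ha' _ (by omega)).symm)
  have hself : ∀ p, p + 1 < n → F.form (O.simple p) (O.simple p) = 2 := fun p h ↦ by
    rw [O.form_simple_lt_lt h h, if_pos rfl]
  have hcomm : ∀ p q, p < n → q < n → F.form (O.simple p) (O.simple q) = 0 →
      ⁅V.U (a p), V.U (a q)⁆ = 0 := fun p q hp hq h ↦
    V.lie_U_U_of_form hθ h𝔞 F (ha p hp) (ha q hq) (by rw [ha' p hp, ha' q hq, h])
  have hadj : ∀ p q, p + 1 < n → q + 1 < n → F.form (O.simple p) (O.simple q) = -1 →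
      ⁅V.U (a p), ⁅V.U (a p), V.U (a q)⁆⁆ = -V.U (a q) := fun p q hp hq h ↦
    V.lie_U_lie_U_U_of_form hθ h𝔞 F
      (by rw [ha' p (by omega), ha' q (by omega), h, hself p hp]; norm_num)
  set w := V.U (a (n - 1)) with hw
  set u : ℕ → 𝔤 := fun k ↦ V.U (a (n - 2 - k)) with hu
  have hchain : IsLongChain (n - 1) u w :=
    { comm := fun p q hpq hq ↦ hcomm _ _ (by omega) (by omega) (by
        rw [O.form_simple_lt_lt (by omega) (by omega), if_neg (by omega), if_neg (by omega)])
      up := fun p hp ↦ hadj _ _ (by omega) (by omega) (by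
        rw [O.form_simple_lt_lt (by omega) (by omega), if_neg (by omega), if_pos (by omega)])
      down := fun p hp ↦ hadj _ _ (by omega) (by omega) (by
        rw [O.form_simple_lt_lt (by omega) (by omega), if_neg (by omega), if_pos (by omega)])
      lie_long := fun p hp0 hp ↦ hcomm _ _ (by omega) (by omega) (by
        rw [O.form_simple_last_of_isLong hl (by omega), if_neg (by omega)])
      long_up := fun _ ↦ V.lie_U_cube_U_of_form hθ h𝔞 F (by
        rw [ha' _ (by omega), ha' _ (by omega), O.form_simple_last_of_isLong hl (by omega),
          if_pos (by omega), hself _ (by omega)])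
      long_down := fun _ ↦ V.lie_U_lie_U_U_of_form hθ h𝔞 F (by
        rw [ha' _ (by omega), ha' _ (by omega), F.symm (O.simple (n - 1)),
          O.form_simple_last_of_isLong hl (by omega), if_pos (by omega),
          O.form_simple_last_last_of_isLong hl]
        norm_num) }
  set Z := ∑ p ∈ Finset.range (n - 1 + 1), IsLongChain.long u w p with hZ
  have hkZ : k Z = Z := by
    refine apply_eq_of_maximalCompact (fun X hX ↦ V.lie_eq_zero_of_forall_simple hθ h𝔞 (b := b)
      (fun l hl ↦ ?_) hX) hkK
    obtain ⟨f, hf⟩ := O.exists_equiv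
    obtain ⟨p, hpn, hl'⟩ : ∃ p < n, (rootSystem 𝔞).root l = O.simple p :=
      ⟨f ⟨l, hl⟩, (f ⟨l, hl⟩).2, hf ⟨l, hl⟩⟩
    obtain rfl : l = a p := (rootSystem 𝔞).root.injective (hl'.trans (ha' p hpn).symm)
    rcases Nat.lt_or_ge p (n - 1) with h | h
    · have := hchain.lie_sum_long.2 (n - 2 - p) (by omega)
      rw [hu] at this
      simp only [show n - 2 - (n - 2 - p) = p by omega] at this
      exact this
    · obtain rfl : p = n - 1 := by omega
      exact hchain.lie_sum_long.1
  -- the summands lie in the root spaces of different long roots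
  have hlong : ∀ p, p < n → ∃ x, IsWt ((2 : ℝ) • O.e (n - 1 - p)) x ∧
      IsLongChain.long u w p = x + θ x := by
    intro p
    induction p with
    | zero =>
      intro _
      refine ⟨V.e (a (n - 1)), ?_, rfl⟩
      rw [tsub_zero, ← O.simple_last_of_isLong hl, ← hj]
      exact V.isWt _
    | succ p ih =>
      intro hp
      obtain ⟨x, hx, hx'⟩ := ih (by omega)
      have hs : (rootSystem 𝔞).root (a (n - 2 - p)) = O.e (n - 2 - p) - O.e (n - 1 - p) := by
        rw [ha' _ (by omega), O.simple_lt (by omega), show n - 2 - p + 1 = n - 1 - p by omega]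
      have hc : (rootSystem 𝔞).coroot' (a (n - 2 - p)) ((2 : ℝ) • O.e (n - 1 - p)) = -2 := by
        have h1 := F.coroot_mul ((2 : ℝ) • O.e (n - 1 - p)) (a (n - 2 - p))
        rw [hs] at h1
        simp only [map_smul, map_sub, LinearMap.smul_apply, LinearMap.sub_apply, smul_eq_mul,
          O.form_eq (show n - 1 - p < n by omega) (show n - 1 - p < n by omega),
          O.form_eq (show n - 2 - p < n by omega) (show n - 2 - p < n by omega),
          O.form_eq (show n - 2 - p < n by omega) (show n - 1 - p < n by omega),
          O.form_eq (show n - 1 - p < n by omega) (show n - 2 - p < n by omega),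
          if_true, if_neg (show n - 1 - p ≠ n - 2 - p by omega),
          if_neg (show n - 2 - p ≠ n - 1 - p by omega)] at h1
        rw [map_smul, smul_eq_mul]
        linarith
      have h1 := (V.lie_U_of_coroot'_eq_neg_two h𝔞
        (fun l ↦ F.abs_pairingIn_le_two l (a (n - 2 - p))) hx hc).1
      have h2 : ⁅u p, ⁅u p, x + θ x⁆⁆ = ⁅V.e (a (n - 2 - p)), ⁅V.e (a (n - 2 - p)), x⁆⁆ +
          θ ⁅V.e (a (n - 2 - p)), ⁅V.e (a (n - 2 - p)), x⁆⁆ - (2 : ℝ) • (x + θ x) := by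
        rw [lie_add, lie_add, ← V.theta_lie_U hθ, ← V.theta_lie_U hθ, h1, map_sub, map_smul]
        module
      refine ⟨(2⁻¹ : ℝ) • ⁅V.e (a (n - 2 - p)), ⁅V.e (a (n - 2 - p)), x⁆⁆, ?_, ?_⟩
      · have h3 := (V.isWt (a (n - 2 - p))).lie ((V.isWt (a (n - 2 - p))).lie hx)
        rw [hs, show O.e (n - 2 - p) - O.e (n - 1 - p) + (O.e (n - 2 - p) - O.e (n - 1 - p) +
          (2 : ℝ) • O.e (n - 1 - p)) = (2 : ℝ) • O.e (n - 1 - (p + 1)) by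
            rw [show n - 1 - (p + 1) = n - 2 - p by omega]; module] at h3
        exact h3.smul _
      · rw [IsLongChain.long_succ, hx', h2, map_smul]
        module
  have hne : ∀ p, p < n → p ≠ 0 → ∀ c : ℝ, O.simple (n - 1) ≠ (c * 2) • O.e (n - 1 - p) := by
    intro p hp hp0 c h
    have h1 := congrArg (F.form (O.e (n - 1))) h
    rw [O.simple_last_of_isLong hl] at h1
    simp only [map_smul, smul_eq_mul, O.form_self (n - 1) (by omega),
      O.form_ne (n - 1) (by omega) (n - 1 - p) (by omega) (by omega)] at h1
    norm_num at h1
  have hinn : ∀ l : 𝔤 ≃ₗ⁅ℝ⁆ 𝔤, (∀ H ∈ 𝔞, l H = H) → l ∈ maximalCompact θ →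
      inn θ (V.e (a (n - 1))) (l Z) = V.chi l (a (n - 1)) *
        inn θ (V.e (a (n - 1))) (V.e (a (n - 1))) := by
    intro l hl0 hlK
    have hadd : ∀ s : Finset ℕ, inn θ (V.e (a (n - 1)))
        (l (∑ p ∈ s, IsLongChain.long u w p)) =
        ∑ p ∈ s, inn θ (V.e (a (n - 1))) (l (IsLongChain.long u w p)) := by
      intro s
      simp only [inn, map_sum, Finset.sum_neg_distrib]
    rw [hZ, hadd, Finset.sum_eq_single_of_mem 0 (by simp)]
    · change inn θ _ (l (V.U _)) = _
      rw [RootVectors.U, map_add, map_theta_of_maximalCompact hlK,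
        V.apply_eq_chi_smul hθ hl0 (V.isWt _), inn_add_right, map_smul, inn_smul_right,
        inn_smul_right,
        inn_eq_zero_of_isWt h𝔞 (V.isWt _) ((V.isWt (a (n - 1))).theta h𝔞), mul_zero, add_zero]
      intro h
      have h8 := congrArg (F.form ((rootSystem 𝔞).root (a (n - 1)))) h
      rw [map_neg, hj, O.form_simple_last_last_of_isLong hl] at h8
      norm_num at h8
    · intro p hp hp0
      rw [Finset.mem_range] at hp
      obtain ⟨x, hx, hx'⟩ := hlong p (by omega)
      rw [hx', map_add, map_theta_of_maximalCompact hlK, inn_add_right,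
        inn_eq_zero_of_isWt h𝔞 (V.isWt _) (hx.map hl0),
        inn_eq_zero_of_isWt h𝔞 (V.isWt _) ((hx.map hl0).theta h𝔞), add_zero]
      · rw [hj]
        exact fun h ↦ hne p (by omega) hp0 (-1) (h.trans (by module))
      · rw [hj]
        have := hne p (by omega) hp0 1
        rwa [one_mul] at this
  have h1 := hinn k hk hkK
  have h2 := hinn 1 (fun _ _ ↦ rfl) (one_mem _)
  have h3 : V.chi 1 (a (n - 1)) = 1 := V.chi_eq hθ (fun _ _ ↦ rfl) (V.isWt _) (V.ne_zero _)
    (by rw [one_smul]; rfl)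
  rw [hkZ] at h1
  rw [h3, one_mul] at h2
  change inn θ _ Z = _ at h2
  rw [h2] at h1
  have h4 := (inn_self_pos hθ (V.ne_zero (a (n - 1)))).ne'
  field_simp at h1
  exact h1.symm

end FrameCharacters

end RealFlag

/-! ### Pairs of positive roots with the same character -/

namespace RealFlag

section PairedRoots

variable {𝔤 : Type*} [LieRing 𝔤] [LieAlgebra ℝ 𝔤] [FiniteDimensional ℝ 𝔤]
  [LieAlgebra.IsKilling ℝ 𝔤] {𝔞 : LieSubalgebra ℝ 𝔤} [𝔞.IsCartanSubalgebra]
  [LieModule.IsTriangularizable ℝ 𝔞 𝔤] {θ : 𝔤 ≃ₗ⁅ℝ⁆ 𝔤} {b : (rootSystem 𝔞).Base}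

open RootPairing

variable {F : (rootSystem 𝔞).NormForm} {n : ℕ} (O : OrthFrame F b n) (V : RootVectors θ 𝔞)
  (hθ : IsCartanInvolution θ) (h𝔞 : ∀ H ∈ 𝔞, θ H = -H)
  [(rootSystem 𝔞).IsIrreducible]

omit [(rootSystem 𝔞).IsIrreducible] in
include hθ h𝔞 in
/-- Long roots of a frame have trivial characters. -/
lemma chi_long {p : ℕ} (hp : p < n) {i : 𝔞.root}
    (hi : (rootSystem 𝔞).root i = (2 : ℝ) • O.e p) {k : 𝔤 ≃ₗ⁅ℝ⁆ 𝔤} (hk : ∀ H ∈ 𝔞, k H = H)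
    (hkK : k ∈ maximalCompact θ) : V.chi k i = 1 := by
  have hn := O.two_le
  have hl : O.IsLong := by
    rcases O.long with h | h
    · exact h
    · exact absurd hi (h i p hp)
  obtain ⟨l, -, hl'⟩ := hl (n - 1) (by omega)
  have h1 : V.chi k l = 1 := chi_eq_one_of_isLong O V hθ h𝔞 hl
    (hl'.trans (O.simple_last_of_isLong hl).symm) hk hkK
  rcases Nat.lt_or_ge p (n - 1) with h | h
  · obtain ⟨r, -, hr⟩ := O.sub_mem p (n - 1) h (by omega)
    obtain ⟨s, -, hs⟩ := O.add_mem p (n - 1) h (by omega)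
    have h2 : V.chi k s = V.chi k r * V.chi k l :=
      V.chi_add hθ hk h𝔞 (by rw [hs, hr, hl']; module)
    have h3 : V.chi k i = V.chi k r * V.chi k s :=
      V.chi_add hθ hk h𝔞 (by rw [hs, hr, hi]; module)
    rw [h3, h2, h1, mul_one, V.chi_mul_self hθ hk hkK]
  · obtain rfl : p = n - 1 := by omega
    rwa [← (rootSystem 𝔞).root.injective (hl'.trans hi.symm)]

include hθ h𝔞 in
/-- The roots `e_p - e_q` and `e_p + e_q` of a frame have the same character of `M`. -/
lemma chi_sub_eq_chi_add {p q : ℕ} (hpq : p < q) (hq : q < n) {i j : 𝔞.root}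
    (hi : (rootSystem 𝔞).root i = O.e p - O.e q) (hj : (rootSystem 𝔞).root j = O.e p + O.e q)
    {k : 𝔤 ≃ₗ⁅ℝ⁆ 𝔤} (hk : ∀ H ∈ 𝔞, k H = H) (hkK : k ∈ maximalCompact θ) :
    V.chi k i = V.chi k j := by
  by_cases hl : O.IsLong
  · obtain ⟨l, -, hl'⟩ := hl q hq
    have h2 : V.chi k j = V.chi k i * V.chi k l :=
      V.chi_add hθ hk h𝔞 (by rw [hi, hj, hl']; module)
    rw [h2, chi_long O V hθ h𝔞 hq hl' hk hkK, mul_one]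
  have hn := O.three_le hl
  -- first the case `q = n - 1`, which is reduced to the last two simple roots
  have key : ∀ p, p < n - 1 → ∀ i j, (rootSystem 𝔞).root i = O.e p - O.e (n - 1) →
      (rootSystem 𝔞).root j = O.e p + O.e (n - 1) → V.chi k i = V.chi k j := by
    intro p hp i j hi hj
    obtain ⟨r, -, hr⟩ := O.exists_simple (p := n - 2) (by omega)
    obtain ⟨s, -, hs⟩ := O.exists_simple (p := n - 1) (by omega)
    have h0 := chi_eq_of_not_isLong O V hθ h𝔞 hl hn hr hs hk hkK
    rw [O.simple_lt (by omega), show n - 2 + 1 = n - 1 by omega] at hr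
    rw [O.simple_last_of_not_isLong hl] at hs
    rcases Nat.lt_or_ge p (n - 2) with h | h
    · obtain ⟨t, -, ht⟩ := O.sub_mem p (n - 2) h (by omega)
      have h1 : V.chi k i = V.chi k t * V.chi k r :=
        V.chi_add hθ hk h𝔞 (by rw [hi, ht, hr]; module)
      have h2 : V.chi k j = V.chi k t * V.chi k s :=
        V.chi_add hθ hk h𝔞 (by rw [hj, ht, hs]; module)
      rw [h1, h2, h0]
    · obtain rfl : p = n - 2 := by omega
      rw [(rootSystem 𝔞).root.injective (hi.trans hr.symm),
        (rootSystem 𝔞).root.injective (hj.trans hs.symm), h0]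
  rcases Nat.lt_or_ge q (n - 1) with h | h
  · obtain ⟨r, -, hr⟩ := O.sub_mem p (n - 1) (by omega) (by omega)
    obtain ⟨s, -, hs⟩ := O.sub_mem q (n - 1) h (by omega)
    obtain ⟨t, -, ht⟩ := O.add_mem q (n - 1) h (by omega)
    have h1 : V.chi k r = V.chi k i * V.chi k s :=
      V.chi_add hθ hk h𝔞 (by rw [hi, hr, hs]; module)
    have h2 : V.chi k j = V.chi k r * V.chi k t :=
      V.chi_add hθ hk h𝔞 (by rw [hj, hr, ht]; module)
    rw [h2, h1, ← key q h s t hs ht, mul_assoc, V.chi_mul_self hθ hk hkK, mul_one]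
  · obtain rfl : q = n - 1 := by omega
    exact key p hpq i j hi hj

/-- The positive roots can be arranged in pairs of roots with the same character of `M`. -/
def HasPairing (V : RootVectors θ 𝔞) (b : (rootSystem 𝔞).Base) : Prop :=
  ∃ (κ : Type) (_ : Fintype κ) (g : κ × Bool ≃ {i // b.IsPos i}), ∀ a (k : 𝔤 ≃ₗ⁅ℝ⁆ 𝔤),
    (∀ H ∈ 𝔞, k H = H) → k ∈ maximalCompact θ → V.chi k (g (a, true)) = V.chi k (g (a, false))

include hθ h𝔞 in
/-- For the short and the long simple root `s` and `l`, the pairs are `l` and `2 s + l`, `s` and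
`3 s + 2 l`, `s + l` and `3 s + l`: the characters are multiplicative with values `± 1`. -/
lemma hasPairing_of_isG2 (hG : (rootSystem 𝔞).IsG2) : HasPairing V b := by
  obtain ⟨i, j, hi, hj, hij, hji⟩ := Base.exists_support_eq_of_isG2 hG b
  let _ : (rootSystem 𝔞).EmbeddedG2 := { long := i, short := j, pairingIn_long_short := hij }
  let P := rootSystem 𝔞
  have e1 : P.root (EmbeddedG2.shortAddLong P) = P.root (EmbeddedG2.short P) +
      P.root (EmbeddedG2.long P) := EmbeddedG2.shortAddLongRoot_eq P
  have a2 : P.root (EmbeddedG2.twoShortAddLong P) = (2 : ℝ) • P.root (EmbeddedG2.short P) +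
      P.root (EmbeddedG2.long P) := EmbeddedG2.twoShortAddLongRoot_eq P
  have a3 : P.root (EmbeddedG2.threeShortAddLong P) = (3 : ℝ) • P.root (EmbeddedG2.short P) +
      P.root (EmbeddedG2.long P) := EmbeddedG2.threeShortAddLongRoot_eq P
  have a4 : P.root (EmbeddedG2.threeShortAddTwoLong P) = (3 : ℝ) • P.root (EmbeddedG2.short P) +
      (2 : ℝ) • P.root (EmbeddedG2.long P) := EmbeddedG2.threeShortAddTwoLongRoot_eq P
  have e2 : P.root (EmbeddedG2.twoShortAddLong P) = P.root (EmbeddedG2.shortAddLong P) +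
      P.root (EmbeddedG2.short P) := by
    rw [a2, e1]; module
  have e3 : P.root (EmbeddedG2.threeShortAddLong P) = P.root (EmbeddedG2.twoShortAddLong P) +
      P.root (EmbeddedG2.short P) := by
    rw [a2, a3]; module
  have e4 : P.root (EmbeddedG2.threeShortAddTwoLong P) = P.root (EmbeddedG2.threeShortAddLong P) +
      P.root (EmbeddedG2.long P) := by
    rw [a3, a4]; module
  have pl : b.IsPos (EmbeddedG2.long P) := b.isPos_of_mem_support hi
  have ps : b.IsPos (EmbeddedG2.short P) := b.isPos_of_mem_support hj
  have p1 := ps.add pl e1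
  have p2 := p1.add ps e2
  have p3 := p2.add ps e3
  have p4 := p3.add pl e4
  let g : Fin 3 × Bool → {i // b.IsPos i} := fun x ↦ match x with
    | (0, true) => ⟨_, pl⟩
    | (0, false) => ⟨_, p2⟩
    | (1, true) => ⟨_, ps⟩
    | (1, false) => ⟨_, p4⟩
    | (2, true) => ⟨_, p1⟩
    | (2, false) => ⟨_, p3⟩
  have hg : Function.Bijective g := by
    constructor
    · -- the pairings with the short simple root are pairwise different
      let c : Fin 3 × Bool → ℤ := fun x ↦ match x with
        | (0, true) => -3
        | (0, false) => 1
        | (1, true) => 2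
        | (1, false) => 0
        | (2, true) => -1
        | (2, false) => 3
      have hc : ∀ x, P.pairingIn ℤ (g x) (EmbeddedG2.short P) = c x := by
        rintro ⟨a, s⟩
        fin_cases a <;> cases s <;> simp [g, c]
      have hinj : Function.Injective c := by decide
      intro x y hxy
      exact hinj (by rw [← hc, ← hc, hxy])
    · rintro ⟨l, hl⟩
      have hmem := EmbeddedG2.mem_allRoots P l
      have hpos : ∀ l', b.IsPos l' → P.root l ≠ -P.root l' := fun l' hl' h ↦
        (b.isPos_iff_of_root_eq_neg h).mp hl hl'
      simp only [EmbeddedG2.allRoots, List.mem_cons, List.not_mem_nil, or_false] at hmem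
      rcases hmem with h | h | h | h | h | h | h | h | h | h | h | h
      · exact ⟨(0, true), Subtype.ext (P.root.injective h.symm)⟩
      · exact absurd h (hpos _ pl)
      · exact ⟨(1, true), Subtype.ext (P.root.injective h.symm)⟩
      · exact absurd h (hpos _ ps)
      · exact ⟨(2, true), Subtype.ext (P.root.injective h.symm)⟩
      · exact absurd h (hpos _ p1)
      · exact ⟨(0, false), Subtype.ext (P.root.injective h.symm)⟩
      · exact absurd h (hpos _ p2)
      · exact ⟨(2, false), Subtype.ext (P.root.injective h.symm)⟩
      · exact absurd h (hpos _ p3)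
      · exact ⟨(1, false), Subtype.ext (P.root.injective h.symm)⟩
      · exact absurd h (hpos _ p4)
  refine ⟨Fin 3, inferInstance, Equiv.ofBijective g hg, fun a k hk hkK ↦ ?_⟩
  have c1 := V.chi_add hθ hk h𝔞 e1
  have c2 := V.chi_add hθ hk h𝔞 e2
  have c3 := V.chi_add hθ hk h𝔞 e3
  have c4 := V.chi_add hθ hk h𝔞 e4
  have sl := V.chi_mul_self hθ hk hkK (EmbeddedG2.long P)
  have ss := V.chi_mul_self hθ hk hkK (EmbeddedG2.short P)
  have c2' : V.chi k (EmbeddedG2.twoShortAddLong P) = V.chi k (EmbeddedG2.long P) := by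
    rw [c2, c1]; linear_combination V.chi k (EmbeddedG2.long P) * ss
  fin_cases a
  · exact c2'.symm
  · change V.chi k (EmbeddedG2.short P) = V.chi k (EmbeddedG2.threeShortAddTwoLong P)
    rw [c4, c3, c2']
    linear_combination -V.chi k (EmbeddedG2.short P) * sl
  · change V.chi k (EmbeddedG2.shortAddLong P) = V.chi k (EmbeddedG2.threeShortAddLong P)
    rw [c3, c2', c1, mul_comm]

include hθ h𝔞 in
/-- The pairs are `e_p - e_q` and `e_p + e_q` and, in the presence of long roots, `2 e_{2p}` and
`2 e_{2p+1}`, for which the rank has to be even. -/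
lemma hasPairing_of_orthFrame (hE : O.IsLong → Even n) : HasPairing V b := by
  obtain ⟨m, hm, hm'⟩ : ∃ m, (0 < m → O.IsLong) ∧ (O.IsLong → n = m + m) := by
    by_cases hl : O.IsLong
    · obtain ⟨m, hm⟩ := hE hl
      exact ⟨m, fun _ ↦ hl, fun _ ↦ hm⟩
    · exact ⟨0, fun h ↦ absurd h (lt_irrefl 0), fun h ↦ absurd h hl⟩
  let κ := {x : Fin n × Fin n // x.1 < x.2} ⊕ Fin m
  let ε : Bool → ℕ := fun s ↦ if s then 1 else 0
  let v : κ × Bool → Module.Dual ℝ 𝔞 := fun x ↦ match x with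
    | (Sum.inl x, true) => O.e x.1.1 - O.e x.1.2
    | (Sum.inl x, false) => O.e x.1.1 + O.e x.1.2
    | (Sum.inr p, s) => (2 : ℝ) • O.e (2 * p + ε s)
  have hε : ∀ (p : Fin m) s, 2 * (p : ℕ) + ε s < n := by
    intro p s
    have h1 := hm' (hm (by have := p.2; omega))
    have h2 : ε s ≤ 1 := by simp only [ε]; split_ifs <;> omega
    have := p.2
    omega
  have hex : ∀ x, ∃ i, b.IsPos i ∧ (rootSystem 𝔞).root i = v x := by
    rintro ⟨x | p, s⟩
    · cases s
      · exact O.add_mem _ _ x.2 x.1.2.2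
      · exact O.sub_mem _ _ x.2 x.1.2.2
    · exact hm (by have := p.2; omega) _ (hε p s)
  choose r hr hr' using hex
  -- the vectors are told apart by their products with the frame
  have hv : Function.Injective v := by
    have hform : ∀ {p t : ℕ}, p < n → t < n →
        F.form (O.e p) (O.e t) = if p = t then 1 else 0 := fun hp ht ↦ O.form_eq hp ht
    rintro ⟨x | p, s⟩ ⟨y | q, s'⟩ hxy
    · obtain ⟨⟨⟨x1, h1⟩, ⟨x2, h2⟩⟩, hx⟩ := x
      obtain ⟨⟨⟨y1, h3⟩, ⟨y2, h4⟩⟩, hy⟩ := y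
      have hx' : x1 < x2 := hx
      have hy' : y1 < y2 := hy
      have k1 := congrArg (fun x ↦ F.form x (O.e x1)) hxy
      have k2 := congrArg (fun x ↦ F.form x (O.e x2)) hxy
      have k3 := congrArg (fun x ↦ F.form x (O.e y1)) hxy
      have k4 := congrArg (fun x ↦ F.form x (O.e y2)) hxy
      have : x1 = y1 ∧ x2 = y2 ∧ s = s' := by
        cases s <;> cases s' <;>
        simp only [v, map_add, map_sub, LinearMap.add_apply, LinearMap.sub_apply, hform, h1, h2,
          h3, h4] at k1 k2 k3 k4 <;> grind
      obtain ⟨rfl, rfl, rfl⟩ := this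
      rfl
    · obtain ⟨⟨⟨x1, h1⟩, ⟨x2, h2⟩⟩, hx⟩ := x
      have hx' : x1 < x2 := hx
      have k1 := congrArg (fun x ↦ F.form x (O.e (2 * (q : ℕ) + ε s'))) hxy
      have h3 := hε q s'
      exfalso
      cases s <;>
      simp only [v, map_add, map_sub, map_smul, LinearMap.add_apply, LinearMap.sub_apply,
        LinearMap.smul_apply, smul_eq_mul, hform, h1, h2, h3] at k1 <;> grind
    · obtain ⟨⟨⟨x1, h1⟩, ⟨x2, h2⟩⟩, hx⟩ := y
      have hx' : x1 < x2 := hx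
      have k1 := congrArg (fun x ↦ F.form x (O.e (2 * (p : ℕ) + ε s))) hxy
      have h3 := hε p s
      exfalso
      cases s' <;>
      simp only [v, map_add, map_sub, map_smul, LinearMap.add_apply, LinearMap.sub_apply,
        LinearMap.smul_apply, smul_eq_mul, hform, h1, h2, h3] at k1 <;> grind
    · have h1 := hε p s
      have h2 := hε q s'
      have k1 := congrArg (fun x ↦ F.form x (O.e (2 * (p : ℕ) + ε s))) hxy
      simp only [v, map_smul, LinearMap.smul_apply, smul_eq_mul, hform, h1, h2] at k1
      have h3 : 2 * (q : ℕ) + ε s' = 2 * (p : ℕ) + ε s := by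
        by_contra hne
        rw [if_pos trivial, if_neg hne] at k1
        norm_num at k1
      have : p = q ∧ s = s' := by
        rw [Fin.ext_iff]
        cases s <;> cases s' <;> simp [ε] at h3 ⊢ <;> omega
      obtain ⟨rfl, rfl⟩ := this
      rfl
  let g : κ × Bool → {i // b.IsPos i} := fun x ↦ ⟨r x, hr x⟩
  have hg : Function.Bijective g := by
    refine ⟨fun x y hxy ↦ hv ?_, fun ⟨i, hi⟩ ↦ ?_⟩
    · rw [← hr' x, ← hr' y, show r x = r y from congrArg Subtype.val hxy]
    · suffices ∃ x, (rootSystem 𝔞).root i = v x by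
        obtain ⟨x, hx⟩ := this
        exact ⟨x, Subtype.ext ((rootSystem 𝔞).root.injective ((hr' x).trans hx.symm))⟩
      rcases O.cases i hi with ⟨p, q, hpq, hq, h | h⟩ | ⟨p, hp, h⟩
      · exact ⟨(Sum.inl ⟨(⟨p, by omega⟩, ⟨q, hq⟩), hpq⟩, true), h⟩
      · exact ⟨(Sum.inl ⟨(⟨p, by omega⟩, ⟨q, hq⟩), hpq⟩, false), h⟩
      · have hl : O.IsLong := by
          rcases O.long with h' | h'
          · exact h'
          · exact absurd h (h' i p hp)
        have hn := hm' hl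
        refine ⟨(Sum.inr ⟨p / 2, by omega⟩, decide (p % 2 = 1)), ?_⟩
        rw [h]
        change (2 : ℝ) • O.e p = (2 : ℝ) • O.e (2 * (p / 2) + ε (decide (p % 2 = 1)))
        congr 2
        simp only [ε, decide_eq_true_eq]
        split_ifs <;> omega
  refine ⟨κ, inferInstance, Equiv.ofBijective g hg, fun a k hk hkK ↦ ?_⟩
  rcases a with x | p
  · exact chi_sub_eq_chi_add O V hθ h𝔞 x.2 x.1.2.2 (hr' _) (hr' _) hk hkK
  · change V.chi k (r (Sum.inr p, true)) = V.chi k (r (Sum.inr p, false))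
    rw [chi_long O V hθ h𝔞 (hε p true) (hr' _) hk hkK,
      chi_long O V hθ h𝔞 (hε p false) (hr' _) hk hkK]

end PairedRoots

end RealFlag

/-! ### Construction of invariant almost complex structures -/

namespace RealFlag

section Existence

variable {𝔤 : Type*} [LieRing 𝔤] [LieAlgebra ℝ 𝔤] [FiniteDimensional ℝ 𝔤]
  [LieAlgebra.IsKilling ℝ 𝔤] {𝔞 : LieSubalgebra ℝ 𝔤} [𝔞.IsCartanSubalgebra]
  [LieModule.IsTriangularizable ℝ 𝔞 𝔤] {θ : 𝔤 ≃ₗ⁅ℝ⁆ 𝔤} {b : (rootSystem 𝔞).Base}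

/-- An endomorphism of `𝔫⁻` that commutes with `M` and has square `-1` extends to an invariant
almost complex structure: at `k M` it is the conjugate by `k`. -/
lemma nonempty_invariantAlmostComplexStructure (J₀ : 𝔤 →ₗ[ℝ] 𝔤)
    (h1 : ∀ v ∈ negSum b, J₀ v ∈ negSum b) (h2 : ∀ v ∈ negSum b, J₀ (J₀ v) = -v)
    (h3 : ∀ m ∈ centralizerM θ 𝔞, ∀ v ∈ negSum b, J₀ (m.1 v) = m.1 (J₀ v)) :
    Nonempty (InvariantAlmostComplexStructure θ b) := by
  let J : MaximalFlag θ 𝔞 → 𝔤 →ₗ[ℝ] 𝔤 := fun x ↦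
    (x.out.1 : 𝔤 →ₗ[ℝ] 𝔤) ∘ₗ J₀ ∘ₗ (x.out.1.symm : 𝔤 →ₗ[ℝ] 𝔤)
  have hJ : ∀ (k : maximalCompact θ) v, v ∈ negSum b →
      J (k : MaximalFlag θ 𝔞) (k.1 v) = k.1 (J₀ v) := by
    intro k v hv
    set l : maximalCompact θ := (k : MaximalFlag θ 𝔞).out with hl
    have hm : l⁻¹ * k ∈ centralizerM θ 𝔞 :=
      QuotientGroup.eq.mp (QuotientGroup.out_eq' (k : MaximalFlag θ 𝔞))
    change l.1 (J₀ ((l⁻¹ * k).1 v)) = k.1 (J₀ v)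
    rw [h3 _ hm v hv]
    exact LieEquiv.apply_symm_apply l.1 _
  have hmem : ∀ x, ∀ v ∈ tangent θ b x, J x v ∈ tangent θ b x := by
    intro x
    induction x using QuotientGroup.induction_on with
    | H k =>
      rintro _ ⟨v, hv, rfl⟩
      exact ⟨J₀ v, h1 v hv, (hJ k v hv).symm⟩
  refine ⟨fun x ↦ (J x).restrict (hmem x), ?_, ?_⟩
  · intro x
    induction x using QuotientGroup.induction_on with
    | H k =>
      rintro ⟨_, ⟨v, hv, rfl⟩⟩
      apply Subtype.ext
      change J k (J k (k.1 v)) = -k.1 v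
      rw [hJ k v hv, hJ k _ (h1 v hv), h2 v hv, map_neg]
  · intro k x
    induction x using QuotientGroup.induction_on with
    | H l =>
      rintro ⟨_, ⟨v, hv, rfl⟩⟩
      apply Subtype.ext
      change J ((k * l : maximalCompact θ) : MaximalFlag θ 𝔞) ((k * l).1 v) = k.1 (J l (l.1 v))
      rw [hJ _ v hv, hJ l v hv]
      rfl

variable (V : RootVectors θ 𝔞) (hθ : IsCartanInvolution θ) (h𝔞 : ∀ H ∈ 𝔞, θ H = -H)

namespace RootVectors

include h𝔞 in
lemma f_mem_negSum {i : 𝔞.root} (hi : b.IsPos i) : V.f i ∈ negSum b :=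
  le_iSup₂_of_le (f := fun (α : 𝔞.root) (_ : b.IsPos α) ↦
    (weightSpace 𝔤 (-(α.1 : 𝔞 → ℝ))).toSubmodule) i hi le_rfl
    ((isWt_neg_iff_mem_weightSpace i).mp (V.f_isWt h𝔞 i))

include hθ h𝔞 in
lemma exists_smul_f {i : 𝔞.root} {v : 𝔤} (hv : IsWt (-(rootSystem 𝔞).root i) v) :
    ∃ c : ℝ, v = c • V.f i := by
  have h1 := hv.theta h𝔞
  rw [neg_neg] at h1
  obtain ⟨c, hc⟩ := h1.exists_smul (V.isWt i) (V.ne_zero i)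
  refine ⟨-c, ?_⟩
  rw [f, smul_neg, neg_smul, neg_neg, ← map_smul, ← hc, hθ.involutive]

include hθ h𝔞 in
lemma negSum_le {S : Submodule ℝ 𝔤} (h : ∀ i, b.IsPos i → V.f i ∈ S) : negSum b ≤ S := by
  refine iSup₂_le fun i hi v hv ↦ ?_
  obtain ⟨c, rfl⟩ := V.exists_smul_f hθ h𝔞 ((isWt_neg_iff_mem_weightSpace i).mpr hv)
  exact S.smul_mem c (h i hi)

include hθ in
lemma apply_f {k : 𝔤 ≃ₗ⁅ℝ⁆ 𝔤} (hk : ∀ H ∈ 𝔞, k H = H) (hkK : k ∈ maximalCompact θ)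
    (i : 𝔞.root) : k (V.f i) = V.chi k i • V.f i := by
  rw [f, map_neg, map_theta_of_maximalCompact hkK, V.apply_eq_chi_smul hθ hk (V.isWt i), map_smul,
    smul_neg]

/-- The coordinate of a vector along a negative root vector. -/
noncomputable def coord (i : 𝔞.root) : 𝔤 →ₗ[ℝ] ℝ where
  toFun v := inn θ (V.f i) v / inn θ (V.f i) (V.f i)
  map_add' v w := by rw [inn_add_right, add_div]
  map_smul' c v := by rw [inn_smul_right, mul_div_assoc]; rfl

include hθ in
lemma coord_self (i : 𝔞.root) : V.coord i (V.f i) = 1 :=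
  div_self (inn_self_pos hθ (V.f_ne_zero i)).ne'

include h𝔞 in
lemma coord_of_ne {i j : 𝔞.root} (h : i ≠ j) : V.coord i (V.f j) = 0 := by
  change inn θ (V.f i) (V.f j) / _ = 0
  rw [inn_eq_zero_of_isWt h𝔞 (V.f_isWt h𝔞 i) (V.f_isWt h𝔞 j), zero_div]
  exact fun h' ↦ h ((rootSystem 𝔞).root.injective (neg_injective h'))

end RootVectors

include hθ h𝔞 in
/-- The complex structure rotates the planes spanned by the root vectors of the pairs. -/
lemma HasPairing.nonempty (h : HasPairing V b) : Nonempty (InvariantAlmostComplexStructure θ b) := by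
  classical
  obtain ⟨κ, _, g, hg⟩ := h
  let J₀ : 𝔤 →ₗ[ℝ] 𝔤 := ∑ a, ((V.coord (g (a, true))).smulRight (V.f (g (a, false))) -
    (V.coord (g (a, false))).smulRight (V.f (g (a, true))))
  have hJ : ∀ v, J₀ v = ∑ a, (V.coord (g (a, true)) v • V.f (g (a, false)) -
      V.coord (g (a, false)) v • V.f (g (a, true))) := by
    intro v
    simp [J₀, LinearMap.sum_apply]
  have hc : ∀ x y, V.coord (g x) (V.f (g y)) = if x = y then 1 else 0 := by
    intro x y
    split_ifs with hxy
    · rw [hxy, V.coord_self hθ]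
    · exact V.coord_of_ne h𝔞 fun h ↦ hxy (g.injective (Subtype.ext h))
  have ht : ∀ a, J₀ (V.f (g (a, true))) = V.f (g (a, false)) := by
    intro a
    rw [hJ, Finset.sum_eq_single_of_mem a (Finset.mem_univ a)]
    · simp [hc]
    · intro a' _ ha'
      simp [hc, ha']
  have hf : ∀ a, J₀ (V.f (g (a, false))) = -V.f (g (a, true)) := by
    intro a
    rw [hJ, Finset.sum_eq_single_of_mem a (Finset.mem_univ a)]
    · simp [hc]
    · intro a' _ ha'
      simp [hc, ha']
  have hpos : ∀ {S : Submodule ℝ 𝔤}, (∀ a, V.f (g (a, true)) ∈ S) →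
      (∀ a, V.f (g (a, false)) ∈ S) → negSum b ≤ S := by
    intro S h1 h2
    refine V.negSum_le hθ h𝔞 fun i hi ↦ ?_
    obtain ⟨⟨a, s⟩, hx⟩ := g.surjective ⟨i, hi⟩
    rw [show i = g (a, s) by rw [hx]]
    cases s
    · exact h2 a
    · exact h1 a
  refine nonempty_invariantAlmostComplexStructure J₀ ?_ ?_ ?_
  · intro v hv
    refine hpos (S := (negSum b).comap J₀) (fun a ↦ ?_) (fun a ↦ ?_) hv
    · change J₀ (V.f (g (a, true))) ∈ negSum b
      rw [ht]
      exact V.f_mem_negSum h𝔞 (g (a, false)).2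
    · change J₀ (V.f (g (a, false))) ∈ negSum b
      rw [hf]
      exact neg_mem (V.f_mem_negSum h𝔞 (g (a, true)).2)
  · intro v hv
    refine hpos (S := LinearMap.eqLocus (J₀ ∘ₗ J₀) (-LinearMap.id)) (fun a ↦ ?_) (fun a ↦ ?_) hv
    · change J₀ (J₀ _) = -_
      rw [ht, hf]
      rfl
    · change J₀ (J₀ _) = -_
      rw [hf, map_neg, ht]
      rfl
  · intro m hm v hv
    have hmf := V.apply_f hθ hm m.2
    have hm' := fun a ↦ hg a m.1 hm m.2
    refine hpos (S := LinearMap.eqLocus (J₀ ∘ₗ (m.1 : 𝔤 →ₗ[ℝ] 𝔤)) ((m.1 : 𝔤 →ₗ[ℝ] 𝔤) ∘ₗ J₀))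
      (fun a ↦ ?_) (fun a ↦ ?_) hv
    · change J₀ (m.1 _) = m.1 (J₀ _)
      rw [hmf, map_smul, ht, hmf, hm']
    · change J₀ (m.1 _) = m.1 (J₀ _)
      rw [hmf, map_smul, hf, map_neg, hmf, hm', smul_neg]

end Existence

end RealFlag

/-! ### The restriction on the root system -/

namespace RealFlag

section Converse

variable {𝔤 : Type*} [LieRing 𝔤] [LieAlgebra ℝ 𝔤] [FiniteDimensional ℝ 𝔤]
  [LieAlgebra.IsKilling ℝ 𝔤] {𝔞 : LieSubalgebra ℝ 𝔤} [𝔞.IsCartanSubalgebra]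
  [LieModule.IsTriangularizable ℝ 𝔞 𝔤] {θ : 𝔤 ≃ₗ⁅ℝ⁆ 𝔤} {b : (rootSystem 𝔞).Base}

/-- An endomorphism of `𝔤` restricts to an `M`-equivariant complex structure on `𝔫⁻`. Working with
endomorphisms of the whole of `𝔤` avoids coercions from `𝔫⁻`. -/
structure IsComplexStructure (θ : 𝔤 ≃ₗ⁅ℝ⁆ 𝔤) (b : (rootSystem 𝔞).Base) (A : 𝔤 →ₗ[ℝ] 𝔤) : Prop where
  map_mem : ∀ v ∈ negSum b, A v ∈ negSum b
  sq : ∀ v ∈ negSum b, A (A v) = -v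
  comm : ∀ m ∈ centralizerM θ 𝔞, ∀ v ∈ negSum b, A (m.1 v) = m.1 (A v)

/-- The value at the origin of an invariant almost complex structure, extended to `𝔤`. -/
lemma InvariantAlmostComplexStructure.exists_isComplexStructure
    (𝒥 : InvariantAlmostComplexStructure θ b) :
    ∃ A : 𝔤 →ₗ[ℝ] 𝔤, IsComplexStructure θ b A ∧ ∀ X : nMinus b, A X = 𝒥.atOrigin X := by
  have hmem : ∀ v, v ∈ negSum b ↔ v ∈ tangent θ b (origin θ 𝔞) := by
    intro v
    rw [tangent_origin]
    rfl
  obtain ⟨A, hA⟩ := LinearMap.exists_extend ((nMinus b).toSubmodule.subtype ∘ₗ 𝒥.atOrigin)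
  have hA' : ∀ X : nMinus b, A X = 𝒥.atOrigin X := fun X ↦ LinearMap.congr_fun hA X
  have hJ : ∀ v (hv : v ∈ tangent θ b (origin θ 𝔞)), A v = 𝒥.J (origin θ 𝔞) ⟨v, hv⟩ :=
    fun v hv ↦ hA' ⟨v, (hmem v).mpr hv⟩
  have hcongr : ∀ (x y : MaximalFlag θ 𝔞), x = y → ∀ (v : tangent θ b x) (w : tangent θ b y),
      (v : 𝔤) = w → (𝒥.J x v : 𝔤) = 𝒥.J y w := by
    rintro x _ rfl v w h
    rw [Subtype.ext h]
  refine ⟨A, ⟨fun v hv ↦ ?_, fun v hv ↦ ?_, fun m hm v hv ↦ ?_⟩, hA'⟩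
  · rw [hA' ⟨v, hv⟩]
    exact (𝒥.atOrigin ⟨v, hv⟩).2
  · rw [hJ v ((hmem v).mp hv), hJ _ (Subtype.prop _), Subtype.coe_eta, 𝒥.sq]
    rfl
  · have hv' := (hmem v).mp hv
    have h1 : m • origin θ 𝔞 = origin θ 𝔞 := by
      refine QuotientGroup.eq.mpr ?_
      simpa using hm
    have h2 := congrArg Subtype.val (𝒥.invariant m (origin θ 𝔞) ⟨v, hv'⟩)
    rw [hJ v hv', hJ _ ((hmem _).mp (map_mem_negSum b hm hv))]
    exact (hcongr _ _ h1 _ _ rfl).symm.trans h2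

variable (V : RootVectors θ 𝔞) (hθ : IsCartanInvolution θ) (h𝔞 : ∀ H ∈ 𝔞, θ H = -H)
  {A : 𝔤 →ₗ[ℝ] 𝔤}

namespace RootVectors

include hθ h𝔞 in
lemma eq_sum_coord {v : 𝔤} (hv : v ∈ negSum b) {s : Finset 𝔞.root} (hs : ∀ j ∈ s, b.IsPos j)
    (h : ∀ j, b.IsPos j → V.coord j v ≠ 0 → j ∈ s) : v = ∑ j ∈ s, V.coord j v • V.f j := by
  classical
  have key : negSum b ≤ LinearMap.eqLocus LinearMap.id
      (∑ j ∈ Finset.univ.filter b.IsPos, (V.coord j).smulRight (V.f j)) := by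
    refine V.negSum_le hθ h𝔞 fun i hi ↦ ?_
    change V.f i = _
    rw [LinearMap.sum_apply, Finset.sum_eq_single_of_mem i (by simpa using hi)]
    · simp [V.coord_self hθ]
    · intro j _ hj
      simp [V.coord_of_ne h𝔞 hj]
  have h1 : v = _ := key hv
  rw [LinearMap.sum_apply] at h1
  refine h1.trans (Finset.sum_subset (fun j hj ↦ by simpa using hs j hj) ?_).symm
  intro j hj hjs
  have : V.coord j v = 0 := by
    by_contra h0
    exact hjs (h j (by simpa using hj) h0)
  simp [this]

include hθ h𝔞 in
lemma mem_span_f {v : 𝔤} (hv : v ∈ negSum b) {s : Set 𝔞.root}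
    (h : ∀ j, b.IsPos j → V.coord j v ≠ 0 → j ∈ s) : v ∈ Submodule.span ℝ (V.f '' s) := by
  classical
  rw [V.eq_sum_coord hθ h𝔞 hv (s := Finset.univ.filter fun j ↦ b.IsPos j ∧ V.coord j v ≠ 0)
    (fun j hj ↦ (Finset.mem_filter.mp hj).2.1)
    (fun j h1 h2 ↦ Finset.mem_filter.mpr ⟨Finset.mem_univ _, h1, h2⟩)]
  refine Submodule.sum_mem _ fun j hj ↦ Submodule.smul_mem _ _ (Submodule.subset_span ⟨j, ?_, rfl⟩)
  have := (Finset.mem_filter.mp hj).2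
  exact h j this.1 this.2

include hθ h𝔞 in
lemma coord_apply {k : 𝔤 ≃ₗ⁅ℝ⁆ 𝔤} (hk : ∀ H ∈ 𝔞, k H = H) (hkK : k ∈ maximalCompact θ)
    (j : 𝔞.root) {v : 𝔤} (hv : v ∈ negSum b) : V.coord j (k v) = V.chi k j * V.coord j v := by
  have key : negSum b ≤ LinearMap.eqLocus (V.coord j ∘ₗ (k : 𝔤 →ₗ[ℝ] 𝔤))
      (V.chi k j • V.coord j) := by
    refine V.negSum_le hθ h𝔞 fun i _ ↦ ?_
    change V.coord j (k (V.f i)) = V.chi k j * V.coord j (V.f i)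
    rw [V.apply_f hθ hk hkK, map_smul, smul_eq_mul]
    rcases eq_or_ne j i with rfl | hji
    · rfl
    · rw [V.coord_of_ne h𝔞 hji, mul_zero, mul_zero]
  exact key hv

include hθ h𝔞 in
lemma chi_m {l : 𝔞.root} (h2 : ∀ j, |(rootSystem 𝔞).pairingIn ℤ j l| ≤ 2) (i : 𝔞.root) :
    V.chi (V.m l) i = (-1 : ℝ) ^ (rootSystem 𝔞).pairingIn ℤ i l :=
  V.chi_eq hθ (V.m_mem_centralizerM hθ h𝔞 l) (V.isWt i) (V.ne_zero i)
    (V.m_apply_of_isWt hθ h𝔞 h2 (V.isWt i))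

end RootVectors

namespace IsComplexStructure

include hθ h𝔞 in
/-- By Schur's lemma, a complex structure does not mix root spaces on which `M` acts differently. -/
lemma coord_eq_zero (hA : IsComplexStructure θ b A) {i : 𝔞.root} (hi : b.IsPos i) (j : 𝔞.root)
    {l : 𝔞.root} (h2 : ∀ j, |(rootSystem 𝔞).pairingIn ℤ j l| ≤ 2)
    (h : ¬ Even ((rootSystem 𝔞).pairingIn ℤ i l - (rootSystem 𝔞).pairingIn ℤ j l)) :
    V.coord j (A (V.f i)) = 0 := by
  have hl := V.m_mem_centralizerM hθ h𝔞 l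
  have hf := V.f_mem_negSum (b := b) h𝔞 hi
  have h3 := hA.comm ⟨V.m l, V.m_mem hθ l⟩ hl _ hf
  have h4 := congrArg (V.coord j) h3
  dsimp only at h4
  rw [V.apply_f hθ hl (V.m_mem hθ l), map_smul, map_smul,
    V.coord_apply hθ h𝔞 hl (V.m_mem hθ l) j (hA.map_mem _ hf), V.chi_m hθ h𝔞 h2,
    V.chi_m hθ h𝔞 h2, smul_eq_mul] at h4
  rcases Int.even_or_odd ((rootSystem 𝔞).pairingIn ℤ i l) with ha | ha <;>
  rcases Int.even_or_odd ((rootSystem 𝔞).pairingIn ℤ j l) with hb | hb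
  · exact absurd (ha.sub hb) h
  · rw [ha.neg_one_zpow, hb.neg_one_zpow] at h4
    linarith
  · rw [ha.neg_one_zpow, hb.neg_one_zpow] at h4
    linarith
  · exact absurd (ha.sub_odd hb) h

include hθ h𝔞 in
/-- If all pairings of roots are at most `2`, a complex structure preserves the spans of the
congruence classes of roots. -/
lemma congr_of_coord_ne_zero (hA : IsComplexStructure θ b A)
    (h2 : ∀ i j, |(rootSystem 𝔞).pairingIn ℤ i j| ≤ 2) {i j : 𝔞.root} (hi : b.IsPos i)
    (h : V.coord j (A (V.f i)) ≠ 0) : (rootSystem 𝔞).Congr i j := by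
  intro l
  by_contra h'
  exact h (hA.coord_eq_zero V hθ h𝔞 hi j (fun j ↦ h2 j l) h')

include hθ h𝔞 in
/-- A complex structure restricts to the spans of the congruence classes of positive roots, so
that these classes have even size. -/
lemma evenClasses (hA : IsComplexStructure θ b A)
    (h2 : ∀ i j, |(rootSystem 𝔞).pairingIn ℤ i j| ≤ 2) : RootPairing.EvenClasses b := by
  classical
  obtain ⟨V⟩ := exists_rootVectors hθ h𝔞
  intro i hi
  set s : Finset 𝔞.root :=
    Finset.univ.filter fun j ↦ b.IsPos j ∧ (rootSystem 𝔞).Congr i j with hs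
  have hpos : ∀ j ∈ s, b.IsPos j := fun j hj ↦ (Finset.mem_filter.mp hj).2.1
  have hcard : Nat.card {j // b.IsPos j ∧ (rootSystem 𝔞).Congr i j} = Fintype.card s := by
    rw [Fintype.card_coe, Nat.card_eq_fintype_card, Fintype.card_subtype]
  let B : Matrix s s ℝ := Matrix.of fun j l ↦ V.coord j.1 (A (V.f l.1))
  have hB : B * B = -1 := by
    ext j l
    have hl := V.f_mem_negSum (b := b) h𝔞 (hpos l l.2)
    have h1 := V.eq_sum_coord hθ h𝔞 (hA.map_mem _ hl) hpos (fun k hk hk0 ↦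
      Finset.mem_filter.mpr ⟨Finset.mem_univ _, hk, (Finset.mem_filter.mp l.2).2.2.trans
        (hA.congr_of_coord_ne_zero V hθ h𝔞 h2 (hpos l l.2) hk0)⟩)
    have h3 := congrArg (fun v ↦ V.coord j.1 (A v)) h1
    beta_reduce at h3
    rw [hA.sq _ hl, map_neg, map_sum, map_sum] at h3
    rw [Matrix.mul_apply, Matrix.neg_apply, Matrix.one_apply]
    have h4 : V.coord j.1 (V.f l.1) = if j = l then 1 else 0 := by
      split_ifs with hjl
      · rw [hjl, V.coord_self hθ]
      · exact V.coord_of_ne h𝔞 fun h ↦ hjl (Subtype.ext h)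
    rw [← h4, h3, ← Finset.sum_coe_sort s]
    refine Finset.sum_congr rfl fun k _ ↦ ?_
    rw [map_smul, map_smul, smul_eq_mul, mul_comm]
    rfl
  -- a real matrix of odd size does not have square `-1`
  have hdet : B.det * B.det = (-1) ^ Fintype.card s := by
    rw [← Matrix.det_mul, hB, Matrix.det_neg, Matrix.det_one, mul_one]
  rw [hcard]
  by_contra hodd
  rw [(Nat.not_even_iff_odd.mp hodd).neg_one_pow] at hdet
  nlinarith [mul_self_nonneg B.det]

include hθ h𝔞 in
lemma admissible [(rootSystem 𝔞).IsIrreducible] (hA : IsComplexStructure θ b A) :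
    RootPairing.Admissible b := by
  by_cases hG : (rootSystem 𝔞).IsG2
  · exact Or.inl hG
  have hne : Nonempty 𝔞.root := by
    have := RootPairing.IsIrreducible.nontrivial (rootSystem 𝔞)
    by_contra h
    rw [not_nonempty_iff] at h
    have h1 := RootPairing.IsRootSystem.span_root_eq_top (P := rootSystem 𝔞)
    rw [Set.range_eq_empty, Submodule.span_empty] at h1
    exact bot_ne_top h1
  obtain ⟨F, -, -⟩ := RootPairing.exists_normForm ((RootPairing.not_isG2_iff_isNotG2 _).mp hG)
  exact RootPairing.admissible_of_evenClasses
    (hA.evenClasses hθ h𝔞 fun i j ↦ RootPairing.NormForm.abs_pairingIn_le_two F i j)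

end IsComplexStructure

end Converse

end RealFlag

/-! ### Integrable structures and descending filtrations -/

namespace RealFlag

section Salamon

variable {L : Type*} [LieRing L] [LieAlgebra ℝ L]

/-- An integrable complex structure `A` on a Lie algebra `N 1` with a descending filtration: if the
second step of the filtration, which is assumed to consist of sums of brackets, generates the
algebra under `A`, then so does every step. -/
lemma le_sup_map_of_integrable {N : ℕ → Submodule ℝ L} {A : L →ₗ[ℝ] L}
    (hanti : ∀ k, N (k + 1) ≤ N k)
    (hlie : ∀ k, ∀ x ∈ N 1, ∀ y ∈ N k, ⁅x, y⁆ ∈ N (k + 1))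
    (hgen : N 2 ≤ Submodule.span ℝ {z | ∃ x ∈ N 1, ∃ y ∈ N 1, ⁅x, y⁆ = z})
    (hA : ∀ x ∈ N 1, A x ∈ N 1) (hsq : ∀ x ∈ N 1, A (A x) = -x)
    (hN : ∀ x ∈ N 1, ∀ y ∈ N 1, ⁅A x, A y⁆ - ⁅x, y⁆ - A ⁅A x, y⁆ - A ⁅x, A y⁆ = 0)
    (h1 : N 1 ≤ N 2 ⊔ (N 2).map A) (k : ℕ) : N 1 ≤ N (k + 2) ⊔ (N (k + 2)).map A := by
  have hle : ∀ k, N (k + 1) ≤ N 1 := by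
    intro k
    induction k with
    | zero => exact le_rfl
    | succ k ih => exact (hanti _).trans ih
  induction k with
  | zero => exact h1
  | succ k ih =>
    set T := N (k + 3) ⊔ (N (k + 3)).map A with hT
    have hl : N (k + 3) ≤ T := le_sup_left
    have hr : ∀ z ∈ N (k + 3), A z ∈ T := fun z hz ↦ le_sup_right (a := N (k + 3)) ⟨z, hz, rfl⟩
    have hAT : T ≤ T.comap A := by
      refine sup_le hr ?_
      rintro _ ⟨z, hz, rfl⟩
      change A (A z) ∈ T
      rw [hsq z (hle _ hz)]
      exact neg_mem (hl hz)
    have h2 : N 2 ≤ T := by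
      refine hgen.trans (Submodule.span_le.mpr ?_)
      rintro _ ⟨x, hx, y, hy, rfl⟩
      obtain ⟨x₁, hx₁, _, ⟨x₂, hx₂, rfl⟩, rfl⟩ := Submodule.mem_sup.mp (ih hx)
      obtain ⟨y₁, hy₁, _, ⟨y₂, hy₂, rfl⟩, rfl⟩ := Submodule.mem_sup.mp (ih hy)
      have hx₁' := hle _ hx₁
      have hx₂' := hle _ hx₂
      have hy₁' := hle _ hy₁
      have hy₂' := hle _ hy₂
      have hlie' : ∀ x ∈ N (k + 2), ∀ y ∈ N 1, ⁅x, y⁆ ∈ N (k + 3) := by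
        intro x hx y hy
        rw [← lie_skew]
        exact neg_mem (hlie _ _ hy _ hx)
      have h3 : ⁅A x₂, A y₂⁆ = ⁅x₂, y₂⁆ + A ⁅A x₂, y₂⁆ + A ⁅x₂, A y₂⁆ := by
        rw [← sub_eq_zero, ← hN _ hx₂' _ hy₂']
        abel
      rw [add_lie, lie_add, lie_add, h3]
      exact T.add_mem (T.add_mem (hl (hlie' _ hx₁ _ hy₁')) (hl (hlie' _ hx₁ _ (hA _ hy₂'))))
        (T.add_mem (hl (hlie _ _ (hA _ hx₂') _ hy₁)) (T.add_mem (T.add_mem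
          (hl (hlie' _ hx₂ _ hy₂')) (hr _ (hlie _ _ (hA _ hx₂') _ hy₂)))
          (hr _ (hlie' _ hx₂ _ (hA _ hy₂')))))
    exact h1.trans (sup_le h2 ((Submodule.map_mono h2).trans (Submodule.map_le_iff_le_comap.mpr hAT)))

end Salamon

end RealFlag

/-! ### Non-integrability in types `C` and `G₂` -/

namespace RealFlag

section Brackets

variable {𝔤 : Type*} [LieRing 𝔤] [LieAlgebra ℝ 𝔤] [FiniteDimensional ℝ 𝔤]
  [LieAlgebra.IsKilling ℝ 𝔤] {𝔞 : LieSubalgebra ℝ 𝔤} [𝔞.IsCartanSubalgebra]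
  [LieModule.IsTriangularizable ℝ 𝔞 𝔤] {θ : 𝔤 ≃ₗ⁅ℝ⁆ 𝔤} {b : (rootSystem 𝔞).Base}
  (V : RootVectors θ 𝔞) (hθ : IsCartanInvolution θ) (h𝔞 : ∀ H ∈ 𝔞, θ H = -H)
  {A : 𝔤 →ₗ[ℝ] 𝔤}

namespace RootVectors

lemma lie_f (i j : 𝔞.root) : ⁅V.f i, V.f j⁆ = θ ⁅V.e i, V.e j⁆ := by
  rw [f, f, neg_lie, lie_neg, neg_neg, LieEquiv.map_lie]

lemma exists_root_of_lie_f_ne_zero {i j : 𝔞.root} (hi : b.IsPos i) (hj : b.IsPos j)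
    (h : ⁅V.f i, V.f j⁆ ≠ 0) :
    ∃ k, (rootSystem 𝔞).root k = (rootSystem 𝔞).root i + (rootSystem 𝔞).root j := by
  have h1 := (V.isWt i).lie (V.isWt j)
  refine h1.exists_root (fun h0 ↦ h ?_) fun h0 ↦ ?_
  · rw [V.lie_f, h0, map_zero]
  · exact (b.isPos_iff_of_root_eq_neg (eq_neg_of_add_eq_zero_left h0)).mp hi hj

include hθ h𝔞 in
lemma exists_lie_f {i j k : 𝔞.root}
    (hk : (rootSystem 𝔞).root k = (rootSystem 𝔞).root i + (rootSystem 𝔞).root j) :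
    ∃ c : ℝ, c ≠ 0 ∧ ⁅V.f i, V.f j⁆ = c • V.f k := by
  have h0 := lie_ne_zero hθ h𝔞 (V.isWt i) (V.isWt j) (V.ne_zero i) (V.ne_zero j) hk
  have h1 := (V.isWt i).lie (V.isWt j)
  rw [← hk] at h1
  obtain ⟨c, hc⟩ := h1.exists_smul (V.isWt k) (V.ne_zero k)
  refine ⟨-c, fun h ↦ h0 ?_, ?_⟩
  · rw [hc, neg_eq_zero.mp h, zero_smul]
  · rw [V.lie_f, hc, map_smul, f, smul_neg, neg_smul, neg_neg]

end RootVectors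

end Brackets

end RealFlag

namespace RootPairing.Base

variable {ι M N : Type*} [Finite ι] [AddCommGroup M] [Module ℝ M] [AddCommGroup N] [Module ℝ N]
  {P : RootPairing ι ℝ M N} [P.IsRootSystem] [P.IsCrystallographic] [P.IsReduced] {b : P.Base}

omit [P.IsRootSystem] in
lemma two_le_height {i : ι} (hi : b.IsPos i) (hs : i ∉ b.support) : 2 ≤ b.height i := by
  obtain ⟨j, k, hj, hk, h⟩ := b.exists_root_eq_add hi hs
  have h1 := b.height_add h
  have h2 := b.height_one_of_mem_support hk
  have h3 : 0 < b.height j := hj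
  omega

end RootPairing.Base

namespace RealFlag

section Generic

variable {𝔤 : Type*} [LieRing 𝔤] [LieAlgebra ℝ 𝔤] [FiniteDimensional ℝ 𝔤]
  [LieAlgebra.IsKilling ℝ 𝔤] {𝔞 : LieSubalgebra ℝ 𝔤} [𝔞.IsCartanSubalgebra]
  [LieModule.IsTriangularizable ℝ 𝔞 𝔤] {θ : 𝔤 ≃ₗ⁅ℝ⁆ 𝔤} {b : (rootSystem 𝔞).Base}
  (hθ : IsCartanInvolution θ) (h𝔞 : ∀ H ∈ 𝔞, θ H = -H)
  {A : 𝔤 →ₗ[ℝ] 𝔤}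

include hθ h𝔞 in
/-- If `M` acts by different characters on the root spaces of the simple roots, then a complex
structure preserves them up to `[𝔫⁻, 𝔫⁻]`. As it does not have real eigenvalues, `𝔫⁻` is the sum of
`[𝔫⁻, 𝔫⁻]` and its image, which is impossible for an integrable `A`. -/
lemma IsComplexStructure.not_integrable_of_separated (hA : IsComplexStructure θ b A)
    {i₀ : 𝔞.root} (hi₀ : b.IsPos i₀)
    (hsep : ∀ i ∈ b.support, ∀ j ∈ b.support, i ≠ j → ∃ l,
      (∀ k, |(rootSystem 𝔞).pairingIn ℤ k l| ≤ 2) ∧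
      ¬ Even ((rootSystem 𝔞).pairingIn ℤ i l - (rootSystem 𝔞).pairingIn ℤ j l)) :
    ¬ ∀ x ∈ negSum b, ∀ y ∈ negSum b,
      ⁅A x, A y⁆ - ⁅x, y⁆ - A ⁅A x, y⁆ - A ⁅x, A y⁆ = 0 := by
  intro hN
  obtain ⟨V⟩ := exists_rootVectors hθ h𝔞
  -- the filtration by height, which is the descending central series of `𝔫⁻`
  let N : ℕ → Submodule ℝ 𝔤 := fun k ↦ Submodule.span ℝ (V.f '' {j | b.IsPos j ∧ k ≤ b.height j})
  have hN1 : N 1 = negSum b := by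
    refine le_antisymm (Submodule.span_le.mpr ?_) (V.negSum_le hθ h𝔞 fun i hi ↦ ?_)
    · rintro _ ⟨j, ⟨hj, -⟩, rfl⟩
      exact V.f_mem_negSum h𝔞 hj
    · exact Submodule.subset_span ⟨i, ⟨hi, by have : 0 < b.height i := hi; push_cast; omega⟩, rfl⟩
  have hanti : ∀ k, N (k + 1) ≤ N k := fun k ↦ Submodule.span_mono (Set.image_mono fun j hj ↦
    ⟨hj.1, by have := hj.2; push_cast at this; omega⟩)
  have hlie : ∀ k, ∀ x ∈ N 1, ∀ y ∈ N k, ⁅x, y⁆ ∈ N (k + 1) := by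
    intro k x hx y hy
    induction hx using Submodule.span_induction with
    | zero => rw [zero_lie]; exact zero_mem _
    | add x x' _ _ h h' => rw [add_lie]; exact add_mem h h'
    | smul c x _ h => rw [smul_lie]; exact Submodule.smul_mem _ _ h
    | mem x hx =>
      obtain ⟨i, ⟨hi, hi'⟩, rfl⟩ := hx
      induction hy using Submodule.span_induction with
      | zero => rw [lie_zero]; exact zero_mem _
      | add y y' _ _ h h' => rw [lie_add]; exact add_mem h h'
      | smul c y _ h => rw [lie_smul]; exact Submodule.smul_mem _ _ h
      | mem y hy =>
        obtain ⟨j, ⟨hj, hj'⟩, rfl⟩ := hy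
        by_cases h0 : ⁅V.f i, V.f j⁆ = 0
        · rw [h0]; exact zero_mem _
        obtain ⟨l, hl⟩ := V.exists_root_of_lie_f_ne_zero hi hj h0
        obtain ⟨c, -, hc⟩ := V.exists_lie_f hθ h𝔞 hl
        rw [hc]
        refine Submodule.smul_mem _ _ (Submodule.subset_span ⟨l, ⟨hi.add hj hl, ?_⟩, rfl⟩)
        rw [b.height_add hl]
        push_cast at hi' hj' ⊢
        omega
  have hgen : N 2 ≤ Submodule.span ℝ {z | ∃ x ∈ N 1, ∃ y ∈ N 1, ⁅x, y⁆ = z} := by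
    refine Submodule.span_le.mpr ?_
    rintro _ ⟨j, ⟨hj, hj'⟩, rfl⟩
    have hjs : j ∉ b.support := by
      intro h
      rw [b.height_one_of_mem_support h] at hj'
      norm_num at hj'
    obtain ⟨i, k, hi, hk, hik⟩ := b.exists_root_eq_add hj hjs
    obtain ⟨c, hc0, hc⟩ := V.exists_lie_f hθ h𝔞 hik
    have hfk := V.f_mem_negSum (b := b) h𝔞 (RootPairing.Base.isPos_of_mem_support hk)
    rw [← inv_smul_smul₀ hc0 (V.f j), ← hc]
    exact Submodule.smul_mem _ _ (Submodule.subset_span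
      ⟨_, hN1 ▸ V.f_mem_negSum h𝔞 hi, _, hN1 ▸ hfk, rfl⟩)
  have h1 : N 1 ≤ N 2 ⊔ (N 2).map A := by
    rw [hN1]
    refine V.negSum_le hθ h𝔞 fun i hi ↦ ?_
    by_cases his : i ∈ b.support
    · set c := V.coord i (A (V.f i)) with hc
      set d := A (V.f i) - c • V.f i with hd
      have hf := V.f_mem_negSum (b := b) h𝔞 hi
      have hdN : d ∈ N 2 := by
        refine V.mem_span_f hθ h𝔞 (b := b)
          (sub_mem (hA.map_mem _ hf) (Submodule.smul_mem _ _ hf)) fun j hj hj0 ↦ ⟨hj, ?_⟩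
        refine RootPairing.Base.two_le_height hj fun hjs ↦ hj0 ?_
        rw [map_sub, map_smul, smul_eq_mul]
        rcases eq_or_ne j i with rfl | hji
        · rw [V.coord_self hθ, mul_one, sub_self]
        · obtain ⟨l, h2, hl⟩ := hsep i his j hjs hji.symm
          rw [hA.coord_eq_zero V hθ h𝔞 hi j h2 hl, V.coord_of_ne h𝔞 hji, mul_zero, sub_zero]
      have h3 : A (V.f i) = c • V.f i + d := by rw [hd]; abel
      have h4 := hA.sq _ hf
      rw [h3, map_add, map_smul, h3] at h4
      -- solve `A (c f + d) = -f` for `f = V.f i`, where `A f = c f + d`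
      have hc1 : (1 + c ^ 2) ≠ 0 := by positivity
      have h5 : V.f i = (1 + c ^ 2)⁻¹ • (-(c • d) + A (-d)) := by
        rw [eq_inv_smul_iff₀ hc1, map_neg]
        linear_combination (norm := module) h4
      rw [h5]
      exact Submodule.smul_mem _ _ (Submodule.add_mem_sup (neg_mem (Submodule.smul_mem _ _ hdN))
        ⟨_, neg_mem hdN, rfl⟩)
    · exact le_sup_left (a := N 2) (Submodule.subset_span
        ⟨i, ⟨hi, RootPairing.Base.two_le_height hi his⟩, rfl⟩)
  -- the heights are bounded
  have : Nonempty 𝔞.root := ⟨i₀⟩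
  obtain ⟨i₁, hi₁⟩ := Finite.exists_max (b.height)
  have := le_sup_map_of_integrable hanti hlie hgen (hN1 ▸ hA.map_mem) (hN1 ▸ hA.sq) (hN1 ▸ hN) h1
    (b.height i₁).toNat
  have hbot : N ((b.height i₁).toNat + 2) = ⊥ := by
    rw [Submodule.span_eq_bot]
    rintro _ ⟨j, ⟨hj, hj'⟩, rfl⟩
    have h2 := hi₁ j
    push_cast at hj'
    omega
  rw [hbot, Submodule.map_bot, sup_bot_eq, hN1] at this
  exact V.f_ne_zero i₀ (by simpa using this (V.f_mem_negSum h𝔞 hi₀))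

include hθ h𝔞 in
/-- The pairings with the long roots `2 e_p`, which are the coordinates along the frame, separate the
simple roots. -/
lemma IsComplexStructure.not_integrable_of_isLong (hA : IsComplexStructure θ b A)
    {F : (rootSystem 𝔞).NormForm} {n : ℕ} (O : RootPairing.OrthFrame F b n) (hl : O.IsLong) :
    ¬ ∀ x ∈ negSum b, ∀ y ∈ negSum b,
      ⁅A x, A y⁆ - ⁅x, y⁆ - A ⁅A x, y⁆ - A ⁅x, A y⁆ = 0 := by
  have hn := O.two_le
  obtain ⟨i₀, hi₀, -⟩ := O.sub_mem 0 1 (by omega) (by omega)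
  refine hA.not_integrable_of_separated hθ h𝔞 hi₀ fun i hi j hj hij ↦ ?_
  obtain ⟨g, hg⟩ := O.exists_equiv
  have hne : (g ⟨i, hi⟩ : ℕ) ≠ g ⟨j, hj⟩ := fun h ↦
    hij (congrArg Subtype.val (g.injective (Fin.ext h)))
  have hgi : (rootSystem 𝔞).root i = _ := hg ⟨i, hi⟩
  have hgj : (rootSystem 𝔞).root j = _ := hg ⟨j, hj⟩
  -- the pairing with the long root `2 e_p` is the coordinate along `e_p`
  have key : ∀ p q : ℕ, p < q → q < n → ∃ l,
      ∀ i j, (rootSystem 𝔞).root i = O.simple p → (rootSystem 𝔞).root j = O.simple q →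
        (rootSystem 𝔞).pairingIn ℤ i l = 1 ∧ (rootSystem 𝔞).pairingIn ℤ j l = 0 := by
    intro p q hpq hq
    obtain ⟨l, -, hl'⟩ := hl p (by omega)
    have hp := O.form_self p (by omega)
    have hpair : ∀ i, ((rootSystem 𝔞).pairingIn ℤ i l : ℝ) =
        F.form ((rootSystem 𝔞).root i) (O.e p) := by
      intro i
      have h1 := F.pairing_mul i l
      rw [← (rootSystem 𝔞).algebraMap_pairingIn ℤ, algebraMap_int_eq, eq_intCast, hl'] at h1
      simp only [map_smul, LinearMap.smul_apply, smul_eq_mul, hp] at h1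
      linarith
    refine ⟨l, fun i j hi hj ↦ ⟨?_, ?_⟩⟩
    · have h1 := hpair i
      rw [hi, O.simple_lt (by omega), map_sub, LinearMap.sub_apply, hp,
        O.form_ne (p + 1) (by omega) p (by omega) (by omega), sub_zero] at h1
      exact_mod_cast h1
    · have h1 := hpair j
      have h2 : F.form (O.simple q) (O.e p) = 0 := by
        rcases lt_or_ge (q + 1) n with hq' | hq'
        · rw [O.simple_lt hq', map_sub, LinearMap.sub_apply,
            O.form_ne (q + 1) hq' p (by omega) (by omega), O.form_ne q hq p (by omega) (by omega),
            sub_zero]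
        · obtain rfl : q = n - 1 := by omega
          rw [O.simple_last_of_isLong hl, map_smul, LinearMap.smul_apply,
            O.form_ne (n - 1) hq p (by omega) (by omega), smul_zero]
      rw [hj, h2] at h1
      exact_mod_cast h1
  have h2 := fun l k ↦ RootPairing.NormForm.abs_pairingIn_le_two F k l
  rcases lt_or_gt_of_ne hne with h | h
  · obtain ⟨l, hl'⟩ := key _ _ h (g ⟨j, hj⟩).2
    obtain ⟨h3, h4⟩ := hl' i j hgi hgj
    exact ⟨l, h2 l, by rw [h3, h4]; decide⟩
  · obtain ⟨l, hl'⟩ := key _ _ h (g ⟨i, hi⟩).2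
    obtain ⟨h3, h4⟩ := hl' j i hgj hgi
    exact ⟨l, h2 l, by rw [h3, h4]; decide⟩

include hθ h𝔞 in
/-- The pairing with the long simple root separates the simple roots. -/
lemma IsComplexStructure.not_integrable_of_isG2 [(rootSystem 𝔞).IsIrreducible]
    (hA : IsComplexStructure θ b A) (hG : (rootSystem 𝔞).IsG2) :
    ¬ ∀ x ∈ negSum b, ∀ y ∈ negSum b,
      ⁅A x, A y⁆ - ⁅x, y⁆ - A ⁅A x, y⁆ - A ⁅x, A y⁆ = 0 := by
  classical
  obtain ⟨i, j, hi, hj, hij, hji⟩ := RootPairing.Base.exists_support_eq_of_isG2 hG b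
  have hne : i ≠ j := by
    rintro rfl
    rw [(rootSystem 𝔞).pairingIn_same] at hij
    norm_num at hij
  have hs : b.support = {i, j} := by
    refine (Finset.eq_of_subset_of_card_le ?_ ?_).symm
    · intro k hk
      rcases Finset.mem_insert.mp hk with rfl | hk
      · exact hi
      · rwa [Finset.mem_singleton.mp hk]
    · rw [RootPairing.IsG2.card_base_support_eq_two, Finset.card_pair hne]
  -- pairings with the long simple root are at most `2`
  have h2 : ∀ k, |(rootSystem 𝔞).pairingIn ℤ k i| ≤ 2 := by
    intro k
    obtain ⟨B⟩ := (rootSystem 𝔞).exists_euclForm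
    have hlen : B.len i = 3 * B.len j := by
      have := B.pairingIn_mul_swap i j
      rw [hij, hji] at this
      push_cast at this
      linarith
    have hk : B.len k ≤ B.len i := by
      obtain ⟨l, hl, h⟩ := B.exists_mem_support_len_eq b k
      have := B.len_pos j
      rw [hs] at hl
      rcases Finset.mem_insert.mp hl with rfl | hl
      · exact h.le
      · rw [h, Finset.mem_singleton.mp hl, hlen]
        linarith
    by_cases h1 : (rootSystem 𝔞).root k = (rootSystem 𝔞).root i
    · rw [(rootSystem 𝔞).root.injective h1, (rootSystem 𝔞).pairingIn_same]
      norm_num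
    by_cases h3 : (rootSystem 𝔞).root k = -(rootSystem 𝔞).root i
    · have : k = (rootSystem 𝔞).reflectionPerm i i := by
        apply (rootSystem 𝔞).root.injective
        rw [h3, (rootSystem 𝔞).root_reflectionPerm, (rootSystem 𝔞).reflection_apply_self]
      rw [this, (rootSystem 𝔞).pairingIn_reflectionPerm_self_left, (rootSystem 𝔞).pairingIn_same]
      norm_num
    have h4 := (rootSystem 𝔞).pairingIn_pairingIn_mem_set_of_isCrystal_of_isRed' k i h1 h3
    have h5 := B.pairingIn_mul_swap k i
    have h6 := B.len_pos i
    simp only [Set.mem_insert_iff, Set.mem_singleton_iff, Prod.mk_zero_zero, Prod.mk_eq_zero,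
      Prod.mk_one_one, Prod.mk_eq_one, Prod.mk.injEq] at h4
    rcases h4 with h | h | h | h | h | h | h | h | h | h | h
    all_goals
      first
      | rw [h.1]; norm_num; done
      | (exfalso; rw [h.1, h.2] at h5; push_cast at h5; linarith)
  refine hA.not_integrable_of_separated hθ h𝔞 (RootPairing.Base.isPos_of_mem_support hi)
    fun k hk l hl hkl ↦ ⟨i, h2, ?_⟩
  rw [hs] at hk hl
  rcases Finset.mem_insert.mp hk with rfl | hk' <;> rcases Finset.mem_insert.mp hl with rfl | hl'
  · exact absurd rfl hkl
  · rw [Finset.mem_singleton.mp hl', (rootSystem 𝔞).pairingIn_same, hji]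
    decide
  · rw [Finset.mem_singleton.mp hk', (rootSystem 𝔞).pairingIn_same, hji]
    decide
  · exact absurd ((Finset.mem_singleton.mp hk').trans (Finset.mem_singleton.mp hl').symm) hkl

end Generic

end RealFlag

/-! ### Non-integrability in type `D` -/

namespace RootPairing

variable {ι M N : Type*} [AddCommGroup M] [Module ℝ M] [AddCommGroup N] [Module ℝ N]
  {P : RootPairing ι ℝ M N} [P.IsCrystallographic]

lemma pairingIn_of_root_eq_add {i j k : ι} (h : P.root k = P.root i + P.root j) (l : ι) :
    P.pairingIn ℤ k l = P.pairingIn ℤ i l + P.pairingIn ℤ j l := by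
  apply FaithfulSMul.algebraMap_injective ℤ ℝ
  rw [map_add, P.algebraMap_pairingIn, P.algebraMap_pairingIn, P.algebraMap_pairingIn,
    ← P.root_coroot'_eq_pairing, h, map_add, P.root_coroot'_eq_pairing, P.root_coroot'_eq_pairing]

lemma NormForm.pairingIn_eq_form (F : P.NormForm) (i : ι) {j : ι}
    (hj : F.form (P.root j) (P.root j) = 2) :
    (P.pairingIn ℤ i j : ℝ) = F.form (P.root i) (P.root j) := by
  have h1 := F.pairing_mul i j
  rw [← P.algebraMap_pairingIn ℤ, algebraMap_int_eq, eq_intCast, hj] at h1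
  linarith

lemma NormForm.eq_of_pairingIn_eq_two (F : P.NormForm) {i j : ι}
    (hi : F.form (P.root i) (P.root i) = 2) (hj : F.form (P.root j) (P.root j) = 2)
    (h : P.pairingIn ℤ i j = 2) : i = j := by
  have h1 := F.pairingIn_eq_form i hj
  rw [h] at h1
  push_cast at h1
  apply P.root.injective
  rw [← sub_eq_zero]
  by_contra h0
  have h2 := F.pos _ h0
  simp only [map_sub, LinearMap.sub_apply, hi, hj, ← h1, F.symm (P.root j) (P.root i)] at h2
  norm_num at h2

omit [P.IsCrystallographic] in
lemma OrthFrame.form_self_eq_two [Finite ι] [P.IsRootSystem] [P.IsReduced] {F : P.NormForm}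
    {b : P.Base} {n : ℕ} (O : OrthFrame F b n) (hl : ¬ O.IsLong) (i : ι) :
    F.form (P.root i) (P.root i) = 2 := by
  have hl' := O.long.resolve_left hl
  wlog hi : b.IsPos i generalizing i
  · have h1 := this (P.reflectionPerm i i) ((Base.IsPos.neg_iff_not b i).mpr hi)
    rw [P.root_reflectionPerm, P.reflection_apply_self] at h1
    simpa using h1
  rcases O.cases i hi with ⟨p, q, hpq, hq, h | h⟩ | ⟨p, hp, h⟩
  · rw [h]
    simp only [map_sub, LinearMap.sub_apply, O.form_self p (by omega), O.form_self q hq,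
      O.form_ne p (by omega) q hq (by omega), O.form_ne q hq p (by omega) (by omega)]
    norm_num
  · rw [h]
    simp only [map_add, LinearMap.add_apply, O.form_self p (by omega), O.form_self q hq,
      O.form_ne p (by omega) q hq (by omega), O.form_ne q hq p (by omega) (by omega)]
    norm_num
  · exact absurd h (hl' i p hp)

/-- In type `D` the root `t = e₀ + e₁` is the highest root. It has the product `1` with the simple
root `a = e₁ - e₂`. -/
lemma OrthFrame.exists_highest [Finite ι] [P.IsRootSystem] [P.IsReduced] {F : P.NormForm}
    {b : P.Base} {n : ℕ} (O : OrthFrame F b n) (hl : ¬ O.IsLong) (hn : 3 ≤ n) :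
    ∃ t a, b.IsPos t ∧ a ∈ b.support ∧ P.pairingIn ℤ t a = 1 ∧
      ∀ j, b.IsPos j → 0 ≤ P.pairingIn ℤ t j := by
  have hs := O.form_self_eq_two hl
  obtain ⟨t, ht, ht'⟩ := O.add_mem 0 1 (by omega) (by omega)
  obtain ⟨a, ha, ha'⟩ := O.exists_simple (show 1 < n by omega)
  rw [O.simple_lt (by omega)] at ha'
  have hform : ∀ {p q : ℕ}, p < n → q < n →
      F.form (O.e p) (O.e q) = if p = q then 1 else 0 := fun hp hq ↦ O.form_eq hp hq
  refine ⟨t, a, ht, ha, ?_, fun j hj ↦ ?_⟩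
  · have h1 := F.pairingIn_eq_form t (hs a)
    rw [ht', ha'] at h1
    simp only [map_sub, map_add, LinearMap.add_apply,
      hform (show 0 < n by omega) (show 1 < n by omega),
      hform (show 1 < n by omega) (show 1 < n by omega),
      hform (show 0 < n by omega) (show 1 + 1 < n by omega),
      hform (show 1 < n by omega) (show 1 + 1 < n by omega)] at h1
    norm_num at h1
    exact_mod_cast h1
  · have h1 := F.pairingIn_eq_form t (hs j)
    suffices (0 : ℝ) ≤ P.pairingIn ℤ t j by exact_mod_cast this
    rw [h1, ht']
    rcases O.cases j hj with ⟨p, q, hpq, hq, h | h⟩ | ⟨p, hp, h⟩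
    · rw [h]
      simp only [map_sub, map_add, LinearMap.add_apply,
        hform (show 0 < n by omega) hq, hform (show 1 < n by omega) hq,
        hform (show 0 < n by omega) (show p < n by omega),
        hform (show 1 < n by omega) (show p < n by omega)]
      split_ifs <;> first | omega | norm_num
    · rw [h]
      simp only [map_add, LinearMap.add_apply,
        hform (show 0 < n by omega) hq, hform (show 1 < n by omega) hq,
        hform (show 0 < n by omega) (show p < n by omega),
        hform (show 1 < n by omega) (show p < n by omega)]
      split_ifs <;> norm_num
    · exact absurd h (O.long.resolve_left hl j p hp)

end RootPairing

namespace RealFlag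

section SimplyLaced

variable {𝔤 : Type*} [LieRing 𝔤] [LieAlgebra ℝ 𝔤] [FiniteDimensional ℝ 𝔤]
  [LieAlgebra.IsKilling ℝ 𝔤] {𝔞 : LieSubalgebra ℝ 𝔤} [𝔞.IsCartanSubalgebra]
  [LieModule.IsTriangularizable ℝ 𝔞 𝔤] {θ : 𝔤 ≃ₗ⁅ℝ⁆ 𝔤} {b : (rootSystem 𝔞).Base}
  (hθ : IsCartanInvolution θ) (h𝔞 : ∀ H ∈ 𝔞, θ H = -H)
  {A : 𝔤 →ₗ[ℝ] 𝔤}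

include hθ h𝔞 in
/-- Let `t` be the highest root, `Z = V.f t`, `a` a simple root with `⟨t, a⟩ = 1` and `S` the span of
the vectors `V.f δ` for the positive roots `δ` congruent to `a`. The equation
`[X, [Y, A Z]] = ω(X, Y) Z` defines a symmetric form `ω` on `S`, for which an integrable `A` is skew.
The component of `A (V.f a)` off `V.f a` is in the radical of `ω`, hence so is `V.f a`. But `A Z` has
a component at some root `β` other than `t`, and `γ = t - a - β` is congruent to `a`, with
`ω(V.f a, V.f γ) ≠ 0`. -/
lemma IsComplexStructure.not_integrable_of_simplyLaced (hA : IsComplexStructure θ b A)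
    (F : (rootSystem 𝔞).NormForm)
    (hs : ∀ i, F.form ((rootSystem 𝔞).root i) ((rootSystem 𝔞).root i) = 2) {t a : 𝔞.root}
    (ht : b.IsPos t) (ha : a ∈ b.support) (hta : (rootSystem 𝔞).pairingIn ℤ t a = 1)
    (hpos : ∀ j, b.IsPos j → 0 ≤ (rootSystem 𝔞).pairingIn ℤ t j) :
    ¬ ∀ x ∈ negSum b, ∀ y ∈ negSum b,
      ⁅A x, A y⁆ - ⁅x, y⁆ - A ⁅A x, y⁆ - A ⁅x, A y⁆ = 0 := by
  intro hN
  obtain ⟨V⟩ := exists_rootVectors hθ h𝔞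
  have h2 := fun i j ↦ RootPairing.NormForm.abs_pairingIn_le_two F i j
  have hsymm : ∀ i j, (rootSystem 𝔞).pairingIn ℤ i j = (rootSystem 𝔞).pairingIn ℤ j i := by
    intro i j
    have h : ((rootSystem 𝔞).pairingIn ℤ i j : ℝ) = (rootSystem 𝔞).pairingIn ℤ j i := by
      rw [F.pairingIn_eq_form _ (hs _), F.pairingIn_eq_form _ (hs _), F.symm]
    exact_mod_cast h
  have hadd : ∀ {i j k : 𝔞.root},
      (rootSystem 𝔞).root k = (rootSystem 𝔞).root i + (rootSystem 𝔞).root j → ∀ l,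
      (rootSystem 𝔞).pairingIn ℤ k l =
        (rootSystem 𝔞).pairingIn ℤ i l + (rootSystem 𝔞).pairingIn ℤ j l :=
    fun h l ↦ RootPairing.pairingIn_of_root_eq_add h l
  have hself : ∀ i, (rootSystem 𝔞).pairingIn ℤ i i = 2 := fun i ↦ (rootSystem 𝔞).pairingIn_same ℤ i
  have hap : b.IsPos a := RootPairing.Base.isPos_of_mem_support ha
  have heq : ∀ {i}, (rootSystem 𝔞).pairingIn ℤ t i = 2 → i = t := fun h ↦
    (F.eq_of_pairingIn_eq_two (hs _) (hs _) h).symm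
  -- a positive root orthogonal to `t` does not have a positive product with `a`
  have hort : ∀ {β}, b.IsPos β → (rootSystem 𝔞).pairingIn ℤ t β ≤ 0 →
      (rootSystem 𝔞).pairingIn ℤ β a ≠ 1 := by
    intro β hβ h h1
    have hne : β ≠ a := by
      rintro rfl
      rw [hself] at h1
      norm_num at h1
    obtain ⟨μ, hμ⟩ := (rootSystem 𝔞).root_sub_root_mem_of_pairingIn_pos (i := β) (j := a)
      (by rw [h1]; norm_num) hne
    have h3 := hpos μ (hβ.sub ha hμ)
    have h4 := hadd (i := μ) (j := a) (k := β) (by rw [hμ]; abel) t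
    rw [hsymm μ, hsymm a, hsymm β] at h4
    omega
  -- `Z` is central in `𝔫⁻`
  have hZ : ∀ x ∈ negSum b, ⁅x, V.f t⁆ = 0 := by
    intro x hx
    have key : negSum b ≤ LinearMap.ker (LieAlgebra.ad ℝ 𝔤 (V.f t) : 𝔤 →ₗ[ℝ] 𝔤) := by
      refine V.negSum_le hθ h𝔞 fun i hi ↦ ?_
      by_contra h0
      obtain ⟨k, hk⟩ := V.exists_root_of_lie_f_ne_zero ht hi h0
      have h3 := hadd hk t
      have h4 := h2 k t
      have h5 := hpos i hi
      rw [hself, hsymm i] at h3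
      rw [abs_le] at h4
      have h6 : (rootSystem 𝔞).pairingIn ℤ t k = 2 := by rw [hsymm]; omega
      rw [heq h6] at hk
      exact (rootSystem 𝔞).ne_zero i (left_eq_add.mp hk)
    have h3 : ⁅V.f t, x⁆ = 0 := key hx
    rw [← lie_skew, h3, neg_zero]
  have hft := V.f_mem_negSum (b := b) h𝔞 ht
  set W := A (V.f t) with hW
  have hWn : W ∈ negSum b := hA.map_mem _ hft
  -- the equation `N_A(x, Z) = 0`
  have hAW : ∀ x ∈ negSum b, A ⁅x, W⁆ = ⁅A x, W⁆ := by
    intro x hx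
    have h3 := hN x hx _ hft
    rw [← hW, hZ x hx, hZ _ (hA.map_mem _ hx), map_zero, sub_zero, sub_zero, sub_eq_zero] at h3
    exact h3.symm
  -- the roots congruent to `a`
  set C : Set 𝔞.root := {δ | b.IsPos δ ∧ (rootSystem 𝔞).Congr a δ} with hC
  have hC1 : ∀ δ ∈ C, 1 ≤ (rootSystem 𝔞).pairingIn ℤ t δ := by
    intro δ hδ
    have h3 := hδ.2 t
    have h4 := hpos δ hδ.1
    rw [hsymm a, hta, hsymm δ] at h3
    obtain ⟨r, hr⟩ := h3
    omega
  have hC0 : ∀ δ ∈ C, δ ≠ a → (rootSystem 𝔞).pairingIn ℤ δ a = 0 := by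
    intro δ hδ hδa
    refine hδ.2.symm.pairingIn_eq_zero (fun h ↦ hδa ((rootSystem 𝔞).root.injective h)) fun h ↦ ?_
    exact (b.isPos_iff_of_root_eq_neg h).mp hδ.1 hap
  set S := Submodule.span ℝ (V.f '' C) with hS
  have hSn : S ≤ negSum b := by
    refine Submodule.span_le.mpr ?_
    rintro _ ⟨δ, hδ, rfl⟩
    exact V.f_mem_negSum h𝔞 hδ.1
  have hSA : ∀ x ∈ S, A x ∈ S := by
    intro x hx
    have : S ≤ S.comap A := by
      refine Submodule.span_le.mpr ?_
      rintro _ ⟨δ, hδ, rfl⟩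
      refine V.mem_span_f hθ h𝔞 (hA.map_mem _ (V.f_mem_negSum h𝔞 hδ.1)) fun j hj hj0 ↦ ⟨hj, ?_⟩
      exact hδ.2.trans (hA.congr_of_coord_ne_zero V hθ h𝔞 h2 hδ.1 hj0)
    exact this hx
  -- the double brackets are multiples of the highest root vector
  have hdouble : ∀ δ ∈ C, ∀ δ' ∈ C, ∀ β, b.IsPos β → ⁅V.f δ, ⁅V.f δ', V.f β⁆⁆ ≠ 0 →
      (rootSystem 𝔞).root t =
        (rootSystem 𝔞).root δ + ((rootSystem 𝔞).root δ' + (rootSystem 𝔞).root β) ∧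
      ∃ c : ℝ, ⁅V.f δ, ⁅V.f δ', V.f β⁆⁆ = c • V.f t := by
    intro δ hδ δ' hδ' β hβ h
    have h0 : ⁅V.f δ', V.f β⁆ ≠ 0 := fun h' ↦ h (by rw [h', lie_zero])
    obtain ⟨k, hk⟩ := V.exists_root_of_lie_f_ne_zero hδ'.1 hβ h0
    obtain ⟨c, hc0, hc⟩ := V.exists_lie_f hθ h𝔞 hk
    rw [hc, lie_smul] at h ⊢
    have hkp := hδ'.1.add hβ hk
    obtain ⟨l, hl⟩ := V.exists_root_of_lie_f_ne_zero hδ.1 hkp (smul_ne_zero_iff.mp h).2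
    obtain ⟨c', -, hc'⟩ := V.exists_lie_f hθ h𝔞 hl
    have h3 := hadd hk t
    have h4 := hadd hl t
    have h5 := hC1 δ hδ
    have h6 := hC1 δ' hδ'
    have h7 := hpos β hβ
    have h8 := h2 l t
    rw [hsymm δ', hsymm β] at h3
    rw [hsymm δ] at h4
    rw [abs_le] at h8
    have h9 : l = t := heq (by rw [hsymm]; omega)
    rw [h9] at hl hc'
    refine ⟨by rw [hl, hk], c * c', ?_⟩
    rw [hc', smul_smul]
  have hdouble0 : ∀ δ ∈ C, ∀ δ' ∈ C, ∀ β, b.IsPos β → (δ ≠ a ∧ δ' ≠ a ∨ δ = a ∧ δ' = a) →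
      ⁅V.f δ, ⁅V.f δ', V.f β⁆⁆ = 0 := by
    intro δ hδ δ' hδ' β hβ hcases
    by_contra h
    obtain ⟨h3, -⟩ := hdouble δ hδ δ' hδ' β hβ h
    have h4 : ∀ l, (rootSystem 𝔞).pairingIn ℤ t l = (rootSystem 𝔞).pairingIn ℤ δ l +
        ((rootSystem 𝔞).pairingIn ℤ δ' l + (rootSystem 𝔞).pairingIn ℤ β l) := by
      intro l
      apply FaithfulSMul.algebraMap_injective ℤ ℝ
      simp only [map_add, (rootSystem 𝔞).algebraMap_pairingIn,
        ← (rootSystem 𝔞).root_coroot'_eq_pairing, h3]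
    have h5 := h4 a
    have h6 := h4 t
    have h7 := hC1 δ hδ
    have h8 := hC1 δ' hδ'
    rw [hself, hsymm δ, hsymm δ', hsymm β] at h6
    rcases hcases with ⟨hδa, hδa'⟩ | ⟨hδa, hδa'⟩
    · rw [hta, hC0 δ hδ hδa, hC0 δ' hδ' hδa'] at h5
      exact hort hβ (by omega) (by omega)
    · have h9 := h2 β a
      rw [hta, hδa, hδa', hself] at h5
      rw [abs_le] at h9
      omega
  have hmem : ∀ x ∈ S, ∀ y ∈ S, ∀ w ∈ negSum b, ⁅x, ⁅y, w⁆⁆ ∈ Submodule.span ℝ {V.f t} := by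
    intro x hx y hy w hw
    induction hx using Submodule.span_induction with
    | zero => rw [zero_lie]; exact zero_mem _
    | add x x' _ _ h h' => rw [add_lie]; exact add_mem h h'
    | smul c x _ h => rw [smul_lie]; exact Submodule.smul_mem _ _ h
    | mem x hx =>
      obtain ⟨δ, hδ, rfl⟩ := hx
      induction hy using Submodule.span_induction with
      | zero => rw [zero_lie, lie_zero]; exact zero_mem _
      | add y y' _ _ h h' => rw [add_lie, lie_add]; exact add_mem h h'
      | smul c y _ h => rw [smul_lie, lie_smul]; exact Submodule.smul_mem _ _ h
      | mem y hy =>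
        obtain ⟨δ', hδ', rfl⟩ := hy
        have key : negSum b ≤ (Submodule.span ℝ {V.f t}).comap
            ((LieAlgebra.ad ℝ 𝔤 (V.f δ) : 𝔤 →ₗ[ℝ] 𝔤) ∘ₗ
              (LieAlgebra.ad ℝ 𝔤 (V.f δ') : 𝔤 →ₗ[ℝ] 𝔤)) := by
          refine V.negSum_le hθ h𝔞 fun β hβ ↦ ?_
          change ⁅V.f δ, ⁅V.f δ', V.f β⁆⁆ ∈ Submodule.span ℝ {V.f t}
          by_cases h0 : ⁅V.f δ, ⁅V.f δ', V.f β⁆⁆ = 0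
          · rw [h0]
            exact zero_mem _
          · obtain ⟨-, c, hc⟩ := hdouble δ hδ δ' hδ' β hβ h0
            exact Submodule.mem_span_singleton.mpr ⟨c, hc.symm⟩
        exact key hw
  -- the brackets of elements of `S` are multiples of the highest root vector as well
  have hcomm : ∀ x ∈ S, ∀ y ∈ S, ⁅⁅x, y⁆, W⁆ = 0 := by
    intro x hx y hy
    induction hx using Submodule.span_induction with
    | zero => rw [zero_lie, zero_lie]
    | add x x' _ _ h h' => rw [add_lie, add_lie, h, h', add_zero]
    | smul c x _ h => rw [smul_lie, smul_lie, h, smul_zero]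
    | mem x hx =>
      obtain ⟨δ, hδ, rfl⟩ := hx
      induction hy using Submodule.span_induction with
      | zero => rw [lie_zero, zero_lie]
      | add y y' _ _ h h' => rw [lie_add, add_lie, h, h', add_zero]
      | smul c y _ h => rw [lie_smul, smul_lie, h, smul_zero]
      | mem y hy =>
        obtain ⟨δ', hδ', rfl⟩ := hy
        by_cases h0 : ⁅V.f δ, V.f δ'⁆ = 0
        · rw [h0, zero_lie]
        obtain ⟨k, hk⟩ := V.exists_root_of_lie_f_ne_zero hδ.1 hδ'.1 h0
        obtain ⟨c, -, hc⟩ := V.exists_lie_f hθ h𝔞 hk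
        have h3 := hadd hk t
        have h4 := hC1 δ hδ
        have h5 := hC1 δ' hδ'
        have h6 := h2 k t
        rw [hsymm δ, hsymm δ'] at h3
        rw [abs_le] at h6
        rw [hc, heq (i := k) (by rw [hsymm]; omega), smul_lie, ← lie_skew, hZ W hWn, neg_zero,
          smul_zero]
  -- the form `ω`
  set ω : 𝔤 → 𝔤 → ℝ := fun x y ↦ V.coord t ⁅x, ⁅y, W⁆⁆ with hω
  have hωZ : ∀ x ∈ S, ∀ y ∈ S, ⁅x, ⁅y, W⁆⁆ = ω x y • V.f t := by
    intro x hx y hy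
    obtain ⟨c, hc⟩ := Submodule.mem_span_singleton.mp (hmem x hx y hy W hWn)
    simp only [hω]
    rw [← hc, map_smul, V.coord_self hθ, smul_eq_mul, mul_one]
  have hω_add : ∀ x x' y, ω (x + x') y = ω x y + ω x' y := fun x x' y ↦ by
    simp only [hω, add_lie, map_add]
  have hω_smul : ∀ (c : ℝ) x y, ω (c • x) y = c * ω x y := fun c x y ↦ by
    simp only [hω, smul_lie, map_smul, smul_eq_mul]
  have hω_symm : ∀ x ∈ S, ∀ y ∈ S, ω x y = ω y x := by
    intro x hx y hy
    simp only [hω]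
    rw [leibniz_lie, hcomm x hx y hy, zero_add]
  -- `A Z` is not a multiple of `Z`
  obtain ⟨β, hβ, hβt, hβW⟩ : ∃ β, b.IsPos β ∧ β ≠ t ∧ V.coord β W ≠ 0 := by
    by_contra! h
    have h3 := V.mem_span_f hθ h𝔞 hWn (s := {t}) fun j hj hj0 ↦ by
      by_contra hjt
      exact hj0 (h j hj hjt)
    rw [Set.image_singleton] at h3
    obtain ⟨c, hc⟩ := Submodule.mem_span_singleton.mp h3
    have h4 := hA.sq _ hft
    rw [← hW, ← hc, map_smul, ← hW, ← hc, smul_smul] at h4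
    have h5 := congrArg (V.coord t) h4
    rw [map_smul, map_neg, V.coord_self hθ, smul_eq_mul] at h5
    nlinarith [mul_self_nonneg c]
  -- the coordinate at `β` of the equation `N_A(x, [y, A Z]) = 0`
  have hω_skew : ∀ x ∈ S, ∀ y ∈ S, ω (A x) y = -ω x (A y) := by
    intro x hx y hy
    have hyW : ⁅y, W⁆ ∈ negSum b := lie_mem_negSum b (hSn hy) hWn
    have h3 := hN x (hSn hx) _ hyW
    rw [hAW y (hSn hy), hωZ _ (hSA x hx) _ (hSA y hy), hωZ _ hx _ hy, hωZ _ (hSA x hx) _ hy,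
      hωZ _ hx _ (hSA y hy), map_smul, map_smul, ← hW] at h3
    have h4 := congrArg (V.coord β) h3
    simp only [map_sub, map_smul, V.coord_of_ne h𝔞 hβt, smul_eq_mul, mul_zero, map_zero, sub_zero,
      zero_sub] at h4
    have h5 : (ω (A x) y + ω x (A y)) * V.coord β W = 0 := by linarith
    linarith [(mul_eq_zero.mp h5).resolve_right hβW]
  have haC : a ∈ C := ⟨hap, RootPairing.Congr.refl a⟩
  have haS : V.f a ∈ S := Submodule.subset_span ⟨a, haC, rfl⟩
  have haa : ω (V.f a) (V.f a) = 0 := by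
    have key : negSum b ≤ LinearMap.ker ((LieAlgebra.ad ℝ 𝔤 (V.f a) : 𝔤 →ₗ[ℝ] 𝔤) ∘ₗ
        (LieAlgebra.ad ℝ 𝔤 (V.f a) : 𝔤 →ₗ[ℝ] 𝔤)) :=
      V.negSum_le hθ h𝔞 fun β hβ ↦ hdouble0 a haC a haC β hβ (Or.inr ⟨rfl, rfl⟩)
    have h3 : ⁅V.f a, ⁅V.f a, W⁆⁆ = 0 := key hWn
    simp only [hω]
    rw [h3, map_zero]
  -- the component of `A (f a)` off `f a` is in the radical of `ω`
  set c := V.coord a (A (V.f a)) with hc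
  set h := A (V.f a) - c • V.f a with hh
  have hAa : A (V.f a) = c • V.f a + h := by rw [hh]; abel
  have hhS' : h ∈ Submodule.span ℝ (V.f '' (C \ {a})) := by
    have hfa := V.f_mem_negSum (b := b) h𝔞 hap
    refine V.mem_span_f hθ h𝔞 (b := b)
      (sub_mem (hA.map_mem _ hfa) (Submodule.smul_mem _ _ hfa)) fun j hj hj0 ↦ ?_
    rw [map_sub, map_smul, smul_eq_mul] at hj0
    have hja : j ≠ a := by
      rintro rfl
      exact hj0 (by rw [V.coord_self hθ, mul_one, sub_self])
    rw [V.coord_of_ne h𝔞 hja, mul_zero, sub_zero] at hj0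
    exact ⟨⟨hj, hA.congr_of_coord_ne_zero V hθ h𝔞 h2 hap hj0⟩, hja⟩
  have hhS : h ∈ S := Submodule.span_mono (Set.image_mono Set.sdiff_subset) hhS'
  have hha : ω h (V.f a) = 0 := by
    have h3 := hω_skew _ haS _ haS
    rw [← hω_symm _ (hSA _ haS) _ haS, hAa, hω_add, hω_smul, haa] at h3
    linarith
  have hω_h : ∀ v ∈ S, ω h v = 0 := by
    intro v hv
    have hhC : ∀ x ∈ Submodule.span ℝ (V.f '' (C \ {a})), ∀ δ' ∈ C, δ' ≠ a → ∀ w ∈ negSum b,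
        ⁅x, ⁅V.f δ', w⁆⁆ = 0 := by
      intro x hx δ' hδ' hδa' w hw
      induction hx using Submodule.span_induction with
      | zero => rw [zero_lie]
      | add x x' _ _ h h' => rw [add_lie, h, h', add_zero]
      | smul c x _ h => rw [smul_lie, h, smul_zero]
      | mem x hx =>
        obtain ⟨δ, ⟨hδ, hδa⟩, rfl⟩ := hx
        have key : negSum b ≤ LinearMap.ker ((LieAlgebra.ad ℝ 𝔤 (V.f δ) : 𝔤 →ₗ[ℝ] 𝔤) ∘ₗ
            (LieAlgebra.ad ℝ 𝔤 (V.f δ') : 𝔤 →ₗ[ℝ] 𝔤)) :=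
          V.negSum_le hθ h𝔞 fun β hβ ↦ hdouble0 δ hδ δ' hδ' β hβ (Or.inl ⟨hδa, hδa'⟩)
        exact key hw
    have key : S ≤ LinearMap.ker (V.coord t ∘ₗ (LieAlgebra.ad ℝ 𝔤 h : 𝔤 →ₗ[ℝ] 𝔤) ∘ₗ
        (LieAlgebra.ad ℝ 𝔤 W : 𝔤 →ₗ[ℝ] 𝔤)) := by
      refine Submodule.span_le.mpr ?_
      rintro _ ⟨δ', hδ', rfl⟩
      change V.coord t ⁅h, ⁅W, V.f δ'⁆⁆ = 0
      rw [← lie_skew W, lie_neg, map_neg, neg_eq_zero]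
      rcases eq_or_ne δ' a with rfl | hδa'
      · exact hha
      · rw [hhC h hhS' δ' hδ' hδa' W hWn, map_zero]
    have h3 : V.coord t ⁅h, ⁅W, v⁆⁆ = 0 := key hv
    rw [← lie_skew W, lie_neg, map_neg, neg_eq_zero] at h3
    exact h3
  -- evaluate `ω(A² (V.f a), v)`, where `A² (V.f a) = c² V.f a + c h + A h`
  have hrad : ∀ v ∈ S, ω (V.f a) v = 0 := by
    intro v hv
    have h3 := hA.sq _ (hSn haS)
    rw [hAa, map_add, map_smul, hAa] at h3
    have h4 := congrArg (fun x ↦ ω x v) h3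
    have h5 := hω_skew _ hhS v hv
    rw [hω_h _ (hSA _ hv), neg_zero] at h5
    beta_reduce at h4
    rw [hω_add, hω_smul, hω_add, hω_smul, h5, hω_h v hv, ← neg_one_smul ℝ (V.f a), hω_smul] at h4
    have h6 : (c ^ 2 + 1) * ω (V.f a) v = 0 := by linarith
    exact (mul_eq_zero.mp h6).resolve_left (by positivity)
  -- a root vector that pairs with that of `a`, using the component of `A Z` at `β`
  have hcongr := hA.congr_of_coord_ne_zero V hθ h𝔞 h2 ht hβW
  have htβ : (rootSystem 𝔞).pairingIn ℤ t β = 0 := by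
    refine hcongr.pairingIn_eq_zero (fun h ↦ hβt ((rootSystem 𝔞).root.injective h.symm)) fun h ↦ ?_
    exact (b.isPos_iff_of_root_eq_neg h).mp ht hβ
  have hβa : (rootSystem 𝔞).pairingIn ℤ β a = -1 := by
    obtain ⟨r, hr⟩ := hcongr a
    have h3 := h2 β a
    have h4 := hort hβ htβ.le
    rw [abs_le] at h3
    omega
  -- the roots `l = t - a` and `γ = t - a - β`
  obtain ⟨l, hl⟩ := (rootSystem 𝔞).root_sub_root_mem_of_pairingIn_pos (i := t) (j := a)
    (by rw [hta]; norm_num) (by rintro rfl; rw [hself] at hta; norm_num at hta)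
  have hl' : ∀ k, (rootSystem 𝔞).pairingIn ℤ t k =
      (rootSystem 𝔞).pairingIn ℤ l k + (rootSystem 𝔞).pairingIn ℤ a k :=
    hadd (by rw [hl]; abel)
  have hlβ : (rootSystem 𝔞).pairingIn ℤ l β = 1 := by
    have h3 := hl' β
    rw [htβ, hsymm a, hβa] at h3
    omega
  obtain ⟨γ, hγ⟩ := (rootSystem 𝔞).root_sub_root_mem_of_pairingIn_pos (i := l) (j := β)
    (by rw [hlβ]; norm_num) (by rintro rfl; rw [hself] at hlβ; norm_num at hlβ)
  have hγ' : ∀ k, (rootSystem 𝔞).pairingIn ℤ l k =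
      (rootSystem 𝔞).pairingIn ℤ γ k + (rootSystem 𝔞).pairingIn ℤ β k :=
    hadd (by rw [hγ]; abel)
  have htγ : (rootSystem 𝔞).pairingIn ℤ γ t = 1 := by
    have h3 := hl' t
    have h4 := hγ' t
    rw [hself, hsymm a, hta] at h3
    rw [hsymm β, htβ] at h4
    omega
  have hγC : γ ∈ C := by
    constructor
    · by_contra hγn
      have h3 := hpos _ ((RootPairing.Base.IsPos.neg_iff_not b γ).mpr hγn)
      rw [hsymm] at h3
      change 0 ≤ (rootSystem 𝔞).pairingIn ℤ ((rootSystem 𝔞).reflectionPerm γ γ) t at h3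
      rw [(rootSystem 𝔞).pairingIn_reflectionPerm_self_left, htγ] at h3
      norm_num at h3
    · intro k
      obtain ⟨r, hr⟩ := hcongr k
      have h3 := hl' k
      have h4 := hγ' k
      refine ⟨(rootSystem 𝔞).pairingIn ℤ a k - r, ?_⟩
      omega
  obtain ⟨c₁, hc₁, hc₁'⟩ := V.exists_lie_f hθ h𝔞 (i := γ) (j := β) (k := l) (by rw [hγ]; abel)
  obtain ⟨c₂, hc₂, hc₂'⟩ := V.exists_lie_f hθ h𝔞 (i := a) (j := l) (k := t) (by rw [hl]; abel)
  have key : negSum b ≤ LinearMap.eqLocus ((LieAlgebra.ad ℝ 𝔤 (V.f a) : 𝔤 →ₗ[ℝ] 𝔤) ∘ₗ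
      (LieAlgebra.ad ℝ 𝔤 (V.f γ) : 𝔤 →ₗ[ℝ] 𝔤)) ((V.coord β).smulRight ((c₁ * c₂) • V.f t)) := by
    refine V.negSum_le hθ h𝔞 fun j hj ↦ ?_
    change ⁅V.f a, ⁅V.f γ, V.f j⁆⁆ = V.coord β (V.f j) • (c₁ * c₂) • V.f t
    rcases eq_or_ne β j with rfl | hβj
    · rw [V.coord_self hθ, one_smul, hc₁', lie_smul, hc₂', smul_smul]
    · rw [V.coord_of_ne h𝔞 hβj, zero_smul]
      by_contra h0
      obtain ⟨h3, -⟩ := hdouble a haC γ hγC j hj h0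
      apply hβj ((rootSystem 𝔞).root.injective ?_)
      rw [hl] at hγ
      rw [h3] at hγ
      rw [← sub_eq_zero]
      have h4 := sub_eq_zero.mpr hγ
      rw [← h4]
      abel
  have h3 : ⁅V.f a, ⁅V.f γ, W⁆⁆ = V.coord β W • (c₁ * c₂) • V.f t := key hWn
  have h4 := hrad (V.f γ) (Submodule.subset_span ⟨γ, hγC, rfl⟩)
  simp only [hω] at h4
  rw [h3, map_smul, map_smul, V.coord_self hθ, smul_eq_mul, smul_eq_mul, mul_one] at h4
  exact mul_ne_zero hβW (mul_ne_zero hc₁ hc₂) h4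

include hθ h𝔞 in
lemma IsComplexStructure.not_integrable [(rootSystem 𝔞).IsIrreducible]
    (hA : IsComplexStructure θ b A) :
    ¬ ∀ x ∈ negSum b, ∀ y ∈ negSum b,
      ⁅A x, A y⁆ - ⁅x, y⁆ - A ⁅A x, y⁆ - A ⁅x, A y⁆ = 0 := by
  rcases hA.admissible hθ h𝔞 with hG | ⟨F, n, O, -⟩
  · exact hA.not_integrable_of_isG2 hθ h𝔞 hG
  by_cases hl : O.IsLong
  · exact hA.not_integrable_of_isLong hθ h𝔞 O hl
  · obtain ⟨t, a, ht, ha, hta, hpos⟩ := O.exists_highest hl (O.three_le hl)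
    exact hA.not_integrable_of_simplyLaced hθ h𝔞 F (O.form_self_eq_two hl) ht ha hta hpos

end SimplyLaced

end RealFlag

theorem mainTheorem4 {𝔤 : Type*} [LieRing 𝔤] [LieAlgebra ℝ 𝔤] [FiniteDimensional ℝ 𝔤]
    [LieAlgebra.IsSimple ℂ (ℂ ⊗[ℝ] 𝔤)]
    (θ : 𝔤 ≃ₗ⁅ℝ⁆ 𝔤) (hθ : RealFlag.IsCartanInvolution θ)
    (𝔞 : LieSubalgebra ℝ 𝔤) [𝔞.IsCartanSubalgebra] [LieModule.IsTriangularizable ℝ 𝔞 𝔤]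
    (h𝔞 : ∀ H ∈ 𝔞, θ H = -H)
    (b : (LieAlgebra.IsKilling.rootSystem 𝔞).Base) :
    (Nonempty (RealFlag.InvariantAlmostComplexStructure θ b) ↔
      RealFlag.HasCartanMatrix b (CartanMatrix.A 3) ∨
      RealFlag.HasCartanMatrix b (CartanMatrix.B 2) ∨
      RealFlag.HasCartanMatrix b CartanMatrix.G₂ ∨
      (∃ l : ℕ, 2 ≤ l ∧ Even l ∧ RealFlag.HasCartanMatrix b (CartanMatrix.C l)) ∨
      (∃ l : ℕ, 4 ≤ l ∧ RealFlag.HasCartanMatrix b (CartanMatrix.D l))) ∧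
    ∀ 𝒥 : RealFlag.InvariantAlmostComplexStructure θ b, ¬ 𝒥.IsIntegrable := by
  obtain ⟨V⟩ := RealFlag.exists_rootVectors hθ h𝔞
  have hcartan := RootPairing.Base.admissible_iff (b := b)
  refine ⟨Iff.trans ⟨?_, ?_⟩ hcartan, fun 𝒥 hint ↦ ?_⟩
  · rintro ⟨𝒥⟩
    obtain ⟨A, hA, -⟩ := 𝒥.exists_isComplexStructure
    exact hA.admissible hθ h𝔞
  · rintro (hG | ⟨F, n, O, hE⟩)
    · exact (RealFlag.hasPairing_of_isG2 V hθ h𝔞 hG).nonempty V hθ h𝔞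
    · exact (RealFlag.hasPairing_of_orthFrame O V hθ h𝔞 hE).nonempty V hθ h𝔞
  · obtain ⟨A, hA, hA'⟩ := 𝒥.exists_isComplexStructure
    refine hA.not_integrable hθ h𝔞 fun x hx y hy ↦ ?_
    have h := congrArg Subtype.val (hint ⟨x, hx⟩ ⟨y, hy⟩)
    rw [RealFlag.InvariantAlmostComplexStructure.nijenhuis] at h
    simp only [AddSubgroupClass.coe_sub, LieSubalgebra.coe_bracket, ← hA'] at h
    exact h
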